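/- Let $\mathcal R(s)=\displaystyle\int_{0\swarrow 1}\frac{x^{-s}e^{\pi i x^2}}{e^{\pi i x}-e^{-\pi i x}}\,dx$ be Riemann's auxiliary function, where $x^{-s}$ is the principal branch and the path is the line of slope $1$ through $1/2$, run from the upper right to the lower left. Then $\mathcal R$ is an entire function. For $\frac12<\alpha\le 1$ and $T>0$ let $N(\alpha,T)$ be the number of zeros $\rho=\beta+i\gamma$ of $\mathcal R(s)$ with $\alpha\le\beta\le1$ and $0<\gamma\le T$, counted with multiplicity. There is an absolute constant $C$ such that for all $\frac12<\alpha\le1$ and all $T\ge2$ the number $N(\alpha,T)$ is finite and \[N(\alpha,T)\le C\,T^{\frac32-\alpha}(\log T)^3 .\] -/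

import Mathlib

open Complex MeasureTheory

/-- The integrand `x^{-s} e^{π i x²} / (e^{π i x} - e^{-π i x})` of Riemann's auxiliary function,
with the principal branch of `x^{-s}`. -/
noncomputable def riemannAuxIntegrand (s x : ℂ) : ℂ :=
  x ^ (-s) * exp (Real.pi * I * x ^ 2) / (exp (Real.pi * I * x) - exp (-(Real.pi * I * x)))

/-- The unit direction `e^{π i / 4}`, pointing up and to the right with slope one. -/
noncomputable def diagDir : ℂ := exp (Real.pi / 4 * I)

/-- Riemann's auxiliary function
`R(s) = ∫_{0 ↙ 1} x^{-s} e^{π i x²} / (e^{π i x} - e^{-π i x}) dx`.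
The path `0 ↙ 1` is the straight line of slope one through the point `1/2`, run from the upper right
to the lower left (whence the minus sign below); it avoids the cut `(-∞, 0]` of the principal
branch and the poles of the integrand. -/
noncomputable def riemannAux (s : ℂ) : ℂ :=
  -∫ r : ℝ, riemannAuxIntegrand s (1 / 2 + r * diagDir) * diagDir

/-- The zeros `ρ = β + iγ` of `R` with `α ≤ β ≤ 1` and `0 < γ ≤ T`. -/
def riemannAuxZeros (α T : ℝ) : Set ℂ :=
  {ρ : ℂ | riemannAux ρ = 0 ∧ α ≤ ρ.re ∧ ρ.re ≤ 1 ∧ 0 < ρ.im ∧ ρ.im ≤ T}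

/-- `N(α, T)`: the number of zeros in `riemannAuxZeros α T`, counted with multiplicity. -/
noncomputable def riemannAuxCount (α T : ℝ) : ℕ :=
  ∑ᶠ ρ ∈ riemannAuxZeros α T, analyticOrderNatAt riemannAux ρ

/-! Moving the path across the poles 1, ..., N gives R(s) = ∑_{n ≤ N} n^{-s} minus the upward
integral along the line through N + 1/2 (`riemannAux_eq_sum_sub`). For N = ⌊√(t/2π)⌋ that line
passes within 1/2 of the saddle point √(t/2π), the integrand is dominated by a Gaussian, and the
remainder is O(t^{-σ/2}) (`exists_norm_riemannAux_sub_sum_le`). So R behaves like a partial sum of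
zeta of length about √t.

The zeros are counted by mollifying. On a block T ≤ t ≤ 2T let M be the sum of μ(d) d^{-s} over d ≤
X, with X of order √T. The main part of RM has no coefficients at 1 < n ≤ X, so the diagonal part of
the mean square of 1 - RM is O(T^{3/2-σ} (log T)^2); here `mollifiedDiagonal_le`, which rests on |∑
μ(n)/n| ≤ 1, saves two logarithms over the divisor bound. For σ ≤ 3/4 the off-diagonal part is
O(T^{2-2σ} (log T)^4), which is admissible once T^{α-1/2} ≥ (log T)^2.

The function f = RM(2 - RM) = 1 - (1 - RM)^2 vanishes at the zeros of R, and log|f| ≤ |1 - RM|^2.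
Jensen's formula is applied in the discs with centre 2 + it and radius 2 - α + δ, δ = 1/log T, and
averaged over t (`sum_mult_le_of_mean_le`). Each zero contributes at least δ/8 for a set of t of
length √δ, while the decay of the mean square away from the leftmost point of the circle gains a
factor of order √δ. Hence δ^{3/2} N ≪ δ^{1/2} T^{3/2-α} (log T)^2, which is the exponent 3 of the
logarithm.

If T^{α-1/2} < (log T)^2, Jensen's formula for R itself gives N ≪ T log T, which suffices. The
dyadic blocks sum geometrically because 3/2 - α ≥ 1/2. -/

/-! ### Lines of slope one and the denominator of the integrand -/

/-- The point `a + u(1 + i)` of the line of slope one through the real point `a`. -/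
def diagPoint (a u : ℝ) : ℂ := ⟨a + u, u⟩

theorem diagPoint_eq (a u : ℝ) : diagPoint a u = a + u * (1 + I) := by
  apply Complex.ext <;> simp [diagPoint]

theorem diagDir_eq : diagDir = ((Real.sqrt 2 / 2 : ℝ) : ℂ) * (1 + I) := by
  unfold diagDir
  rw [show (Real.pi / 4 * I : ℂ) = ((Real.pi / 4 : ℝ) : ℂ) * I by push_cast; ring, exp_mul_I,
    ← ofReal_cos, ← ofReal_sin, Real.cos_pi_div_four, Real.sin_pi_div_four]
  ring

theorem norm_diagDir : ‖diagDir‖ = 1 := by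
  unfold diagDir
  rw [show (Real.pi / 4 * I : ℂ) = ((Real.pi / 4 : ℝ) : ℂ) * I by push_cast; ring,
    norm_exp_ofReal_mul_I]

theorem add_mul_diagDir (a r : ℝ) : (a : ℂ) + r * diagDir = diagPoint a (Real.sqrt 2 / 2 * r) := by
  rw [diagDir_eq, diagPoint_eq]; push_cast; ring

theorem diagPoint_mem_slitPlane {a : ℝ} (ha : 0 < a) (u : ℝ) : diagPoint a u ∈ slitPlane := by
  rw [mem_slitPlane_iff]
  by_cases h : u = 0
  · left; simp [diagPoint, h, ha]
  · right; simpa [diagPoint] using h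

theorem normSq_diagPoint (a u : ℝ) : normSq (diagPoint a u) = a ^ 2 + 2 * a * u + 2 * u ^ 2 := by
  simp [normSq_apply, diagPoint]; ring

theorem sq_half_le_normSq_diagPoint (a u : ℝ) : a ^ 2 / 2 ≤ normSq (diagPoint a u) := by
  rw [normSq_diagPoint]; nlinarith [sq_nonneg (a + 2 * u)]

theorem half_le_norm_diagPoint (a u : ℝ) : a / 2 ≤ ‖diagPoint a u‖ := by
  apply le_of_sq_le_sq _ (norm_nonneg _)
  rw [← normSq_eq_norm_sq]
  have := sq_half_le_normSq_diagPoint a u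
  nlinarith [sq_nonneg a]

theorem norm_diagPoint_le {a : ℝ} (ha : 0 ≤ a) (u : ℝ) : ‖diagPoint a u‖ ≤ a + 2 * |u| := by
  refine (norm_le_abs_re_add_abs_im _).trans ?_
  simp only [diagPoint]
  have := abs_add_le a u
  rw [abs_of_nonneg ha] at this
  linarith

theorem norm_exp_pi_I_mul_sq (a u : ℝ) :
    ‖exp (Real.pi * I * diagPoint a u ^ 2)‖ = Real.exp (-(2 * Real.pi * ((a + u) * u))) := by
  rw [norm_exp]
  congr 1
  simp [diagPoint, sq]
  ring

theorem norm_cpow_neg_diagPoint {a : ℝ} (ha : 0 < a) (u : ℝ) (s : ℂ) :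
    ‖diagPoint a u ^ (-s)‖ = ‖diagPoint a u‖ ^ (-s.re) * Real.exp (s.im * arg (diagPoint a u)) := by
  rw [norm_cpow_of_ne_zero (slitPlane_ne_zero (diagPoint_mem_slitPlane ha u))]
  simp only [neg_re, neg_im, mul_neg, Real.exp_neg, div_inv_eq_mul]
  ring_nf

/-- The denominator `e^{π i x} - e^{-π i x}` of the integrand. -/
noncomputable def auxDenom (x : ℂ) : ℂ := exp (Real.pi * I * x) - exp (-(Real.pi * I * x))

theorem auxDenom_eq (x : ℂ) : auxDenom x = 2 * I * sin (Real.pi * x) := by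
  unfold auxDenom
  rw [sin, show Real.pi * x * I = Real.pi * I * x by ring,
    show -(Real.pi * x) * I = -(Real.pi * I * x) by ring]
  linear_combination (exp (Real.pi * I * x) - exp (-(Real.pi * I * x))) * I_sq

theorem normSq_auxDenom (p q : ℝ) : normSq (auxDenom (p + q * I)) =
    4 * (Real.sin (Real.pi * p) ^ 2 + Real.sinh (Real.pi * q) ^ 2) := by
  rw [auxDenom_eq, mul_add, ← mul_assoc, ← ofReal_mul, ← ofReal_mul, sin_add_mul_I]
  rw [map_mul, map_mul, normSq_I]
  rw [← ofReal_sin, ← ofReal_cos, ← ofReal_cosh, ← ofReal_sinh, ← ofReal_mul, ← ofReal_mul,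
    normSq_add_mul_I]
  have h1 := Real.cosh_sq (Real.pi * q)
  have h2 := Real.sin_sq_add_cos_sq (Real.pi * p)
  have h3 : normSq (2 : ℂ) = 4 := by rw [normSq_apply]; norm_num
  rw [h3, mul_pow, mul_pow, h1]
  linear_combination 4 * Real.sinh (Real.pi * q) ^ 2 * h2

theorem abs_le_abs_sinh (x : ℝ) : |x| ≤ |Real.sinh x| := by
  rw [Real.abs_sinh]
  exact Real.self_le_sinh_iff.2 (abs_nonneg x)

/-- On a line through a half-integer the term sin² becomes cos²(πu), and sinh² dominates the missing
sin²(πu). These lines therefore keep a uniform distance from the poles. -/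
theorem two_le_norm_auxDenom (N : ℕ) (u : ℝ) : 2 ≤ ‖auxDenom (diagPoint (N + 1 / 2) u)‖ := by
  apply le_of_sq_le_sq _ (norm_nonneg _)
  rw [← normSq_eq_norm_sq]
  have : diagPoint (N + 1 / 2) u = ((N + 1 / 2 + u : ℝ) : ℂ) + (u : ℝ) * I := by
    rw [diagPoint_eq]; push_cast; ring
  rw [this, normSq_auxDenom]
  have h1 : Real.sin (Real.pi * (N + 1 / 2 + u)) ^ 2 = Real.cos (Real.pi * u) ^ 2 := by
    rw [show Real.pi * (N + 1 / 2 + u) = (Real.pi * u + Real.pi / 2) + N * Real.pi by ring,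
      Real.sin_add_nat_mul_pi, Real.sin_add_pi_div_two, mul_pow, ← pow_mul, mul_comm N 2, pow_mul]
    norm_num
  have h2 : Real.sin (Real.pi * u) ^ 2 ≤ Real.sinh (Real.pi * u) ^ 2 := by
    rw [sq_le_sq]
    exact Real.abs_sin_le_abs.trans (abs_le_abs_sinh _)
  have h3 := Real.sin_sq_add_cos_sq (Real.pi * u)
  rw [h1]; nlinarith

/-- Valid for every `a`: away from the real axis sinh alone suffices. This controls the far ends of
the strips between two half-integer lines. -/
theorem one_le_norm_auxDenom (a : ℝ) {u : ℝ} (hu : 1 ≤ |u|) : 1 ≤ ‖auxDenom (diagPoint a u)‖ := by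
  apply le_of_sq_le_sq _ (norm_nonneg _)
  rw [← normSq_eq_norm_sq]
  have : diagPoint a u = ((a + u : ℝ) : ℂ) + (u : ℝ) * I := by
    rw [diagPoint_eq]; push_cast; ring
  rw [this, normSq_auxDenom]
  have h2 : 1 ≤ |Real.sinh (Real.pi * u)| := by
    refine le_trans ?_ (abs_le_abs_sinh _)
    rw [abs_mul, abs_of_pos Real.pi_pos]
    nlinarith [Real.pi_gt_three]
  have h3 := sq_abs (Real.sinh (Real.pi * u))
  nlinarith [sq_nonneg (Real.sin (Real.pi * (a + u)))]

theorem auxDenom_eq_zero_iff {a u : ℝ} : auxDenom (diagPoint a u) = 0 ↔ u = 0 ∧ ∃ k : ℤ, a = k := by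
  have : diagPoint a u = ((a + u : ℝ) : ℂ) + (u : ℝ) * I := by
    rw [diagPoint_eq]; push_cast; ring
  rw [← normSq_eq_zero, this, normSq_auxDenom]
  constructor
  · intro h
    have h1 : Real.sinh (Real.pi * u) = 0 := by
      nlinarith [sq_nonneg (Real.sin (Real.pi * (a + u))), sq_nonneg (Real.sinh (Real.pi * u))]
    have h2 : Real.sin (Real.pi * (a + u)) = 0 := by
      nlinarith [sq_nonneg (Real.sin (Real.pi * (a + u))), sq_nonneg (Real.sinh (Real.pi * u))]
    rw [Real.sinh_eq_zero, mul_eq_zero] at h1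
    have hu := h1.resolve_left Real.pi_ne_zero
    refine ⟨hu, ?_⟩
    rw [Real.sin_eq_zero_iff] at h2
    obtain ⟨k, hk⟩ := h2
    refine ⟨k, ?_⟩
    rw [hu, add_zero, mul_comm] at hk
    exact (mul_left_cancel₀ Real.pi_ne_zero hk).symm
  · rintro ⟨rfl, k, rfl⟩
    simp [mul_comm Real.pi, Real.sin_int_mul_pi]

theorem abs_log_norm_diagPoint_le {a A : ℝ} (ha : 1 / 2 ≤ a) (haA : a ≤ A) (u : ℝ) :
    |Real.log ‖diagPoint a u‖| ≤ A + 3 + 2 * |u| := by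
  have h1 := half_le_norm_diagPoint a u
  have h2 := norm_diagPoint_le (by linarith : 0 ≤ a) u
  have hpos : 0 < ‖diagPoint a u‖ := by linarith
  have h3 := abs_nonneg u
  rw [abs_le]
  constructor
  · have := Real.one_sub_inv_le_log_of_pos hpos
    have h4 : ‖diagPoint a u‖⁻¹ ≤ 4 := by
      rw [inv_le_comm₀ hpos (by norm_num)]; linarith
    linarith
  · have := Real.log_le_sub_one_of_pos hpos
    linarith

/-! ### Decay of the integrand and holomorphy of R -/

/-- Gaussian decay of the numerator of the integrand and of its derivative in `s`. -/
theorem exists_norm_numerator_le (A B : ℝ) : ∃ K : ℝ, 0 < K ∧ ∀ s : ℂ, ‖s‖ ≤ B → ∀ a : ℝ, 1 / 2 ≤ a →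
    a ≤ A → ∀ u : ℝ, ‖diagPoint a u ^ (-s) * exp (Real.pi * I * diagPoint a u ^ 2)‖ *
      (1 + ‖log (diagPoint a u)‖) ≤ K * Real.exp (-u ^ 2) := by
  -- `c` collects the coefficients of |u| in the exponent; completing the square, c|u| ≤ c²/4 + u²,
  -- leaves -u² out of -2πu².
  set c := 2 * B + 2 * Real.pi * A + 2 with hc
  refine ⟨Real.exp (B * (A + 3) + Real.pi * B + (A + 8) + c ^ 2 / 4), Real.exp_pos _, ?_⟩
  intro s hs a ha haA u
  have ha0 : 0 < a := by linarith
  have hu := abs_nonneg u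
  have hpi := Real.pi_gt_three
  have hpos : 0 < ‖diagPoint a u‖ := by linarith [half_le_norm_diagPoint a u]
  have hlog := abs_log_norm_diagPoint_le ha haA u
  have hB : 0 ≤ B := (norm_nonneg s).trans hs
  have h1 : 1 + ‖log (diagPoint a u)‖ ≤ Real.exp (A + 8 + 2 * |u|) := by
    have h2 : ‖log (diagPoint a u)‖ ≤ A + 7 + 2 * |u| := by
      refine (norm_le_abs_re_add_abs_im _).trans ?_
      rw [log_re, log_im]
      have := abs_arg_le_pi (diagPoint a u)
      linarith [Real.pi_lt_four]
    have := Real.add_one_le_exp (A + 8 + 2 * |u|)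
    linarith
  rw [norm_mul, norm_cpow_neg_diagPoint ha0, norm_exp_pi_I_mul_sq, Real.rpow_def_of_pos hpos]
  calc _ ≤ Real.exp (B * (A + 3 + 2 * |u|)) * Real.exp (B * Real.pi) *
        Real.exp (-(2 * Real.pi * ((a + u) * u))) * Real.exp (A + 8 + 2 * |u|) := by
        have e1 : Real.log ‖diagPoint a u‖ * -s.re ≤ B * (A + 3 + 2 * |u|) := by
          refine (le_abs_self _).trans ?_
          rw [abs_mul, abs_neg, mul_comm]
          exact mul_le_mul ((abs_re_le_norm s).trans hs) hlog (abs_nonneg _) hB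
        have e2 : s.im * arg (diagPoint a u) ≤ B * Real.pi := by
          refine (le_abs_self _).trans ?_
          rw [abs_mul]
          exact mul_le_mul ((abs_im_le_norm s).trans hs) (abs_arg_le_pi _) (abs_nonneg _) hB
        have e3 := Real.exp_le_exp.2 e1
        have e4 := Real.exp_le_exp.2 e2
        gcongr
    _ = Real.exp (B * (A + 3 + 2 * |u|) + B * Real.pi + -(2 * Real.pi * ((a + u) * u)) +
        (A + 8 + 2 * |u|)) := by simp only [Real.exp_add]
    _ ≤ Real.exp (B * (A + 3) + Real.pi * B + (A + 8) + c ^ 2 / 4 + -u ^ 2) := by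
        apply Real.exp_le_exp.2
        have h3 : -(a * u) ≤ A * |u| := by
          have := neg_abs_le u
          nlinarith
        have h4 : c * |u| ≤ c ^ 2 / 4 + u ^ 2 := by
          rw [← sq_abs u]; nlinarith [sq_nonneg (c / 2 - |u|)]
        have h5 : u ^ 2 ≤ Real.pi * u ^ 2 := by nlinarith [sq_nonneg u]
        rw [hc] at h4 ⊢
        nlinarith
    _ = _ := by rw [Real.exp_add]

theorem riemannAuxIntegrand_eq (s x : ℂ) :
    riemannAuxIntegrand s x = x ^ (-s) * exp (Real.pi * I * x ^ 2) / auxDenom x := rfl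

theorem continuous_diagPoint (a : ℝ) : Continuous (diagPoint a) := by
  have : diagPoint a = fun u : ℝ => (a : ℂ) + u * (1 + I) := funext fun u => diagPoint_eq a u
  rw [this]; fun_prop

theorem continuous_auxDenom : Continuous auxDenom := by
  unfold auxDenom; fun_prop

theorem continuous_riemannAuxIntegrand_line (s : ℂ) (N : ℕ) :
    Continuous fun r : ℝ => riemannAuxIntegrand s ((N + 1 / 2 : ℝ) + r * diagDir) := by
  simp_rw [add_mul_diagDir, riemannAuxIntegrand_eq]
  have hc : Continuous fun r : ℝ => diagPoint (N + 1 / 2) (Real.sqrt 2 / 2 * r) :=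
    (continuous_diagPoint _).comp (by fun_prop)
  refine Continuous.div (Continuous.mul ?_ (by fun_prop)) (continuous_auxDenom.comp hc) fun r => ?_
  · exact hc.cpow continuous_const fun r => diagPoint_mem_slitPlane (by positivity) _
  · have := two_le_norm_auxDenom N (Real.sqrt 2 / 2 * r)
    exact norm_pos_iff.1 (by linarith)

theorem exists_norm_integrand_line_le (N : ℕ) (B : ℝ) : ∃ K : ℝ, 0 < K ∧ ∀ s : ℂ, ‖s‖ ≤ B → ∀ r : ℝ,
    ‖riemannAuxIntegrand s ((N + 1 / 2 : ℝ) + r * diagDir)‖ *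
      (1 + ‖log ((N + 1 / 2 : ℝ) + r * diagDir)‖) ≤ K * Real.exp (-(1 / 2) * r ^ 2) := by
  obtain ⟨K, hK, h⟩ := exists_norm_numerator_le (N + 1 / 2) B
  refine ⟨K, hK, fun s hs r => ?_⟩
  have h1 := h s hs (N + 1 / 2) (by linarith [(Nat.cast_nonneg N : (0 : ℝ) ≤ N)]) le_rfl
    (Real.sqrt 2 / 2 * r)
  have h2 := two_le_norm_auxDenom N (Real.sqrt 2 / 2 * r)
  rw [add_mul_diagDir, riemannAuxIntegrand_eq, norm_div]
  have e : -(Real.sqrt 2 / 2 * r) ^ 2 = -(1 / 2) * r ^ 2 := by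
    rw [mul_pow, div_pow, Real.sq_sqrt (by norm_num)]; ring
  rw [e] at h1
  refine le_trans ?_ h1
  gcongr
  exact div_le_self (norm_nonneg _) (by linarith)

theorem integrable_exp_neg_half_sq : Integrable fun r : ℝ => Real.exp (-(1 / 2) * r ^ 2) :=
  integrable_exp_neg_mul_sq (by norm_num)

theorem integrable_integrand_line (s : ℂ) (N : ℕ) :
    Integrable fun r : ℝ => riemannAuxIntegrand s ((N + 1 / 2 : ℝ) + r * diagDir) * diagDir := by
  obtain ⟨K, hK, h⟩ := exists_norm_integrand_line_le N ‖s‖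
  refine Integrable.mono' (integrable_exp_neg_half_sq.const_mul K)
    (((continuous_riemannAuxIntegrand_line s N).mul continuous_const).aestronglyMeasurable)
    (Filter.Eventually.of_forall fun r => ?_)
  rw [norm_mul, norm_diagDir, mul_one]
  refine le_trans (le_mul_of_one_le_right (norm_nonneg _) ?_) (h s le_rfl r)
  linarith [norm_nonneg (log ((N + 1 / 2 : ℝ) + r * diagDir))]

/-- The integral along the line of slope one through `a`, run upwards. -/
noncomputable def auxLineIntegral (s : ℂ) (a : ℝ) : ℂ :=
  ∫ r : ℝ, riemannAuxIntegrand s (a + r * diagDir) * diagDir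

theorem riemannAux_eq (s : ℂ) : riemannAux s = -auxLineIntegral s (1 / 2) := by
  unfold riemannAux auxLineIntegral
  norm_num

theorem hasDerivAt_riemannAuxIntegrand {x : ℂ} (hx : x ≠ 0) (s : ℂ) :
    HasDerivAt (fun s => riemannAuxIntegrand s x) (riemannAuxIntegrand s x * -log x) s := by
  have h1 : HasDerivAt (fun s : ℂ => x ^ (-s)) (x ^ (-s) * log x * -1) s :=
    (hasDerivAt_neg s).const_cpow (Or.inl hx)
  have h2 := (h1.mul_const (exp (Real.pi * I * x ^ 2))).div_const (auxDenom x)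
  refine h2.congr_deriv ?_
  rw [riemannAuxIntegrand_eq]; ring

/-- Differentiation under the integral sign. The derivative in `s` brings down `-log x`, and the
factor `1 + ‖log‖` in `exists_norm_integrand_line_le` was carried to give a Gaussian majorant
uniform on a ball. -/
theorem differentiable_riemannAux : Differentiable ℂ riemannAux := by
  intro s₀
  have heq : riemannAux = fun s => -auxLineIntegral s ((0 : ℕ) + 1 / 2) := by
    funext s; rw [riemannAux_eq]; norm_num
  rw [heq]
  refine DifferentiableAt.neg ?_
  obtain ⟨K, hK, h⟩ := exists_norm_integrand_line_le 0 (‖s₀‖ + 1)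
  have hmem : ∀ r : ℝ, (((0 : ℕ) + 1 / 2 : ℝ) : ℂ) + r * diagDir ∈ slitPlane := fun r => by
    rw [add_mul_diagDir]; exact diagPoint_mem_slitPlane (by norm_num) _
  have hlogc : Continuous fun r : ℝ => log ((((0 : ℕ) + 1 / 2 : ℝ) : ℂ) + r * diagDir) :=
    Continuous.clog (by fun_prop) hmem
  refine (hasDerivAt_integral_of_dominated_loc_of_deriv_le (𝕜 := ℂ) (μ := volume)
    (F := fun s r => riemannAuxIntegrand s ((((0 : ℕ) + 1 / 2 : ℝ) : ℂ) + r * diagDir) * diagDir)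
    (F' := fun s r => riemannAuxIntegrand s ((((0 : ℕ) + 1 / 2 : ℝ) : ℂ) + r * diagDir) *
      -log ((((0 : ℕ) + 1 / 2 : ℝ) : ℂ) + r * diagDir) * diagDir)
    (bound := fun r => K * Real.exp (-(1 / 2) * r ^ 2)) (Metric.ball_mem_nhds s₀ zero_lt_one)
    (Filter.Eventually.of_forall fun s => ?_) (integrable_integrand_line s₀ 0) ?_
    (Filter.Eventually.of_forall fun r s hs => ?_) (integrable_exp_neg_half_sq.const_mul K)
    (Filter.Eventually.of_forall fun r s hs => ?_)).2.differentiableAt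
  · exact ((continuous_riemannAuxIntegrand_line s 0).mul continuous_const).aestronglyMeasurable
  · exact (((continuous_riemannAuxIntegrand_line s₀ 0).mul hlogc.neg).mul
      continuous_const).aestronglyMeasurable
  · have hs' : ‖s‖ ≤ ‖s₀‖ + 1 := by
      have := norm_sub_norm_le s s₀
      rw [Metric.mem_ball, dist_eq_norm] at hs
      linarith
    rw [norm_mul, norm_mul, norm_diagDir, mul_one, norm_neg]
    refine le_trans ?_ (h s hs' r)
    gcongr
    linarith
  · exact (hasDerivAt_riemannAuxIntegrand (slitPlane_ne_zero (hmem r)) s).mul_const diagDir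

/-! ### Residues: moving the line across the integers -/

/-- The model case of a bare pole 1/z. Neither term is integrable alone, but their difference is the
Poisson kernel 2ih/(x² + h²). -/
theorem integrable_and_integral_inv_sub_inv {h : ℝ} (hh : 0 < h) :
    Integrable (fun x : ℝ => 1 / ((x : ℂ) + ((-h : ℝ) : ℂ) * I) - 1 / ((x : ℂ) + (h : ℂ) * I)) ∧
    ∫ x : ℝ, (1 / ((x : ℂ) + ((-h : ℝ) : ℂ) * I) - 1 / ((x : ℂ) + (h : ℂ) * I)) = 2 * Real.pi * I := by
  have heq : (fun x : ℝ => 1 / ((x : ℂ) + ((-h : ℝ) : ℂ) * I) - 1 / ((x : ℂ) + (h : ℂ) * I)) =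
      fun x : ℝ => (((1 + (x / h) ^ 2)⁻¹ : ℝ) : ℂ) * (2 / h * I) := by
    funext x
    have h1 : (x : ℂ) + ((-h : ℝ) : ℂ) * I ≠ 0 := fun H => by
      have := congrArg im H; simp at this; exact hh.ne' this
    have h2 : (x : ℂ) + (h : ℂ) * I ≠ 0 := fun H => by
      have := congrArg im H; simp at this; exact hh.ne' this
    have h3 : (h : ℂ) ≠ 0 := ofReal_ne_zero.2 hh.ne'
    have h4 : (1 + ((x : ℂ) / h) ^ 2) ≠ 0 := by
      have : (1 + (x / h) ^ 2 : ℝ) ≠ 0 := by positivity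
      exact_mod_cast this
    push_cast at h1 ⊢
    have h5 : (h : ℂ) ^ 2 + (x : ℂ) ^ 2 ≠ 0 := by
      have : (h ^ 2 + x ^ 2 : ℝ) ≠ 0 := by positivity
      exact_mod_cast this
    rw [div_sub_div _ _ h1 h2, inv_mul_eq_div, div_eq_div_iff (mul_ne_zero h1 h2) h4]
    field_simp
    ring_nf
    rw [I_pow_three]
    ring
  rw [heq]
  constructor
  · exact ((integrable_inv_one_add_sq.comp_div hh.ne').ofReal).mul_const _
  · rw [integral_mul_const, integral_complex_ofReal]
    have := Measure.integral_comp_div (fun x : ℝ => (1 + x ^ 2)⁻¹) h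
    rw [this, integral_univ_inv_one_add_sq, abs_of_pos hh, smul_eq_mul]
    push_cast
    have h3 : (h : ℂ) ≠ 0 := ofReal_ne_zero.2 hh.ne'
    field_simp

/-- The residue theorem for a horizontal strip with a simple pole at the origin. -/
theorem integral_strip_sub_eq {f : ℂ → ℂ} {h h' : ℝ} (hh : 0 < h) (hh' : h < h')
    (hf : DifferentiableOn ℂ f {z | |z.im| < h'})
    (hi1 : Integrable fun x : ℝ => f (x + ((-h : ℝ) : ℂ) * I) / (x + ((-h : ℝ) : ℂ) * I))
    (hi2 : Integrable fun x : ℝ => f (x + (h : ℂ) * I) / (x + (h : ℂ) * I))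
    (hdecay : ∀ ε > 0, ∃ R₀ : ℝ, ∀ r : ℝ, R₀ ≤ |r| → ∀ y : ℝ, |y| ≤ h →
      ‖f (r + y * I) / (r + y * I)‖ ≤ ε) :
    (∫ x : ℝ, f (x + ((-h : ℝ) : ℂ) * I) / (x + ((-h : ℝ) : ℂ) * I)) -
      (∫ x : ℝ, f (x + (h : ℂ) * I) / (x + (h : ℂ) * I)) = 2 * Real.pi * I * f 0 := by
  obtain ⟨hint, hval⟩ := integrable_and_integral_inv_sub_inv hh
  have hU : IsOpen {z : ℂ | |z.im| < h'} := isOpen_lt (continuous_im.abs) continuous_const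
  have h0 : (0 : ℂ) ∈ {z : ℂ | |z.im| < h'} := by simp; linarith
  -- Subtracting f(0)/z from f(z)/z leaves `dslope f 0`, holomorphic in the whole strip. Cauchy's
  -- theorem on long rectangles then shows that only the model pole contributes.
  have hd : DifferentiableOn ℂ (dslope f 0) {z | |z.im| < h'} :=
    (differentiableOn_dslope (hU.mem_nhds h0)).2 hf
  have hds : ∀ z : ℂ, z ≠ 0 → dslope f 0 z = f z / z - f 0 * (1 / z) := by
    intro z hz
    rw [dslope_of_ne _ hz, slope_def_field, sub_zero, sub_div]
    ring
  have hne : ∀ (x : ℝ) {y : ℝ}, y ≠ 0 → (x : ℂ) + (y : ℂ) * I ≠ 0 := fun x y hy H => by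
    have := congrArg im H; simp at this; exact hy this
  have hne' : ∀ {x : ℝ} (y : ℝ), x ≠ 0 → (x : ℂ) + (y : ℂ) * I ≠ 0 := fun {x} y hy H => by
    have := congrArg re H; simp at this; exact hy this
  set K : ℝ → ℂ := fun x => f (x + ((-h : ℝ) : ℂ) * I) / (x + ((-h : ℝ) : ℂ) * I) -
    f (x + (h : ℂ) * I) / (x + (h : ℂ) * I) -
    f 0 * (1 / ((x : ℂ) + ((-h : ℝ) : ℂ) * I) - 1 / ((x : ℂ) + (h : ℂ) * I)) with hK
  have hKint : Integrable K := (hi1.sub hi2).sub (hint.const_mul _)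
  have hKeq : ∀ x, K x = dslope f 0 (x + ((-h : ℝ) : ℂ) * I) - dslope f 0 (x + (h : ℂ) * I) := by
    intro x
    rw [hds _ (hne x (neg_ne_zero.2 hh.ne')), hds _ (hne x hh.ne')]
    simp only [hK]; ring
  have hlim := intervalIntegral_tendsto_integral hKint Filter.tendsto_neg_atTop_atBot
    Filter.tendsto_id
  have hzero : Filter.Tendsto (fun R : ℝ => ∫ x in (-R)..R, K x) Filter.atTop (nhds 0) := by
    have hrect : ∀ R : ℝ, (∫ x in (-R)..R, K x) =
        I * (∫ y in (-h)..h, dslope f 0 (((-R : ℝ) : ℂ) + y * I)) -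
        I * (∫ y in (-h)..h, dslope f 0 ((R : ℂ) + y * I)) := by
      intro R
      have hsub : ∀ {r : ℝ} {y : ℝ}, |y| ≤ h → ((r : ℂ) + (y : ℂ) * I) ∈ {z : ℂ | |z.im| < h'} := by
        intro r y hy
        simp only [Set.mem_ofPred_eq, add_im, ofReal_im, mul_im, ofReal_re, I_im, mul_one, I_re,
          mul_zero, add_zero, zero_add]
        linarith
      have := integral_boundary_rect_eq_zero_of_differentiableOn (dslope f 0)
        (⟨-R, -h⟩ : ℂ) (⟨R, h⟩ : ℂ) (hd.mono ?_)
      · simp only [smul_eq_mul] at this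
        rw [intervalIntegral.integral_congr (fun x _ => hKeq x), intervalIntegral.integral_sub]
        · linear_combination this
        · refine ContinuousOn.intervalIntegrable (hd.continuousOn.comp (by fun_prop) ?_)
          intro x _; exact hsub (by rw [abs_neg, abs_of_pos hh])
        · refine ContinuousOn.intervalIntegrable (hd.continuousOn.comp (by fun_prop) ?_)
          intro x _; exact hsub (by rw [abs_of_pos hh])
      · intro z hz
        rw [mem_reProdIm] at hz
        have h2 := hz.2
        simp only at h2
        rw [Set.uIcc_of_le (by linarith)] at h2
        have := abs_le.2 h2
        simp only [Set.mem_ofPred_eq]; linarith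
    have hside : ∀ ε > 0, ∃ R₀ : ℝ, ∀ r : ℝ, R₀ ≤ |r| →
        ‖∫ y in (-h)..h, dslope f 0 ((r : ℂ) + y * I)‖ ≤ ε := by
      intro ε hε
      obtain ⟨R₀, hR₀⟩ := hdecay (ε / (4 * h)) (by positivity)
      -- The second threshold makes the subtracted term f(0)/z at most ε/(4h) on the vertical sides,
      -- the same as the bound taken from `hdecay`.
      refine ⟨max R₀ (4 * h * (‖f 0‖ + 1) / ε), fun r hr => ?_⟩
      have hr1 := (le_max_left _ _).trans hr
      have hr2 := (le_max_right _ _).trans hr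
      have hrpos : 0 < |r| := lt_of_lt_of_le (by positivity) hr2
      have hb : ∀ y ∈ Set.uIoc (-h) h, ‖dslope f 0 ((r : ℂ) + y * I)‖ ≤ ε / (2 * h) := by
        intro y hy
        rw [Set.uIoc_of_le (by linarith)] at hy
        have hy' : |y| ≤ h := abs_le.2 ⟨hy.1.le, hy.2⟩
        have hz : (r : ℂ) + (y : ℂ) * I ≠ 0 := hne' y (abs_pos.1 hrpos)
        rw [hds _ hz]
        have e1 := hR₀ r hr1 y hy'
        have e2 : ‖f 0 * (1 / ((r : ℂ) + (y : ℂ) * I))‖ ≤ ε / (4 * h) := by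
          rw [norm_mul, norm_div, norm_one, mul_one_div]
          have e3 : |r| ≤ ‖(r : ℂ) + (y : ℂ) * I‖ := by
            simpa using abs_re_le_norm ((r : ℂ) + (y : ℂ) * I)
          rw [div_le_iff₀ (lt_of_lt_of_le hrpos e3)]
          rw [div_le_iff₀ hε] at hr2
          rw [div_mul_eq_mul_div, le_div_iff₀ (by positivity)]
          nlinarith [norm_nonneg (f 0)]
        calc _ ≤ ε / (4 * h) + ε / (4 * h) := (norm_sub_le _ _).trans (add_le_add e1 e2)
          _ = _ := by field_simp; ring
      refine (intervalIntegral.norm_integral_le_of_norm_le_const hb).trans (le_of_eq ?_)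
      rw [abs_of_pos (by linarith)]; field_simp; ring
    rw [Metric.tendsto_atTop]
    intro ε hε
    obtain ⟨R₀, hR₀⟩ := hside (ε / 3) (by positivity)
    refine ⟨max R₀ 0, fun R hR => ?_⟩
    have hR1 : R₀ ≤ |R| := ((le_max_left _ _).trans hR).trans (le_abs_self R)
    have e1 := hR₀ R hR1
    have e2 := hR₀ (-R) (by rwa [abs_neg])
    rw [dist_zero_right, hrect R]
    refine lt_of_le_of_lt (norm_sub_le _ _) ?_
    rw [norm_mul, norm_mul, norm_I, one_mul, one_mul]
    linarith
  have hK0 : ∫ x, K x = 0 := tendsto_nhds_unique hlim hzero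
  have hsplit : ∫ x, K x = (∫ x : ℝ, f (x + ((-h : ℝ) : ℂ) * I) / (x + ((-h : ℝ) : ℂ) * I)) -
      (∫ x : ℝ, f (x + (h : ℂ) * I) / (x + (h : ℂ) * I)) - f 0 * (2 * Real.pi * I) := by
    rw [← hval, ← integral_const_mul, ← integral_sub hi1 hi2]
    exact integral_sub (hi1.sub hi2) (hint.const_mul _)
  rw [hK0] at hsplit
  linear_combination -hsplit

theorem exp_pi_I_mul_nat (n : ℕ) : exp (Real.pi * I * n) = (-1) ^ n := by
  rw [mul_comm, exp_nat_mul, exp_pi_mul_I]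

theorem auxDenom_nat (n : ℕ) : auxDenom n = 0 := by
  unfold auxDenom
  rw [exp_neg, exp_pi_I_mul_nat, sub_eq_zero, ← inv_pow]
  norm_num

theorem hasDerivAt_auxDenom_nat (n : ℕ) : HasDerivAt auxDenom (2 * Real.pi * I * (-1) ^ n) n := by
  have h1 : HasDerivAt (fun x : ℂ => Real.pi * I * x) (Real.pi * I * 1) n :=
    (hasDerivAt_id _).const_mul _
  have h2 := h1.cexp.sub h1.neg.cexp
  refine h2.congr_deriv ?_
  simp only [Pi.neg_apply]
  rw [exp_neg, exp_pi_I_mul_nat, ← inv_pow]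
  norm_num
  ring

theorem differentiable_auxDenom : Differentiable ℂ auxDenom := by
  unfold auxDenom; fun_prop

theorem nat_add_diagDir_mul (n : ℕ) (r y : ℝ) : (n : ℂ) + diagDir * ((r : ℂ) + y * I) =
    diagPoint (n - Real.sqrt 2 * y) (Real.sqrt 2 / 2 * (r + y)) := by
  rw [diagDir_eq, diagPoint_eq]
  push_cast
  linear_combination (Real.sqrt 2 / 2 * y : ℂ) * I_sq

/-- Between the two lines the only pole is n = N + 1. The residue there is n^{-s}/(2πi), because
e^{πi n²} = (-1)^n cancels the sign in the derivative of the denominator. The substitution x = n +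
`diagDir` z makes the strip horizontal. -/
theorem auxLineIntegral_succ_sub (s : ℂ) (N : ℕ) :
    auxLineIntegral s ((N + 1 : ℕ) + 1 / 2) - auxLineIntegral s (N + 1 / 2) =
      ((N + 1 : ℕ) : ℂ) ^ (-s) := by
  set n := N + 1 with hn
  have hn1 : (1 : ℝ) ≤ n := by rw [hn]; push_cast; linarith [(Nat.cast_nonneg N : (0 : ℝ) ≤ N)]
  set w : ℂ → ℂ := fun z => n + diagDir * z with hw
  set D : ℂ → ℂ := fun z => auxDenom (w z) with hD
  have hwd : Differentiable ℂ w := by rw [hw]; fun_prop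
  have hDd : Differentiable ℂ D := differentiable_auxDenom.comp hwd
  have hw0 : w 0 = n := by simp [hw]
  have hD0 : D 0 = 0 := by simp only [hD, hw0, auxDenom_nat]
  have hDder : deriv D 0 = 2 * Real.pi * I * (-1) ^ n * diagDir := by
    have h1 : HasDerivAt w diagDir 0 :=
      (((hasDerivAt_id (0 : ℂ)).const_mul diagDir).const_add (n : ℂ)).congr_deriv (mul_one _)
    have h2 : HasDerivAt auxDenom (2 * Real.pi * I * (-1) ^ n) (w 0) := by
      rw [hw0]; exact hasDerivAt_auxDenom_nat n
    exact (h2.comp 0 h1).deriv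
  have hdir : diagDir ≠ 0 := exp_ne_zero _
  have h2 : Real.sqrt 2 * Real.sqrt 2 = 2 := Real.mul_self_sqrt (by norm_num)
  have hs2 : 0 < Real.sqrt 2 := by positivity
  -- Height y in the strip is the line through n - √2 y. So |y| < √2/2 stays strictly between n - 1
  -- and n + 1, off the cut and off the other poles, and y = ±√2/4 are the two half-integer lines.
  set h' := Real.sqrt 2 / 2 with hh'
  set h := Real.sqrt 2 / 4 with hh
  have hzform : ∀ z : ℂ, z = (z.re : ℂ) + (z.im : ℂ) * I := fun z => (re_add_im z).symm
  have hay : ∀ {y : ℝ}, |y| < h' → 0 < n - Real.sqrt 2 * y ∧ |Real.sqrt 2 * y| < 1 := by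
    intro y hy
    have : |Real.sqrt 2 * y| < 1 := by
      rw [abs_mul, abs_of_pos hs2]
      calc _ < Real.sqrt 2 * h' := by gcongr
        _ = 1 := by rw [hh']; linarith
    exact ⟨by linarith [(abs_lt.1 this).2], this⟩
  have hSne : ∀ z ∈ {z : ℂ | |z.im| < h'}, dslope D 0 z ≠ 0 := by
    intro z hz
    by_cases hz0 : z = 0
    · rw [hz0, dslope_same, hDder]
      have : (Real.pi : ℂ) ≠ 0 := ofReal_ne_zero.2 Real.pi_ne_zero
      simp [this, hdir]
    · rw [dslope_of_ne _ hz0, slope_def_field, hD0, sub_zero, sub_zero]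
      refine div_ne_zero ?_ hz0
      intro hzero
      simp only [hD, hw] at hzero
      rw [hzform z, nat_add_diagDir_mul, auxDenom_eq_zero_iff] at hzero
      obtain ⟨e1, k, e2⟩ := hzero
      have hy := (hay hz).2
      have e3 : Real.sqrt 2 * z.im = ((n - k : ℤ) : ℝ) := by push_cast; linarith
      rw [e3] at hy
      have e4 : |(n - k : ℤ)| < 1 := by exact_mod_cast hy
      rw [Int.abs_lt_one_iff] at e4
      rw [e4] at e3
      have e5 : z.im = 0 := by simpa using e3
      have e6 : z.re = 0 := by
        rcases mul_eq_zero.1 e1 with e | e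
        · linarith
        · linarith
      exact hz0 (Complex.ext e6 e5)
  -- Dividing by the `dslope` of the denominator instead of the denominator makes f(z)/z equal to
  -- the integrand with its pole split off.
  set f : ℂ → ℂ := fun z => w z ^ (-s) * exp (Real.pi * I * w z ^ 2) * diagDir / dslope D 0 z with hf
  have hU : IsOpen {z : ℂ | |z.im| < h'} := isOpen_lt (continuous_im.abs) continuous_const
  have h0 : (0 : ℂ) ∈ {z : ℂ | |z.im| < h'} := by simp [hh']
  have hfd : DifferentiableOn ℂ f {z | |z.im| < h'} := by
    have hS : DifferentiableOn ℂ (dslope D 0) {z : ℂ | |z.im| < h'} :=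
      (differentiableOn_dslope (hU.mem_nhds h0)).2 hDd.differentiableOn
    refine DifferentiableOn.div ?_ hS hSne
    refine DifferentiableOn.mul_const (DifferentiableOn.mul ?_ ?_) _
    · refine DifferentiableOn.cpow_const hwd.differentiableOn fun z hz => ?_
      simp only [hw]
      rw [hzform z, nat_add_diagDir_mul]
      exact diagPoint_mem_slitPlane (hay hz).1 _
    · exact Differentiable.differentiableOn (by fun_prop)
  have hfz : ∀ z : ℂ, z ≠ 0 → f z / z = riemannAuxIntegrand s (w z) * diagDir := by
    intro z hz
    simp only [hf]
    rw [dslope_of_ne _ hz, slope_def_field, hD0, sub_zero, sub_zero, riemannAuxIntegrand_eq]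
    simp only [hD]
    field_simp
  have hf0 : f 0 = (n : ℂ) ^ (-s) / (2 * Real.pi * I) := by
    simp only [hf]
    rw [dslope_same, hDder, hw0]
    have e1 : exp (Real.pi * I * (n : ℂ) ^ 2) = (-1) ^ n := by
      have := exp_pi_I_mul_nat (n ^ 2)
      push_cast at this
      rw [this, sq, pow_mul]
      rcases Nat.even_or_odd n with e | e
      · rw [e.neg_one_pow, one_pow]
      · rw [e.neg_one_pow, e.neg_one_pow]
    have : (Real.pi : ℂ) ≠ 0 := ofReal_ne_zero.2 Real.pi_ne_zero
    have h1 : ((-1 : ℂ)) ^ n ≠ 0 := by simp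
    rw [e1]
    field_simp
  have hne : ∀ (x : ℝ) {y : ℝ}, y ≠ 0 → (x : ℂ) + (y : ℂ) * I ≠ 0 := fun x y hy H => by
    have := congrArg im H; simp at this; exact hy this
  have hne' : ∀ {x : ℝ} (y : ℝ), x ≠ 0 → (x : ℂ) + (y : ℂ) * I ≠ 0 := fun {x} y hy H => by
    have := congrArg re H; simp at this; exact hy this
  have hhpos : 0 < h := by rw [hh]; positivity
  have hline : ∀ (y a : ℝ), y ≠ 0 → n - Real.sqrt 2 * y = a →
      (fun x : ℝ => f (x + (y : ℂ) * I) / (x + (y : ℂ) * I)) =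
      fun x : ℝ => (fun r : ℝ => riemannAuxIntegrand s ((a : ℂ) + r * diagDir) * diagDir) (x + y) := by
    intro y a hy ha
    funext x
    rw [hfz _ (hne x hy)]
    simp only [hw]
    rw [nat_add_diagDir_mul, ha, add_mul_diagDir]
  have hlow := hline (-h) ((n : ℕ) + 1 / 2) (neg_ne_zero.2 hhpos.ne') (by rw [hh]; linarith)
  have hup := hline h (N + 1 / 2) hhpos.ne' (by rw [hh, hn]; push_cast; linarith)
  have hI1 := integrable_integrand_line s n
  have hI2 := integrable_integrand_line s N
  have key := integral_strip_sub_eq (f := f) hhpos (by rw [hh, hh']; linarith) hfd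
    (by rw [hlow]; exact hI1.comp_add_right (-h)) (by rw [hup]; exact hI2.comp_add_right h) ?_
  · rw [hlow, hup, integral_add_right_eq_self (fun r : ℝ => riemannAuxIntegrand s
      (((n : ℕ) + 1 / 2 : ℝ) + r * diagDir) * diagDir), integral_add_right_eq_self (fun r : ℝ =>
      riemannAuxIntegrand s ((N + 1 / 2 : ℝ) + r * diagDir) * diagDir), hf0] at key
    have : (Real.pi : ℂ) ≠ 0 := ofReal_ne_zero.2 Real.pi_ne_zero
    unfold auxLineIntegral
    rw [key]
    field_simp
  · intro ε hε
    obtain ⟨K, hK, hKb⟩ := exists_norm_numerator_le (n + 1) ‖s‖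
    -- This forces |u| ≥ 1 + K/(2ε), hence both a denominator of size at least 1 and K exp(-u²) ≤ ε.
    refine ⟨3 + K / ε, fun r hr y hy => ?_⟩
    have hKε : 0 < K / ε := by positivity
    have hy1 : |y| < h' := lt_of_le_of_lt hy (by rw [hh, hh']; linarith)
    have hs2' : Real.sqrt 2 < 3 / 2 := by
      rw [Real.sqrt_lt' (by norm_num)]; norm_num
    have hs2'' : 1 < Real.sqrt 2 := by
      rw [Real.lt_sqrt (by norm_num)]; norm_num
    have hr0 : r ≠ 0 := by
      rintro rfl; rw [abs_zero] at hr; linarith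
    rw [hfz _ (hne' y hr0), norm_mul, norm_diagDir, mul_one]
    simp only [hw]
    rw [nat_add_diagDir_mul, riemannAuxIntegrand_eq, norm_div]
    set a := n - Real.sqrt 2 * y with ha
    set u := Real.sqrt 2 / 2 * (r + y) with hu
    have hay2 : |Real.sqrt 2 * y| ≤ 1 / 2 := by
      rw [abs_mul, abs_of_pos hs2]
      calc _ ≤ Real.sqrt 2 * h := by gcongr
        _ = 1 / 2 := by rw [hh]; linarith
    have ha1 : 1 / 2 ≤ a := by linarith [(abs_le.1 hay2).2]
    have ha2 : a ≤ n + 1 := by linarith [(abs_le.1 hay2).1]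
    have hub : 1 + K / ε / 2 ≤ |u| := by
      rw [hu, abs_mul, abs_of_pos (by positivity)]
      have e1 : |r| - |y| ≤ |r + y| := by
        have := abs_sub_abs_le_abs_sub r (-y)
        rwa [abs_neg, sub_neg_eq_add] at this
      have e2 : |y| ≤ 1 := by rw [hh'] at hy1; linarith
      nlinarith
    have hu1 : 1 ≤ |u| := by linarith
    have hnum := hKb s le_rfl a ha1 ha2 u
    have hden := one_le_norm_auxDenom a hu1
    have hnum2 : ‖diagPoint a u ^ (-s) * exp (Real.pi * I * diagPoint a u ^ 2)‖ ≤
        K * Real.exp (-u ^ 2) :=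
      le_trans (le_mul_of_one_le_right (norm_nonneg _) (by linarith [norm_nonneg (log (diagPoint a u))])) hnum
    refine (div_le_self (norm_nonneg _) hden).trans (hnum2.trans ?_)
    rw [Real.exp_neg]
    have e3 : K / ε ≤ Real.exp (u ^ 2) := by
      have := Real.add_one_le_exp (u ^ 2)
      rw [← sq_abs u] at this ⊢
      nlinarith
    rw [← div_eq_mul_inv, div_le_iff₀ (Real.exp_pos _)]
    rw [div_le_iff₀ hε] at e3
    linarith

theorem riemannAux_eq_sum_sub (s : ℂ) (N : ℕ) : riemannAux s =
    ∑ n ∈ Finset.Icc 1 N, (n : ℂ) ^ (-s) - auxLineIntegral s (N + 1 / 2) := by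
  induction N with
  | zero => rw [riemannAux_eq]; simp
  | succ N ih =>
    rw [ih, Finset.sum_Icc_succ_top (by omega), ← auxLineIntegral_succ_sub s N]
    ring

/-! ### Saddle point estimate for the remainder -/

theorem hasDerivAt_arg_diagPoint {a : ℝ} (ha : 0 < a) (u : ℝ) :
    HasDerivAt (fun u => arg (diagPoint a u)) (a / normSq (diagPoint a u)) u := by
  have h1 : HasDerivAt (fun u : ℝ => diagPoint a u) (1 + I) u := by
    have : (fun u : ℝ => diagPoint a u) = fun u : ℝ => (a : ℂ) + u * (1 + I) :=
      funext fun u => diagPoint_eq a u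
    rw [this]
    exact (((ofRealCLM.hasDerivAt (x := u)).mul_const (1 + I)).const_add (a : ℂ)).congr_deriv (by simp)
  have h2 := h1.clog_real (diagPoint_mem_slitPlane ha u)
  have h3 := (imCLM.hasFDerivAt (x := log (diagPoint a u))).comp_hasDerivAt u h2
  have h4 : (fun u => arg (diagPoint a u)) = imCLM ∘ fun t => log (diagPoint a t) := by
    funext v; simp [log_im]
  rw [h4]
  refine h3.congr_deriv ?_
  simp only [imCLM_apply, div_im, add_re, one_re, I_re, add_im, one_im, I_im]
  simp only [diagPoint]
  ring

/-- For t = 2πa² the line through `a` meets the saddle point, and this inequality bounds the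
exponent t arg x - 2π(a + u)u by -πu². The difference of the two sides vanishes at 0 and has
derivative u times a nonnegative factor, as 3a² + 4au + 2u² = a² + 2(a + u)². -/
theorem sq_mul_arg_diagPoint_le {a : ℝ} (ha : 0 < a) (u : ℝ) :
    a ^ 2 * arg (diagPoint a u) ≤ a * u + u ^ 2 / 2 := by
  set ψ : ℝ → ℝ := fun u => a * u + u ^ 2 / 2 - a ^ 2 * arg (diagPoint a u) with hψ
  have hd : ∀ v, HasDerivAt ψ (v * (3 * a ^ 2 + 4 * a * v + 2 * v ^ 2) / normSq (diagPoint a v)) v := by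
    intro v
    have hpos : normSq (diagPoint a v) ≠ 0 := by
      have := sq_half_le_normSq_diagPoint a v
      have : 0 < a ^ 2 := by positivity
      linarith
    have h1 := (((hasDerivAt_id v).const_mul a).add (((hasDerivAt_id v).pow 2).div_const 2)).sub
      ((hasDerivAt_arg_diagPoint ha v).const_mul (a ^ 2))
    refine h1.congr_deriv ?_
    field_simp
    rw [normSq_diagPoint]
    simp
    ring
  have hq : ∀ v, 0 ≤ (3 * a ^ 2 + 4 * a * v + 2 * v ^ 2) / normSq (diagPoint a v) := fun v =>
    div_nonneg (by nlinarith [sq_nonneg (a + v), sq_nonneg a]) (normSq_nonneg _)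
  have hψ0 : ψ 0 = 0 := by
    have : diagPoint a 0 = (a : ℂ) := by rw [diagPoint_eq]; simp
    simp [hψ, this, arg_ofReal_of_nonneg ha.le]
  have hcont : Continuous ψ := continuous_iff_continuousAt.2 fun v => (hd v).continuousAt
  have hnonneg : 0 ≤ ψ u := by
    rw [← hψ0]
    rcases le_total 0 u with hu | hu
    · refine monotoneOn_of_deriv_nonneg (convex_Ici 0) hcont.continuousOn
        (fun v _ => (hd v).differentiableAt.differentiableWithinAt) (fun v hv => ?_)
        (Set.mem_Ici.2 le_rfl) (Set.mem_Ici.2 hu) hu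
      rw [interior_Ici] at hv
      rw [(hd v).deriv, mul_div_assoc]
      exact mul_nonneg (le_of_lt hv) (hq v)
    · refine antitoneOn_of_deriv_nonpos (convex_Iic 0) hcont.continuousOn
        (fun v _ => (hd v).differentiableAt.differentiableWithinAt) (fun v hv => ?_)
        (Set.mem_Iic.2 hu) (Set.mem_Iic.2 le_rfl) hu
      rw [interior_Iic] at hv
      rw [(hd v).deriv, mul_div_assoc]
      exact mul_nonpos_of_nonpos_of_nonneg (le_of_lt hv) (hq v)
  simp only [hψ] at hnonneg
  linarith

theorem abs_arg_diagPoint_le {a : ℝ} (ha : 0 < a) (u : ℝ) : |arg (diagPoint a u)| ≤ 2 / a * |u| := by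
  have h := Convex.norm_image_sub_le_of_norm_hasDerivWithin_le (f := fun u => arg (diagPoint a u))
    (C := 2 / a) (s := Set.univ) (x := 0) (y := u)
    (fun v _ => (hasDerivAt_arg_diagPoint ha v).hasDerivWithinAt) (fun v _ => ?_) convex_univ
    (Set.mem_univ _) (Set.mem_univ _)
  · have h0 : diagPoint a 0 = (a : ℂ) := by rw [diagPoint_eq]; simp
    simpa [h0, arg_ofReal_of_nonneg ha.le] using h
  · have h1 := sq_half_le_normSq_diagPoint a v
    have h2 : 0 < a ^ 2 := by positivity
    rw [Real.norm_of_nonneg (div_nonneg ha.le (normSq_nonneg _)), div_le_div_iff₀ (by linarith) ha]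
    nlinarith

/-- The line passes at a = ⌊η⌋ + 1/2 rather than at the saddle η. Since |η - a| ≤ 1/2 and a ≥ 1/2,
|η² - a²| ≤ 3a/2, and with |arg x| ≤ 2|u|/a the error is at most 3|u|. Half of the Gaussian absorbs
it, at the price of the constant exp(18π). -/
theorem norm_integrand_diagPoint_le {σ t η : ℝ} (hσ : 0 ≤ σ) (hσ4 : σ ≤ 4) (hη : 0 ≤ η)
    (ht : t = 2 * Real.pi * η ^ 2) (u : ℝ) :
    ‖riemannAuxIntegrand (σ + t * I) (diagPoint (⌊η⌋₊ + 1 / 2) u)‖ ≤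
      8 * Real.exp (18 * Real.pi) * ((⌊η⌋₊ : ℝ) + 1 / 2) ^ (-σ) * Real.exp (-u ^ 2) := by
  set N := ⌊η⌋₊ with hN
  set a : ℝ := N + 1 / 2 with ha
  have hN1 : (N : ℝ) ≤ η := Nat.floor_le hη
  have hN2 : η < N + 1 := Nat.lt_floor_add_one η
  have hN0 : (0 : ℝ) ≤ N := Nat.cast_nonneg N
  have ha0 : 0 < a := by positivity
  have hpi := Real.pi_gt_three
  have hden := two_le_norm_auxDenom N u
  have hre : (σ + t * I : ℂ).re = σ := by simp
  have him : (σ + t * I : ℂ).im = t := by simp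
  rw [riemannAuxIntegrand_eq, norm_div, norm_mul, norm_cpow_neg_diagPoint ha0, norm_exp_pi_I_mul_sq,
    hre, him]
  have h1 : ‖diagPoint a u‖ ^ (-σ) ≤ 16 * a ^ (-σ) := by
    calc _ ≤ (a / 2) ^ (-σ) :=
          Real.rpow_le_rpow_of_nonpos (by positivity) (half_le_norm_diagPoint a u) (by linarith)
      _ = 2 ^ σ * a ^ (-σ) := by
          rw [Real.div_rpow ha0.le (by norm_num), Real.rpow_neg (by norm_num : (0 : ℝ) ≤ 2)]
          field_simp
      _ ≤ 2 ^ (4 : ℝ) * a ^ (-σ) := by gcongr; norm_num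
      _ = 16 * a ^ (-σ) := by norm_num
  have h2 : t * arg (diagPoint a u) - 2 * Real.pi * ((a + u) * u) ≤ 18 * Real.pi - u ^ 2 := by
    have e1 := sq_mul_arg_diagPoint_le ha0 u
    have e2 := abs_arg_diagPoint_le ha0 u
    have e3 : (η ^ 2 - a ^ 2) * arg (diagPoint a u) ≤ 3 * |u| := by
      refine (le_abs_self _).trans ?_
      rw [abs_mul]
      have e4 : |η ^ 2 - a ^ 2| ≤ 3 / 2 * a := by
        rw [abs_le]; constructor <;> nlinarith
      calc _ ≤ 3 / 2 * a * (2 / a * |u|) := mul_le_mul e4 e2 (abs_nonneg _) (by positivity)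
        _ = 3 * |u| := by field_simp
    have e5 : 3 * |u| ≤ 9 + u ^ 2 / 4 := by
      rw [← sq_abs u]; nlinarith [sq_nonneg (|u| / 2 - 3)]
    have e6 : η ^ 2 * arg (diagPoint a u) - (a + u) * u ≤ 9 - u ^ 2 / 4 := by nlinarith
    rw [ht]
    nlinarith [sq_nonneg u, mul_le_mul_of_nonneg_left e6 (by positivity : 0 ≤ 2 * Real.pi)]
  calc _ ≤ (‖diagPoint a u‖ ^ (-σ) * Real.exp (t * arg (diagPoint a u)) *
        Real.exp (-(2 * Real.pi * ((a + u) * u)))) / 2 := by gcongr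
    _ = ‖diagPoint a u‖ ^ (-σ) *
        Real.exp (t * arg (diagPoint a u) - 2 * Real.pi * ((a + u) * u)) / 2 := by
        rw [mul_assoc, ← Real.exp_add]; rfl
    _ ≤ 16 * a ^ (-σ) * Real.exp (18 * Real.pi - u ^ 2) / 2 := by gcongr
    _ = _ := by rw [sub_eq_add_neg, Real.exp_add]; ring

/-- The main term of Riemann's auxiliary function with the order of the remainder. -/
theorem exists_norm_riemannAux_sub_sum_le : ∃ C : ℝ, 0 < C ∧ ∀ σ t : ℝ, 0 ≤ σ → σ ≤ 4 →
    2 * Real.pi ≤ t → ‖riemannAux (σ + t * I) -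
      ∑ n ∈ Finset.Icc 1 ⌊Real.sqrt (t / (2 * Real.pi))⌋₊, (n : ℂ) ^ (-(σ + t * I : ℂ))‖ ≤
        C * t ^ (-(σ / 2)) := by
  set J := ∫ r : ℝ, Real.exp (-(1 / 2) * r ^ 2) with hJ
  have hJ0 : 0 ≤ J := integral_nonneg fun r => (Real.exp_pos _).le
  -- The factors are the pointwise bound, the cost 2^σ (2π)^{σ/2} of replacing (N + 1/2)^{-σ} by
  -- t^{-σ/2} for σ ≤ 4, and the mass of the Gaussian.
  refine ⟨8 * Real.exp (18 * Real.pi) * 16 * (2 * Real.pi) ^ 2 * (J + 1), by positivity, ?_⟩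
  intro σ t hσ hσ4 ht
  set η := Real.sqrt (t / (2 * Real.pi)) with hη
  have hpi := Real.pi_pos
  have ht0 : 0 < t := by linarith
  have hη1 : 1 ≤ η := by
    rw [hη, Real.one_le_sqrt, le_div_iff₀ (by positivity)]; linarith
  have htη : t = 2 * Real.pi * η ^ 2 := by
    rw [hη, Real.sq_sqrt (by positivity)]; field_simp
  set N := ⌊η⌋₊ with hN
  have hN2 : η < N + 1 := Nat.lt_floor_add_one η
  have hN0 : (0 : ℝ) ≤ N := Nat.cast_nonneg N
  rw [riemannAux_eq_sum_sub _ N, sub_sub_cancel_left, norm_neg]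
  set c := 8 * Real.exp (18 * Real.pi) * ((N : ℝ) + 1 / 2) ^ (-σ) with hc
  have hb : ‖auxLineIntegral (σ + t * I) (N + 1 / 2)‖ ≤ c * J := by
    unfold auxLineIntegral
    rw [hJ, ← integral_const_mul]
    refine norm_integral_le_of_norm_le (integrable_exp_neg_half_sq.const_mul c)
      (Filter.Eventually.of_forall fun r => ?_)
    rw [norm_mul, norm_diagDir, mul_one, add_mul_diagDir]
    have := norm_integrand_diagPoint_le hσ hσ4 (by linarith) htη (Real.sqrt 2 / 2 * r)
    have e : -(Real.sqrt 2 / 2 * r) ^ 2 = -(1 / 2) * r ^ 2 := by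
      rw [mul_pow, div_pow, Real.sq_sqrt (by norm_num)]; ring
    rwa [e] at this
  have h1 : ((N : ℝ) + 1 / 2) ^ (-σ) ≤ 16 * (2 * Real.pi) ^ 2 * t ^ (-(σ / 2)) := by
    calc _ ≤ (η / 2) ^ (-σ) :=
          Real.rpow_le_rpow_of_nonpos (by positivity) (by linarith) (by linarith)
      _ = 2 ^ σ * η ^ (-σ) := by
          rw [Real.div_rpow (by linarith) (by norm_num), Real.rpow_neg (by norm_num : (0 : ℝ) ≤ 2)]
          field_simp
      _ = 2 ^ σ * ((2 * Real.pi) ^ (σ / 2) * t ^ (-(σ / 2))) := by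
          congr 1
          rw [hη, Real.sqrt_eq_rpow, ← Real.rpow_mul (by positivity),
            Real.div_rpow ht0.le (by positivity), show 1 / 2 * -σ = -(σ / 2) by ring,
            Real.rpow_neg (by positivity : 0 ≤ 2 * Real.pi)]
          field_simp
      _ ≤ 2 ^ (4 : ℝ) * ((2 * Real.pi) ^ (2 : ℝ) * t ^ (-(σ / 2))) := by
          gcongr
          · norm_num
          · linarith [Real.pi_gt_three]
          · linarith
      _ = _ := by norm_num; ring
  calc _ ≤ c * J := hb
    _ ≤ 8 * Real.exp (18 * Real.pi) * (16 * (2 * Real.pi) ^ 2 * t ^ (-(σ / 2))) * (J + 1) := by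
        rw [hc]; gcongr; linarith
    _ = _ := by ring

/-! ### Jensen's inequality averaged over the centres -/

open MeromorphicOn in
/-- Jensen's inequality for a finite family of zeros, counted with at most their multiplicity. -/
theorem sum_log_le_circleAverage_sub {f : ℂ → ℂ} (hf : Differentiable ℂ f) {u : ℂ → ℝ}
    (hu : Continuous u) (hfu : ∀ z, Real.log ‖f z‖ ≤ u z) {c : ℂ} (hc : f c ≠ 0) {r : ℝ} (hr : 0 < r)
    (S : Finset ℂ) (m : ℂ → ℕ) (hm : ∀ ρ ∈ S, m ρ ≤ analyticOrderNatAt f ρ)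
    (hS : ∀ ρ ∈ S, ‖c - ρ‖ ≤ r) :
    ∑ ρ ∈ S, (m ρ : ℝ) * Real.log (r * ‖c - ρ‖⁻¹) ≤
      Real.circleAverage u c r - Real.log ‖f c‖ := by
  have hfan : AnalyticOnNhd ℂ f Set.univ := fun z _ => hf.analyticAt z
  have hfan' : AnalyticOnNhd ℂ f (Metric.closedBall c |r|) := hfan.mono (Set.subset_univ _)
  have hJ := hfan'.circleAverage_log_norm hr.ne' hc
  have hmono : Real.circleAverage (Real.log ‖f ·‖) c r ≤ Real.circleAverage u c r := by
    refine Real.circleAverage_mono ?_ ?_ (fun z _ => hfu z)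
    · exact (hfan'.mono Metric.sphere_subset_closedBall).meromorphicOn.circleIntegrable_log_norm
    · exact hu.continuousOn.circleIntegrable'
  set D := divisor f (Metric.closedBall c |r|) with hD
  have hDfin := D.finiteSupport (isCompact_closedBall c |r|)
  have hDnn : ∀ z, 0 ≤ D z := hfan'.divisor_nonneg
  have hlognn : ∀ z ∈ Metric.closedBall c |r|, 0 ≤ Real.log (r * ‖c - z‖⁻¹) := by
    intro z hz
    rw [Metric.mem_closedBall, dist_comm, dist_eq_norm, abs_of_pos hr] at hz
    by_cases h0 : ‖c - z‖ = 0
    · simp [h0]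
    · have : 0 < ‖c - z‖ := lt_of_le_of_ne (norm_nonneg _) (Ne.symm h0)
      apply Real.log_nonneg
      rw [← div_eq_mul_inv, le_div_iff₀ this]; linarith
  -- Every zero in the disc contributes a nonnegative term, so zeros outside `S` and excess
  -- multiplicity may be dropped from Jensen's formula.
  have hterm : ∀ z, 0 ≤ (D z : ℝ) * Real.log (r * ‖c - z‖⁻¹) := by
    intro z
    by_cases hz : z ∈ Metric.closedBall c |r|
    · exact mul_nonneg (by exact_mod_cast hDnn z) (hlognn z hz)
    · have : D z = 0 := by rw [hD]; exact Function.locallyFinsuppWithin.apply_eq_zero_of_notMem _ hz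
      simp [this]
  have hSle : ∑ ρ ∈ S, (m ρ : ℝ) * Real.log (r * ‖c - ρ‖⁻¹) ≤
      ∑ᶠ z, (D z : ℝ) * Real.log (r * ‖c - z‖⁻¹) := by
    classical
    rw [finsum_eq_sum_of_support_subset (s := hDfin.toFinset ∪ S) _ (by
      intro z hz
      simp only [Finset.coe_union, Set.Finite.coe_toFinset, Set.mem_union]
      left
      intro h0
      exact hz (by simp [h0]))]
    refine le_trans (Finset.sum_le_sum fun ρ hρ => ?_) (Finset.sum_le_sum_of_subset_of_nonneg
      (Finset.subset_union_right) fun z _ _ => hterm z)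
    have hmem : ρ ∈ Metric.closedBall c |r| := by
      rw [Metric.mem_closedBall, dist_comm, dist_eq_norm, abs_of_pos hr]; exact hS ρ hρ
    refine mul_le_mul_of_nonneg_right ?_ (hlognn ρ hmem)
    have h1 : D ρ = (analyticOrderNatAt f ρ : ℤ) := by
      rw [hD, hfan'.divisor_apply hmem, analyticOrderNatAt]
      cases analyticOrderAt f ρ <;> rfl
    rw [h1]
    exact_mod_cast hm ρ hρ
  linarith

/-- With r = 2 - α + δ and 2 - α ≥ 1, r² exceeds (2 - α)² by at least 2δ. A vertical offset up to
√δ/2 spends only δ/4 of this, so the disc sees the zero through a window of length √δ. The last step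
uses r ≤ 2. -/
theorem log_ratio_ge {δ α r : ℝ} (hδ : 0 < δ) (hδ2 : δ ≤ 1 / 2) (hα : 1 / 2 ≤ α) (hα1 : α ≤ 1)
    (hr : r = 2 - α + δ) {ρ : ℂ} (h1 : α ≤ ρ.re) (h2 : ρ.re ≤ 1) {t : ℝ}
    (ht : |t - ρ.im| ≤ Real.sqrt δ / 2) :
    ‖((2 : ℂ) + t * I) - ρ‖ ≤ r ∧ δ / 8 ≤ Real.log (r * ‖((2 : ℂ) + t * I) - ρ‖⁻¹) := by
  set d := ‖((2 : ℂ) + t * I) - ρ‖ with hd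
  have hsq : d ^ 2 = (2 - ρ.re) ^ 2 + (t - ρ.im) ^ 2 := by
    rw [hd, ← normSq_eq_norm_sq, normSq_apply]; simp; ring
  have hs : (t - ρ.im) ^ 2 ≤ δ / 4 := by
    rw [← sq_abs]
    calc _ ≤ (Real.sqrt δ / 2) ^ 2 := by gcongr
      _ = δ / 4 := by rw [div_pow, Real.sq_sqrt hδ.le]; norm_num
  have hd2 : d ^ 2 ≤ r ^ 2 - δ := by
    rw [hsq, hr]; nlinarith
  have hdpos : 0 < d := by
    refine lt_of_le_of_ne (norm_nonneg _) fun h => ?_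
    rw [← h] at hsq
    nlinarith [sq_nonneg (t - ρ.im)]
  have hr0 : 0 < r := by rw [hr]; linarith
  refine ⟨by nlinarith, ?_⟩
  have h3 : Real.log (r * d⁻¹) = 1 / 2 * Real.log (r ^ 2 / d ^ 2) := by
    rw [← div_eq_mul_inv, ← div_pow, Real.log_pow]; push_cast; ring
  have h4 := Real.one_sub_inv_le_log_of_pos (x := r ^ 2 / d ^ 2) (by positivity)
  rw [inv_div] at h4
  have h5 : d ^ 2 / r ^ 2 ≤ 1 - δ / 4 := by
    rw [div_le_iff₀ (by positivity)]
    have hr2 : r ≤ 2 := by rw [hr]; linarith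
    have hr4 : r ^ 2 ≤ 4 := by nlinarith
    nlinarith [mul_le_mul_of_nonneg_left hr4 hδ.le]
  rw [h3]; linarith

/-- Jensen's inequality on the discs with centres `2 + it`, averaged over `t`. -/
theorem sum_mult_le_of_mean_le {f : ℂ → ℂ} (hf : Differentiable ℂ f) {u : ℂ → ℝ}
    (hu : Continuous u) (hu0 : ∀ z, 0 ≤ u z) (hfu : ∀ z, Real.log ‖f z‖ ≤ u z)
    {δ α r T w : ℝ} (hδ : 0 < δ) (hδ2 : δ ≤ 1 / 2) (hα : 1 / 2 ≤ α) (hα1 : α ≤ 1)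
    (hr : r = 2 - α + δ) (hT : 0 ≤ T) (S : Finset ℂ) (m : ℂ → ℕ)
    (hm : ∀ ρ ∈ S, m ρ ≤ analyticOrderNatAt f ρ)
    (hS : ∀ ρ ∈ S, α ≤ ρ.re ∧ ρ.re ≤ 1 ∧ T ≤ ρ.im ∧ ρ.im ≤ 2 * T)
    (hw : ∀ t ∈ Set.Icc (T - 1) (2 * T + 1), f (2 + t * I) ≠ 0 ∧ -Real.log ‖f (2 + t * I)‖ ≤ w)
    {G : ℝ → ℝ} (hG : Continuous G)
    (hGu : ∀ σ, α - δ ≤ σ → σ ≤ 4 → ∫ t in (T - 3)..(2 * T + 3), u (σ + t * I) ≤ G σ) :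
    (∑ ρ ∈ S, (m ρ : ℝ)) * (δ * Real.sqrt δ / 8) ≤
      (2 * Real.pi)⁻¹ * (∫ θ in (0)..(2 * Real.pi), G (2 + r * Real.cos θ)) + (T + 2) * w := by
  have hr1 : 1 ≤ r := by rw [hr]; linarith
  have hr2 : r ≤ 2 := by rw [hr]; linarith
  set κ := Real.sqrt δ / 2 with hκ
  have hκ0 : 0 < κ := by rw [hκ]; positivity
  have hκ1 : κ ≤ 1 := by
    rw [hκ]
    have : Real.sqrt δ ≤ 1 := Real.sqrt_le_one.2 (by linarith)
    linarith
  -- `g t` is the guaranteed contribution to Jensen's sum at centre 2 + it. Each zero has a window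
  -- of length 2κ = √δ and weight δ/8, whence the factor δ√δ/8 after integration.
  set g : ℝ → ℝ := fun t => ∑ ρ ∈ S, (m ρ : ℝ) * (δ / 8) *
    (Set.Icc (ρ.im - κ) (ρ.im + κ)).indicator (fun _ => (1 : ℝ)) t with hg
  have hgint : ∀ ρ : ℂ, IntervalIntegrable
      ((Set.Icc (ρ.im - κ) (ρ.im + κ)).indicator (fun _ => (1 : ℝ))) volume (T - 1) (2 * T + 1) := by
    intro ρ
    rw [intervalIntegrable_iff]
    exact (integrableOn_const (by simp)).indicator measurableSet_Icc
  have hgI : ∫ t in (T - 1)..(2 * T + 1), g t = (∑ ρ ∈ S, (m ρ : ℝ)) * (δ * Real.sqrt δ / 8) := by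
    rw [hg, intervalIntegral.integral_finsetSum fun ρ _ => (hgint ρ).const_mul _, Finset.sum_mul]
    refine Finset.sum_congr rfl fun ρ hρ => ?_
    obtain ⟨-, -, h3, h4⟩ := hS ρ hρ
    rw [intervalIntegral.integral_const_mul, intervalIntegral.integral_of_le (by linarith),
      setIntegral_indicator measurableSet_Icc]
    have hcap : volume.real (Set.Ioc (T - 1) (2 * T + 1) ∩ Set.Icc (ρ.im - κ) (ρ.im + κ)) = 2 * κ := by
      have : volume (Set.Ioc (T - 1) (2 * T + 1) ∩ Set.Icc (ρ.im - κ) (ρ.im + κ)) =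
          volume (Set.Icc (ρ.im - κ) (ρ.im + κ)) := by
        apply le_antisymm (measure_mono Set.inter_subset_right)
        rw [← Real.volume_Icc.trans Real.volume_Ioc.symm |>.symm]
        refine measure_mono fun x hx => ⟨⟨by linarith [hx.1], by linarith [hx.2]⟩, hx.1.le, hx.2⟩
      rw [measureReal_def, this, Real.volume_Icc, ENNReal.toReal_ofReal (by linarith)]; ring
    rw [setIntegral_const, hcap, hκ]
    simp only [smul_eq_mul]
    ring
  set H : ℝ → ℝ → ℝ := fun t θ => u (circleMap (2 + t * I) r θ) with hH
  have hHc : Continuous (Function.uncurry H) := by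
    simp only [hH, circleMap, Function.uncurry_def]
    fun_prop
  have havg : ∀ t : ℝ, Real.circleAverage u (2 + t * I) r =
      (2 * Real.pi)⁻¹ * ∫ θ in (0)..(2 * Real.pi), H t θ := fun t => by
    rw [Real.circleAverage_def, smul_eq_mul]
  have hcont : Continuous fun t : ℝ => Real.circleAverage u (2 + t * I) r := by
    simp_rw [havg]
    exact continuous_const.mul
      (intervalIntegral.continuous_parametric_intervalIntegral_of_continuous' hHc _ _)
  have hpt : ∀ t ∈ Set.Icc (T - 1) (2 * T + 1),
      g t ≤ Real.circleAverage u (2 + t * I) r + w := by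
    intro t ht
    classical
    obtain ⟨hne, hlog⟩ := hw t ht
    have hkey := sum_log_le_circleAverage_sub hf hu hfu hne (by linarith : 0 < r)
      (S.filter fun ρ => |t - ρ.im| ≤ κ) m (fun ρ hρ => hm ρ (Finset.mem_filter.1 hρ).1)
      (fun ρ hρ => by
        obtain ⟨h1, h2⟩ := Finset.mem_filter.1 hρ
        exact (log_ratio_ge hδ hδ2 hα hα1 hr (hS ρ h1).1 (hS ρ h1).2.1 h2).1)
    refine le_trans ?_ (hkey.trans (by linarith))
    rw [Finset.sum_filter]
    refine Finset.sum_le_sum fun ρ hρ => ?_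
    by_cases h : |t - ρ.im| ≤ κ
    · rw [if_pos h, Set.indicator_of_mem, mul_one]
      · exact mul_le_mul_of_nonneg_left
          (log_ratio_ge hδ hδ2 hα hα1 hr (hS ρ hρ).1 (hS ρ hρ).2.1 h).2 (Nat.cast_nonneg _)
      · rw [abs_le] at h; exact ⟨by linarith, by linarith⟩
    · rw [if_neg h, Set.indicator_of_notMem, mul_zero]
      intro h'; exact h (abs_le.2 ⟨by linarith [h'.1], by linarith [h'.2]⟩)
  have hmono : ∫ t in (T - 1)..(2 * T + 1), g t ≤
      ∫ t in (T - 1)..(2 * T + 1), (Real.circleAverage u (2 + t * I) r + w) := by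
    refine intervalIntegral.integral_mono_on (by linarith) ?_ ?_ hpt
    · rw [hg]
      have hsum := IntervalIntegrable.sum S fun ρ _ => (hgint ρ).const_mul ((m ρ : ℝ) * (δ / 8))
      rwa [Finset.sum_fn] at hsum
    · exact (hcont.add continuous_const).intervalIntegrable _ _
  rw [hgI, intervalIntegral.integral_add (hcont.intervalIntegrable _ _) (by simp),
    intervalIntegral.integral_const] at hmono
  refine hmono.trans ?_
  -- After Fubini, for fixed θ the moving point of the circle runs along the vertical line σ = 2 + r
  -- cos θ, where the mean value hypothesis applies.
  have hswap : ∫ t in (T - 1)..(2 * T + 1), Real.circleAverage u (2 + t * I) r =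
      (2 * Real.pi)⁻¹ * ∫ θ in (0)..(2 * Real.pi), ∫ t in (T - 1)..(2 * T + 1), H t θ := by
    simp_rw [havg]
    rw [intervalIntegral.integral_const_mul, intervalIntegral_intervalIntegral_swap]
    exact (hHc.continuousOn.integrableOn_compact (isCompact_uIcc.prod isCompact_uIcc)).mono_set
      (Set.prod_mono Set.uIoc_subset_uIcc Set.uIoc_subset_uIcc)
  rw [hswap, smul_eq_mul]
  have hw' : (2 * T + 1 - (T - 1)) * w = (T + 2) * w := by ring
  rw [hw']
  gcongr
  refine intervalIntegral.integral_mono_on (by positivity) ?_ ?_ fun θ _ => ?_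
  · refine Continuous.intervalIntegrable ?_ _ _
    exact intervalIntegral.continuous_parametric_intervalIntegral_of_continuous'
      (f := fun θ t => H t θ) (hHc.comp continuous_swap) _ _
  · exact (hG.comp (by fun_prop)).intervalIntegrable _ _
  · set σ := 2 + r * Real.cos θ with hσ
    have hc1 := Real.neg_one_le_cos θ
    have hc2 := Real.cos_le_one θ
    have hs1 := Real.neg_one_le_sin θ
    have hs2 := Real.sin_le_one θ
    have heq : ∀ t : ℝ, H t θ = (fun t : ℝ => u (σ + t * I)) (t + r * Real.sin θ) := by
      intro t
      simp only [hH, circleMap, hσ]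
      congr 1
      rw [exp_mul_I, ← ofReal_cos, ← ofReal_sin]
      push_cast
      ring_nf
    rw [intervalIntegral.integral_congr fun t _ => heq t,
      intervalIntegral.integral_comp_add_right (fun t : ℝ => u (σ + t * I))]
    -- The vertical shift r sin θ is at most 2 in size, which is why [T - 1, 2T + 1] widens to [T -
    -- 3, 2T + 3]; and σ ≥ 2 - r = α - δ.
    refine le_trans ?_ (hGu σ (by rw [hσ]; nlinarith) (by rw [hσ]; nlinarith))
    refine intervalIntegral.integral_mono_interval (by nlinarith) (by linarith) (by nlinarith)
      (Filter.Eventually.of_forall fun t => hu0 _) ?_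
    exact (hu.comp (by fun_prop)).intervalIntegrable _ _

/-! ### Möbius sums with coprimality conditions -/

open scoped ArithmeticFunction.Moebius

theorem sum_Icc_filter_dvd {M : Type*} [AddCommMonoid M] (f : ℕ → M) {d : ℕ} (hd : 0 < d) (N : ℕ) :
    ∑ n ∈ (Finset.Icc 1 N).filter (d ∣ ·), f n = ∑ j ∈ Finset.Icc 1 (N / d), f (d * j) := by
  symm
  refine Finset.sum_nbij' (fun j => d * j) (fun n => n / d) ?_ ?_ ?_ ?_ ?_
  · intro j hj
    simp only [Finset.mem_Icc, Finset.mem_filter] at *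
    refine ⟨⟨Nat.mul_pos hd (by omega), ?_⟩, dvd_mul_right _ _⟩
    rw [mul_comm]; exact (Nat.le_div_iff_mul_le hd).1 hj.2
  · intro n hn
    simp only [Finset.mem_Icc, Finset.mem_filter] at *
    obtain ⟨⟨h1, h2⟩, c, rfl⟩ := hn
    rw [Nat.mul_div_cancel_left _ hd]
    refine ⟨Nat.pos_of_mul_pos_left h1, ?_⟩
    rw [Nat.le_div_iff_mul_le hd, mul_comm]; exact h2
  · intro j _; exact Nat.mul_div_cancel_left _ hd
  · intro n hn
    simp only [Finset.mem_Icc, Finset.mem_filter] at *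
    exact Nat.mul_div_cancel' hn.2
  · intro _ _; rfl

theorem sum_Icc_sum_divisors {M : Type*} [AddCommMonoid M] (f : ℕ → ℕ → M) (N : ℕ) :
    ∑ n ∈ Finset.Icc 1 N, ∑ d ∈ n.divisors, f d n =
      ∑ d ∈ Finset.Icc 1 N, ∑ j ∈ Finset.Icc 1 (N / d), f d (d * j) := by
  have h1 : ∀ n ∈ Finset.Icc 1 N, ∑ d ∈ n.divisors, f d n =
      ∑ d ∈ Finset.Icc 1 N, if d ∣ n then f d n else 0 := by
    intro n hn
    rw [← Finset.sum_filter]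
    refine Finset.sum_congr ?_ fun _ _ => rfl
    ext d
    simp only [Finset.mem_Icc, Finset.mem_filter, Nat.mem_divisors] at *
    constructor
    · rintro ⟨h, _⟩
      exact ⟨⟨Nat.pos_of_dvd_of_pos h (by omega), (Nat.le_of_dvd (by omega) h).trans hn.2⟩, h⟩
    · rintro ⟨_, h⟩; exact ⟨h, by omega⟩
  rw [Finset.sum_congr rfl h1, Finset.sum_comm]
  refine Finset.sum_congr rfl fun d hd => ?_
  rw [← Finset.sum_filter, sum_Icc_filter_dvd (f d) (by simp at hd; omega)]

theorem sum_Icc_inv_le (N : ℕ) : ∑ n ∈ Finset.Icc 1 N, (1 / n : ℝ) ≤ 1 + Real.log N := by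
  have h := harmonic_le_one_add_log N
  rw [harmonic_eq_sum_Icc] at h
  push_cast at h
  simpa [one_div] using h

theorem sum_Icc_inv_sq_le (N : ℕ) : ∑ n ∈ Finset.Icc 1 N, (1 / (n : ℝ) ^ 2) ≤ 2 := by
  have h : ∀ N : ℕ, ∑ n ∈ Finset.Icc 1 N, (1 / (n : ℝ) ^ 2) ≤ 2 - 1 / (N : ℝ) := by
    intro N
    induction N with
    | zero => norm_num
    | succ n ih =>
      rw [Finset.sum_Icc_succ_top (by omega)]
      rcases Nat.eq_zero_or_pos n with rfl | hn
      · norm_num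
      push_cast
      have hn' : (0 : ℝ) < n := by exact_mod_cast hn
      have h1 : (1 : ℝ) / (n + 1) ^ 2 ≤ 1 / n - 1 / (n + 1) := by
        rw [div_sub_div _ _ hn'.ne' (by positivity), div_le_div_iff₀ (by positivity) (by positivity)]
        nlinarith
      linarith
  have : (0 : ℝ) ≤ 1 / (N : ℝ) := by positivity
  linarith [h N]

/-- The sum of `μ` over the divisors of `m` prime to `q`. -/
theorem sum_moebius_divisors_coprime_mem (q m : ℕ) (hm : 0 < m) :
    ∑ n ∈ m.divisors.filter (Nat.Coprime · q), μ n = 0 ∨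
      ∑ n ∈ m.divisors.filter (Nat.Coprime · q), μ n = 1 := by
  induction m using Nat.strong_induction_on with
  | _ m ih =>
    by_cases h : Nat.Coprime m q
    · rw [Finset.filter_true_of_mem
        (fun n hn => Nat.Coprime.coprime_dvd_left (Nat.dvd_of_mem_divisors hn) h)]
      have := ArithmeticFunction.coe_mul_zeta_apply (f := μ) (x := m)
      rw [ArithmeticFunction.moebius_mul_coe_zeta, ArithmeticFunction.one_apply] at this
      rw [← this]
      split_ifs <;> simp
    · obtain ⟨p, hp, hpm, hpq⟩ := Nat.Prime.not_coprime_iff_dvd.1 h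
      obtain ⟨r, rfl⟩ := hpm
      have hr : 0 < r := Nat.pos_of_mul_pos_left hm
      have : (p * r).divisors.filter (Nat.Coprime · q) = r.divisors.filter (Nat.Coprime · q) := by
        ext n
        simp only [Finset.mem_filter, Nat.mem_divisors]
        constructor
        · rintro ⟨⟨h1, _⟩, h3⟩
          refine ⟨⟨Nat.Coprime.dvd_of_dvd_mul_left ?_ h1, hr.ne'⟩, h3⟩
          exact Nat.Coprime.coprime_dvd_right hpq h3
        · rintro ⟨⟨h1, _⟩, h3⟩
          exact ⟨⟨Dvd.dvd.mul_left h1 p, hm.ne'⟩, h3⟩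
      rw [this]
      exact ih r (by nlinarith [hp.two_le]) hr

theorem sum_moebius_divisors_of_coprime {q m : ℕ} (hm : 1 < m) (h : Nat.Coprime m q) :
    ∑ n ∈ m.divisors.filter (Nat.Coprime · q), μ n = 0 := by
  rw [Finset.filter_true_of_mem
    (fun n hn => Nat.Coprime.coprime_dvd_left (Nat.dvd_of_mem_divisors hn) h)]
  have := ArithmeticFunction.coe_mul_zeta_apply (f := μ) (x := m)
  rw [ArithmeticFunction.moebius_mul_coe_zeta, ArithmeticFunction.one_apply, if_neg hm.ne'] at this
  exact this.symm

/-- Multiply by N and write N/n as its integer part plus a fractional part. The integer parts give ∑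
c(m) over m ≤ N with c(m) in {0, 1}. A fractional error occurs only at n prime to q with n > 1,
exactly where c(n) = 0. So each integer up to N is charged at most once and the total is at most N.
-/
theorem abs_sum_moebius_coprime_div_le_one (q N : ℕ) :
    |∑ n ∈ (Finset.Icc 1 N).filter (Nat.Coprime · q), (μ n : ℝ) / n| ≤ 1 := by
  rcases Nat.eq_zero_or_pos N with rfl | hN
  · simp
  set S := (Finset.Icc 1 N).filter (Nat.Coprime · q) with hS
  have hcount : ∑ n ∈ S, (μ n : ℝ) * ((N / n : ℕ) : ℝ) =
      ∑ m ∈ Finset.Icc 1 N, ((∑ n ∈ m.divisors.filter (Nat.Coprime · q), μ n : ℤ) : ℝ) := by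
    have := sum_Icc_sum_divisors (fun d _ => if Nat.Coprime d q then (μ d : ℝ) else 0) N
    simp only [Finset.sum_const, Nat.card_Icc, Nat.add_sub_cancel, nsmul_eq_mul] at this
    rw [hS, Finset.sum_filter]
    push_cast
    simp_rw [Finset.sum_filter]
    rw [this]
    refine Finset.sum_congr rfl fun n _ => ?_
    split_ifs <;> ring
  set c : ℕ → ℝ := fun m => ((∑ n ∈ m.divisors.filter (Nat.Coprime · q), μ n : ℤ) : ℝ) with hc
  have hfrac : ∀ n ∈ S, |(μ n : ℝ) * ((N : ℝ) / n - ((N / n : ℕ) : ℝ))| ≤ if n = 1 then 0 else 1 := by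
    intro n hn
    have hn1 : 0 < n := by simp [hS] at hn; omega
    split_ifs with h
    · simp [h]
    · rw [abs_mul]
      have h1 : |(μ n : ℝ)| ≤ 1 := by
        exact_mod_cast ArithmeticFunction.abs_moebius_le_one (n := n)
      have h2 : |(N : ℝ) / n - ((N / n : ℕ) : ℝ)| ≤ 1 := by
        rw [abs_of_nonneg (sub_nonneg.2 Nat.cast_div_le)]
        have := Nat.lt_div_mul_add (a := N) hn1
        rw [sub_le_iff_le_add, div_le_iff₀ (by positivity)]
        have h3 : (N : ℝ) < (N / n : ℕ) * n + n := by exact_mod_cast this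
        linarith
      calc _ ≤ 1 * 1 := mul_le_mul h1 h2 (abs_nonneg _) zero_le_one
        _ = 1 := one_mul 1
  have hc0 : ∀ m ∈ Finset.Icc 1 N, |c m| + (if m ∈ S then (if m = 1 then 0 else 1) else 0) ≤ 1 := by
    intro m hm
    have hm1 : 0 < m := by simp at hm; omega
    have habs : |c m| ≤ 1 := by
      simp only [hc]
      rcases sum_moebius_divisors_coprime_mem q m hm1 with h | h <;> rw [h] <;> simp
    by_cases hmS : m ∈ S
    · by_cases hm2 : m = 1
      · simpa [hmS, hm2] using habs
      · have h0 : c m = 0 := by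
          simp only [hc]
          rw [sum_moebius_divisors_of_coprime (by omega) (by simp [hS] at hmS; exact hmS.2)]
          simp
        simp [hmS, hm2, h0]
    · simpa [hmS] using habs
  have hsum : (N : ℝ) * ∑ n ∈ S, (μ n : ℝ) / n =
      ∑ m ∈ Finset.Icc 1 N, c m + ∑ n ∈ S, (μ n : ℝ) * ((N : ℝ) / n - ((N / n : ℕ) : ℝ)) := by
    rw [← hcount, ← Finset.sum_add_distrib, Finset.mul_sum]
    refine Finset.sum_congr rfl fun n _ => by ring
  have hbound : |(N : ℝ) * ∑ n ∈ S, (μ n : ℝ) / n| ≤ N := by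
    rw [hsum]
    calc _ ≤ ∑ m ∈ Finset.Icc 1 N, |c m| + ∑ n ∈ S, (if n = 1 then (0 : ℝ) else 1) :=
          (abs_add_le _ _).trans (add_le_add (Finset.abs_sum_le_sum_abs _ _)
            ((Finset.abs_sum_le_sum_abs _ _).trans (Finset.sum_le_sum hfrac)))
      _ = ∑ m ∈ Finset.Icc 1 N, (|c m| + (if m ∈ S then (if m = 1 then 0 else 1) else 0)) := by
          rw [Finset.sum_add_distrib, ← Finset.sum_filter]
          congr 2
          ext m; simp [hS]
      _ ≤ ∑ m ∈ Finset.Icc 1 N, (1 : ℝ) := Finset.sum_le_sum hc0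
      _ = N := by simp
  rw [abs_mul, abs_of_nonneg (Nat.cast_nonneg N)] at hbound
  have hNpos : (0 : ℝ) < N := by exact_mod_cast hN
  exact le_of_mul_le_mul_left (by linarith) hNpos

/-- `∑ μ(e)μ(e')/(ee')` over coprime `e, e' ≤ Y` that are prime to `g`. -/
noncomputable def coprimeMoebiusForm (Y g : ℕ) : ℝ :=
  ∑ e ∈ (Finset.Icc 1 Y).filter (Nat.Coprime · g), ∑ e' ∈ (Finset.Icc 1 Y).filter (Nat.Coprime · g),
    if Nat.Coprime e e' then (μ e : ℝ) / e * ((μ e' : ℝ) / e') else 0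

theorem moebius_mul_div (f j : ℕ) : (μ (f * j) : ℝ) / ((f * j : ℕ) : ℝ) =
    if Nat.Coprime j f then (μ f : ℝ) / f * ((μ j : ℝ) / j) else 0 := by
  split_ifs with h
  · rw [ArithmeticFunction.isMultiplicative_moebius.map_mul_of_coprime h.symm]
    push_cast
    rw [mul_div_mul_comm]
  · rw [ArithmeticFunction.moebius_eq_zero_of_not_squarefree]
    · simp
    · intro hs
      exact h (Nat.coprime_of_squarefree_mul hs).symm

/-- Writing e = fj pulls out μ(f)/f and leaves the preceding kind of sum, with j prime to fg; the
uniformity in the modulus is what is used. -/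
theorem abs_sum_moebius_multiples_le {f : ℕ} (hf : 0 < f) (Y g : ℕ) :
    |∑ e ∈ (Finset.Icc 1 Y).filter (Nat.Coprime · g), if f ∣ e then (μ e : ℝ) / e else 0| ≤ 1 / f := by
  have h1 : ∑ e ∈ (Finset.Icc 1 Y).filter (Nat.Coprime · g), (if f ∣ e then (μ e : ℝ) / e else 0) =
      (if Nat.Coprime f g then (μ f : ℝ) / f else 0) *
        ∑ j ∈ (Finset.Icc 1 (Y / f)).filter (Nat.Coprime · (f * g)), (μ j : ℝ) / j := by
    rw [Finset.sum_filter]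
    have := sum_Icc_filter_dvd (fun e => if Nat.Coprime e g then (μ e : ℝ) / e else 0) hf Y
    rw [Finset.sum_filter] at this
    calc _ = ∑ a ∈ Finset.Icc 1 Y,
          if f ∣ a then (if Nat.Coprime a g then (μ a : ℝ) / a else 0) else 0 := by
          refine Finset.sum_congr rfl fun e _ => ?_
          split_ifs <;> rfl
      _ = _ := by
          rw [this, Finset.sum_filter, Finset.mul_sum]
          refine Finset.sum_congr rfl fun j _ => ?_
          rw [moebius_mul_div]
          simp only [Nat.coprime_mul_iff_left, Nat.coprime_mul_iff_right]
          grind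
  rw [h1, abs_mul]
  have h2 : |if Nat.Coprime f g then (μ f : ℝ) / f else 0| ≤ 1 / f := by
    split_ifs
    · rw [abs_div, Nat.abs_cast]
      gcongr
      exact_mod_cast ArithmeticFunction.abs_moebius_le_one (n := f)
    · simp
  calc _ ≤ 1 / (f : ℝ) * 1 := mul_le_mul h2 (abs_sum_moebius_coprime_div_le_one _ _) (abs_nonneg _)
        (by positivity)
    _ = _ := mul_one _

/-- Detecting the condition (e, e') = 1 by ∑ μ(f) over f | (e, e') diagonalises the form. By the
previous lemma the f-th square is at most 1/f², so the form is bounded uniformly in `Y` and `g`. -/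
theorem coprimeMoebiusForm_eq (Y g : ℕ) : coprimeMoebiusForm Y g = ∑ f ∈ Finset.Icc 1 Y,
    (μ f : ℝ) * (∑ e ∈ (Finset.Icc 1 Y).filter (Nat.Coprime · g),
      if f ∣ e then (μ e : ℝ) / e else 0) ^ 2 := by
  have key : ∀ e ∈ (Finset.Icc 1 Y).filter (Nat.Coprime · g), ∀ e' ∈ (Finset.Icc 1 Y).filter (Nat.Coprime · g),
      (if Nat.Coprime e e' then (μ e : ℝ) / e * ((μ e' : ℝ) / e') else 0) =
      ∑ f ∈ Finset.Icc 1 Y, (μ f : ℝ) * ((if f ∣ e then (μ e : ℝ) / e else 0) *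
        (if f ∣ e' then (μ e' : ℝ) / e' else 0)) := by
    intro e he e' _
    simp only [Finset.mem_filter, Finset.mem_Icc] at he
    have hpos : 0 < Nat.gcd e e' := Nat.gcd_pos_of_pos_left _ (by omega)
    have h2 : ∑ f ∈ Finset.Icc 1 Y, (μ f : ℝ) * ((if f ∣ e then (μ e : ℝ) / e else 0) *
        (if f ∣ e' then (μ e' : ℝ) / e' else 0)) =
        (∑ f ∈ (Nat.gcd e e').divisors, (μ f : ℝ)) * ((μ e : ℝ) / e * ((μ e' : ℝ) / e')) := by
      rw [Finset.sum_mul]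
      symm
      have hsub : (Nat.gcd e e').divisors ⊆ Finset.Icc 1 Y := by
        intro f hf
        have h1 := Nat.dvd_of_mem_divisors hf
        have h3 := Nat.le_of_dvd (by omega) (h1.trans (Nat.gcd_dvd_left e e'))
        have := Nat.pos_of_mem_divisors hf
        simp only [Finset.mem_Icc]; omega
      rw [← Finset.sum_subset hsub (f := fun f => (μ f : ℝ) * ((if f ∣ e then (μ e : ℝ) / e else 0) *
        (if f ∣ e' then (μ e' : ℝ) / e' else 0)))]
      · refine Finset.sum_congr rfl fun f hf => ?_
        have h1 := Nat.dvd_of_mem_divisors hf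
        rw [if_pos (h1.trans (Nat.gcd_dvd_left e e')), if_pos (h1.trans (Nat.gcd_dvd_right e e'))]
      · intro f _ hf
        have : ¬ (f ∣ e ∧ f ∣ e') := by
          rw [← Nat.dvd_gcd_iff]
          intro h; exact hf (Nat.mem_divisors.2 ⟨h, hpos.ne'⟩)
        by_cases h1 : f ∣ e
        · simp [show ¬ f ∣ e' from fun h => this ⟨h1, h⟩]
        · simp [h1]
    rw [h2]
    have := ArithmeticFunction.coe_mul_zeta_apply (f := μ) (x := Nat.gcd e e')
    rw [ArithmeticFunction.moebius_mul_coe_zeta, ArithmeticFunction.one_apply] at this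
    have h3 : (∑ f ∈ (Nat.gcd e e').divisors, (μ f : ℝ)) = if Nat.Coprime e e' then 1 else 0 := by
      rw [← Int.cast_sum, ← this]
      simp only [Nat.Coprime]
      split_ifs <;> simp
    rw [h3]
    split_ifs <;> simp
  unfold coprimeMoebiusForm
  rw [Finset.sum_congr rfl fun e he => Finset.sum_congr rfl (key e he)]
  simp_rw [Finset.sum_comm (t := Finset.Icc 1 Y)]
  refine Finset.sum_congr rfl fun f _ => ?_
  rw [sq, Finset.sum_mul_sum, Finset.mul_sum]
  refine Finset.sum_congr rfl fun e _ => ?_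
  rw [Finset.mul_sum]

theorem abs_coprimeMoebiusForm_le (Y g : ℕ) : |coprimeMoebiusForm Y g| ≤ 2 := by
  rw [coprimeMoebiusForm_eq]
  refine (Finset.abs_sum_le_sum_abs _ _).trans (le_trans (Finset.sum_le_sum fun f hf => ?_)
    (sum_Icc_inv_sq_le Y))
  have hf0 : 0 < f := by simp at hf; omega
  rw [abs_mul, abs_pow]
  have h1 : |(μ f : ℝ)| ≤ 1 := by exact_mod_cast ArithmeticFunction.abs_moebius_le_one (n := f)
  calc _ ≤ 1 * (1 / (f : ℝ)) ^ 2 := by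
        gcongr
        exact abs_sum_moebius_multiples_le hf0 Y g
    _ = _ := by rw [one_mul, div_pow, one_pow]

/-! ### The diagonal of the mollified mean square -/

/-- The quadratic form `∑ μ(d)μ(d')/(dk)` over `d, d' ≤ X`, `k, k' ≤ K` with `dk = d'k'`. -/
noncomputable def mollifiedDiagonal (X K : ℕ) : ℝ :=
  ∑ p ∈ ((Finset.Icc 1 X ×ˢ Finset.Icc 1 K) ×ˢ (Finset.Icc 1 X ×ˢ Finset.Icc 1 K)).filter
    (fun p => p.1.1 * p.1.2 = p.2.1 * p.2.2),
    (μ p.1.1 : ℝ) * (μ p.2.1 : ℝ) / ((p.1.1 * p.1.2 : ℕ) : ℝ)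

theorem exists_coprime_param {d k d' k' : ℕ} (hd : 0 < d) (hk : 0 < k) (h : d * k = d' * k') :
    ∃ g m e e' : ℕ, Nat.Coprime e e' ∧ d = g * e ∧ d' = g * e' ∧ k = m * e' ∧ k' = m * e := by
  obtain ⟨e, e', hc, h1, h2⟩ := Nat.exists_coprime d d'
  have hg : 0 < Nat.gcd d d' := Nat.gcd_pos_of_pos_left _ hd
  set g := Nat.gcd d d'
  have h3 : e * k = e' * k' := by
    apply Nat.eq_of_mul_eq_mul_left hg
    calc g * (e * k) = d * k := by rw [h1]; ring
      _ = d' * k' := h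
      _ = g * (e' * k') := by rw [h2]; ring
  obtain ⟨m, hm⟩ : e' ∣ k := hc.symm.dvd_of_dvd_mul_left (Dvd.intro _ h3.symm)
  refine ⟨g, m, e, e', hc, by rw [h1]; ring, by rw [h2]; ring, by rw [hm]; ring, ?_⟩
  have he' : 0 < e' := Nat.pos_of_ne_zero (by rintro rfl; simp at hm; omega)
  apply Nat.eq_of_mul_eq_mul_left he'
  rw [← h3, hm]; ring

/-- The solutions of dk = d'k' are d = ge, d' = ge', k = me', k' = me with e, e' coprime. Since
μ(ge) is μ(g)μ(e) for coprime g, e and zero otherwise, the sum over e, e' is a coprime Möbius form,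
with all four size conditions merged into one minimum. -/
theorem mollifiedDiagonal_eq (X K : ℕ) : mollifiedDiagonal X K =
    ∑ g ∈ Finset.Icc 1 X, ∑ m ∈ Finset.Icc 1 K,
      (μ g : ℝ) ^ 2 / ((g : ℝ) * m) * coprimeMoebiusForm (min (X / g) (K / m)) g := by
  have h1 : mollifiedDiagonal X K = ∑ q ∈ ((Finset.Icc 1 X ×ˢ Finset.Icc 1 K) ×ˢ
      (Finset.Icc 1 X ×ˢ Finset.Icc 1 X)).filter (fun q => Nat.Coprime q.2.1 q.2.2 ∧
        (q.1.1 * q.2.1 ≤ X ∧ q.1.2 * q.2.1 ≤ K) ∧ (q.1.1 * q.2.2 ≤ X ∧ q.1.2 * q.2.2 ≤ K)),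
      (μ (q.1.1 * q.2.1) : ℝ) * (μ (q.1.1 * q.2.2) : ℝ) /
        ((q.1.1 * q.2.1 * (q.1.2 * q.2.2) : ℕ) : ℝ) := by
    unfold mollifiedDiagonal
    symm
    refine Finset.sum_nbij
      (fun q => ((q.1.1 * q.2.1, q.1.2 * q.2.2), (q.1.1 * q.2.2, q.1.2 * q.2.1))) ?_ ?_ ?_ ?_
    · rintro ⟨⟨g, m⟩, e, e'⟩ h
      simp only [Finset.mem_filter, Finset.mem_product, Finset.mem_Icc] at h ⊢
      obtain ⟨⟨⟨h1, h2⟩, h3, h4⟩, -, h6, h7⟩ := h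
      refine ⟨⟨⟨⟨Nat.mul_pos h1.1 h3.1, h6.1⟩, Nat.mul_pos h2.1 h4.1, h7.2⟩,
        ⟨Nat.mul_pos h1.1 h4.1, h7.1⟩, Nat.mul_pos h2.1 h3.1, h6.2⟩, by ring⟩
    · rintro ⟨⟨g, m⟩, e, e'⟩ h ⟨⟨g2, m2⟩, e2, e2'⟩ h2 heq
      simp only [Finset.coe_filter, Set.mem_ofPred_eq, Finset.mem_product, Finset.mem_Icc] at h h2
      simp only [Prod.mk.injEq] at heq ⊢
      obtain ⟨⟨q1, q2⟩, q3, q4⟩ := heq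
      -- Injectivity: coprimality of e, e' recovers g as the gcd of ge and ge'; m is recovered in
      -- the same way.
      have hg : g = g2 := by
        have a := Nat.gcd_mul_left g e e'
        have b := Nat.gcd_mul_left g2 e2 e2'
        rw [h.2.1.gcd_eq_one, mul_one, q1, q3] at a
        rw [h2.2.1.gcd_eq_one, mul_one] at b
        exact a.symm.trans b
      have hm : m = m2 := by
        have a := Nat.gcd_mul_left m e e'
        have b := Nat.gcd_mul_left m2 e2 e2'
        rw [h.2.1.gcd_eq_one, mul_one, q2, q4] at a
        rw [h2.2.1.gcd_eq_one, mul_one] at b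
        exact a.symm.trans b
      subst hg hm
      exact ⟨⟨rfl, rfl⟩, Nat.eq_of_mul_eq_mul_left h.1.1.1.1 q1,
        Nat.eq_of_mul_eq_mul_left h.1.1.1.1 q3⟩
    · rintro ⟨⟨d, k⟩, d', k'⟩ h
      simp only [Finset.coe_filter, Set.mem_ofPred_eq, Finset.mem_product, Finset.mem_Icc] at h
      obtain ⟨⟨⟨hd, hk⟩, hd', hk'⟩, heq⟩ := h
      obtain ⟨g, m, e, e', hc, rfl, rfl, rfl, rfl⟩ := exists_coprime_param hd.1 hk.1 heq
      refine ⟨((g, m), (e, e')), ?_, rfl⟩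
      have g0 : 0 < g := Nat.pos_of_mul_pos_right hd.1
      have e0 : 0 < e := Nat.pos_of_mul_pos_left hd.1
      have m0 : 0 < m := Nat.pos_of_mul_pos_right hk.1
      have e0' : 0 < e' := Nat.pos_of_mul_pos_left hk.1
      simp only [Finset.coe_filter, Set.mem_ofPred_eq, Finset.mem_product, Finset.mem_Icc]
      exact ⟨⟨⟨⟨g0, (Nat.le_mul_of_pos_right g e0).trans hd.2⟩,
        m0, (Nat.le_mul_of_pos_right m e0').trans hk.2⟩,
        ⟨e0, (Nat.le_mul_of_pos_left e g0).trans hd.2⟩,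
        e0', (Nat.le_mul_of_pos_left e' g0).trans hd'.2⟩, hc, ⟨hd.2, hk'.2⟩, hd'.2, hk.2⟩
    · rintro ⟨⟨g, m⟩, e, e'⟩ _
      rfl
  rw [h1, Finset.sum_filter, Finset.sum_product, Finset.sum_product]
  refine Finset.sum_congr rfl fun g hg => Finset.sum_congr rfl fun m hm => ?_
  simp only [Finset.mem_Icc] at hg hm
  unfold coprimeMoebiusForm
  rw [Finset.sum_product, Finset.mul_sum, Finset.sum_filter]
  have hsub : Finset.Icc 1 (min (X / g) (K / m)) ⊆ Finset.Icc 1 X :=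
    Finset.Icc_subset_Icc_right ((min_le_left _ _).trans (Nat.div_le_self _ _))
  have hmem : ∀ e, 1 ≤ e → (e ∈ Finset.Icc 1 (min (X / g) (K / m)) ↔ (g * e ≤ X ∧ m * e ≤ K)) := by
    intro e he
    simp only [Finset.mem_Icc, le_min_iff, Nat.le_div_iff_mul_le hg.1, Nat.le_div_iff_mul_le hm.1]
    rw [mul_comm e g, mul_comm e m]; tauto
  rw [← Finset.sum_subset hsub]
  · refine Finset.sum_congr rfl fun e he => ?_
    have he1 : 1 ≤ e := (Finset.mem_Icc.1 he).1
    have he2 := (hmem e he1).1 he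
    rw [← Finset.sum_subset hsub]
    · by_cases hcg : Nat.Coprime e g
      · rw [if_pos hcg, Finset.sum_filter, Finset.mul_sum]
        refine Finset.sum_congr rfl fun e' he' => ?_
        have he1' : 1 ≤ e' := (Finset.mem_Icc.1 he').1
        have he2' := (hmem e' he1').1 he'
        have r1 := moebius_mul_div g e
        have r2 := moebius_mul_div g e'
        by_cases hcc : Nat.Coprime e e'
        · rw [if_pos ⟨hcc, he2, he2'⟩, if_pos hcc]
          have hge : (g : ℝ) ≠ 0 := by have := hg.1; positivity
          calc _ = ((μ (g * e) : ℝ) / ((g * e : ℕ) : ℝ)) * ((μ (g * e') : ℝ) / ((g * e' : ℕ) : ℝ))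
                * (g / m) := by push_cast; field_simp
            _ = _ := by
              rw [r1, r2, if_pos hcg]
              split_ifs
              · field_simp
              · simp
        · rw [if_neg (fun h => hcc h.1)]
          simp [hcc]
      · rw [if_neg hcg]
        refine Finset.sum_eq_zero fun e' _ => ?_
        have r1 := moebius_mul_div g e
        rw [if_neg hcg, div_eq_zero_iff] at r1
        have : (μ (g * e) : ℝ) = 0 := by
          rcases r1 with r1 | r1
          · exact r1
          · exfalso
            have := Nat.mul_pos hg.1 he1
            rw [Nat.cast_eq_zero] at r1; omega
        simp [this]
    · intro e' he' hne'
      rw [if_neg]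
      rintro ⟨-, -, h⟩
      exact hne' ((hmem e' (Finset.mem_Icc.1 he').1).2 h)
  · intro e he hne
    refine Finset.sum_eq_zero fun e' _ => ?_
    rw [if_neg]
    rintro ⟨-, h, -⟩
    exact hne ((hmem e (Finset.mem_Icc.1 he).1).2 h)

/-- The inner forms are bounded, so only two harmonic sums remain. Bounding the coefficients by the
divisor function would give four logarithms instead of two, and spoil the final exponent 3. -/
theorem mollifiedDiagonal_le (X K : ℕ) :
    mollifiedDiagonal X K ≤ 2 * (1 + Real.log X) * (1 + Real.log K) := by
  rw [mollifiedDiagonal_eq]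
  calc _ ≤ ∑ g ∈ Finset.Icc 1 X, ∑ m ∈ Finset.Icc 1 K, (1 / (g : ℝ)) * (1 / (m : ℝ)) * 2 := by
        refine Finset.sum_le_sum fun g _ => Finset.sum_le_sum fun m _ => ?_
        refine (le_abs_self _).trans ?_
        rw [abs_mul]
        refine mul_le_mul ?_ (abs_coprimeMoebiusForm_le _ _) (abs_nonneg _) (by positivity)
        rw [abs_of_nonneg (by positivity), one_div_mul_one_div]
        gcongr
        have : |(μ g : ℝ)| ≤ 1 := by exact_mod_cast ArithmeticFunction.abs_moebius_le_one (n := g)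
        exact (sq_le_one_iff_abs_le_one _).2 this
    _ = 2 * (∑ g ∈ Finset.Icc 1 X, 1 / (g : ℝ)) * ∑ m ∈ Finset.Icc 1 K, 1 / (m : ℝ) := by
        rw [mul_assoc, Finset.sum_mul_sum, Finset.mul_sum]
        refine Finset.sum_congr rfl fun g _ => ?_
        rw [Finset.mul_sum]
        refine Finset.sum_congr rfl fun m _ => by ring
    _ ≤ _ := by
        have h1 := sum_Icc_inv_le X
        have h2 := sum_Icc_inv_le K
        have h3 : 0 ≤ ∑ m ∈ Finset.Icc 1 K, 1 / (m : ℝ) := Finset.sum_nonneg fun _ _ => by positivity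
        have h4 := Real.log_natCast_nonneg X
        gcongr

/-- The coefficient of `n^{-s}` in `(∑_{d ≤ X} μ(d) d^{-s}) (∑_{k ≤ K} k^{-s})`. -/
noncomputable def mollifiedCoeff (X K n : ℕ) : ℝ :=
  ∑ p ∈ (Finset.Icc 1 X ×ˢ Finset.Icc 1 K).filter (fun p => p.1 * p.2 = n), (μ p.1 : ℝ)

/-- For n ≤ X ≤ K neither truncation is felt, so the coefficient is the full divisor sum of μ. This
is what the mollifier is for. -/
theorem mollifiedCoeff_eq_zero {X K n : ℕ} (hXK : X ≤ K) (h1 : 1 < n) (hn : n ≤ X) :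
    mollifiedCoeff X K n = 0 := by
  have : mollifiedCoeff X K n = ∑ d ∈ n.divisors, (μ d : ℝ) := by
    unfold mollifiedCoeff
    rw [← Nat.sum_divisorsAntidiagonal (fun d _ => (μ d : ℝ))]
    refine Finset.sum_congr ?_ fun _ _ => rfl
    ext ⟨d, k⟩
    simp only [Finset.mem_filter, Finset.mem_product, Finset.mem_Icc, Nat.mem_divisorsAntidiagonal]
    constructor
    · rintro ⟨_, h⟩; exact ⟨h, by omega⟩
    · rintro ⟨rfl, h⟩
      have hd : 0 < d := Nat.pos_of_mul_pos_right (by omega : 0 < d * k)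
      have hk : 0 < k := Nat.pos_of_mul_pos_left (by omega : 0 < d * k)
      have := Nat.le_mul_of_pos_right d hk
      have := Nat.le_mul_of_pos_left k hd
      exact ⟨⟨⟨hd, by omega⟩, hk, by omega⟩, rfl⟩
  rw [this]
  have := ArithmeticFunction.coe_mul_zeta_apply (f := μ) (x := n)
  rw [ArithmeticFunction.moebius_mul_coe_zeta, ArithmeticFunction.one_apply, if_neg h1.ne'] at this
  exact_mod_cast this.symm

theorem mollifiedDiagonal_eq_sum_sq (X K : ℕ) : mollifiedDiagonal X K =
    ∑ n ∈ Finset.Icc 1 (X * K), mollifiedCoeff X K n ^ 2 / n := by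
  unfold mollifiedDiagonal mollifiedCoeff
  set P := Finset.Icc 1 X ×ˢ Finset.Icc 1 K with hP
  have hmaps : ∀ p ∈ P, p.1 * p.2 ∈ Finset.Icc 1 (X * K) := by
    rintro ⟨d, k⟩ h
    simp only [hP, Finset.mem_product, Finset.mem_Icc] at h ⊢
    exact ⟨Nat.mul_pos h.1.1 h.2.1, Nat.mul_le_mul h.1.2 h.2.2⟩
  rw [Finset.sum_filter, Finset.sum_product,
    ← Finset.sum_fiberwise_of_maps_to (g := fun p : ℕ × ℕ => p.1 * p.2) hmaps]
  refine Finset.sum_congr rfl fun n _ => ?_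
  rw [sq, Finset.sum_mul_sum, Finset.sum_div]
  refine Finset.sum_congr rfl fun p hp => ?_
  have hp2 := (Finset.mem_filter.1 hp).2
  rw [Finset.sum_div, Finset.sum_filter]
  refine Finset.sum_congr rfl fun q _ => ?_
  simp only [hp2, eq_comm (a := n)]

/-! ### Power sums weighted by the divisor function -/

theorem sum_Icc_rpow_neg_half_le (J : ℕ) :
    ∑ j ∈ Finset.Icc 1 J, (j : ℝ) ^ (-(1 / 2) : ℝ) ≤ 2 * Real.sqrt J := by
  induction J with
  | zero => simp
  | succ n ih =>
    rw [Finset.sum_Icc_succ_top (by omega)]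
    have h0 : (0 : ℝ) ≤ n := Nat.cast_nonneg n
    have h1 : ((n + 1 : ℕ) : ℝ) ^ (-(1 / 2) : ℝ) = 1 / Real.sqrt (n + 1) := by
      rw [Real.rpow_neg (by positivity), ← Real.sqrt_eq_rpow]; push_cast; rw [one_div]
    rw [h1]
    push_cast
    have hs : 0 < Real.sqrt (n + 1) := Real.sqrt_pos.2 (by positivity)
    have a := Real.sq_sqrt h0
    have b := Real.sq_sqrt (by positivity : (0 : ℝ) ≤ n + 1)
    have key : 1 / Real.sqrt (n + 1) ≤ 2 * Real.sqrt (n + 1) - 2 * Real.sqrt n := by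
      rw [div_le_iff₀ hs]
      nlinarith [sq_nonneg (Real.sqrt (n + 1) - Real.sqrt n)]
    linarith

/-- Reduction to exponent 1/2. Away from a = 1 no logarithm is lost; with a = 2σ - 1 this covers σ ≤
3/4, where the logarithms matter. -/
theorem sum_Icc_rpow_neg_le_of_le_half {a : ℝ} (ha : a ≤ 1 / 2) (J : ℕ) :
    ∑ j ∈ Finset.Icc 1 J, (j : ℝ) ^ (-a) ≤ 2 * (J : ℝ) ^ (1 - a) := by
  rcases Nat.eq_zero_or_pos J with rfl | hJ
  · simp; positivity
  have hJ' : (0 : ℝ) < J := by exact_mod_cast hJ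
  calc _ ≤ ∑ j ∈ Finset.Icc 1 J, (J : ℝ) ^ (1 / 2 - a) * (j : ℝ) ^ (-(1 / 2) : ℝ) := by
        refine Finset.sum_le_sum fun j hj => ?_
        simp only [Finset.mem_Icc] at hj
        have hj' : (0 : ℝ) < j := by exact_mod_cast hj.1
        have : (j : ℝ) ^ (-a) = (j : ℝ) ^ (1 / 2 - a) * (j : ℝ) ^ (-(1 / 2) : ℝ) := by
          rw [← Real.rpow_add hj']; ring_nf
        rw [this]
        gcongr
        exact hj.2
    _ ≤ (J : ℝ) ^ (1 / 2 - a) * (2 * Real.sqrt J) := by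
        rw [← Finset.mul_sum]
        gcongr
        exact sum_Icc_rpow_neg_half_le J
    _ = _ := by
        rw [Real.sqrt_eq_rpow, mul_left_comm, ← Real.rpow_add hJ']; ring_nf

theorem sum_Icc_rpow_neg_le_of_le_one {a : ℝ} (ha : a ≤ 1) {J N : ℕ} (hJN : J ≤ N) :
    ∑ j ∈ Finset.Icc 1 J, (j : ℝ) ^ (-a) ≤ (1 + Real.log N) * (J : ℝ) ^ (1 - a) := by
  rcases Nat.eq_zero_or_pos J with rfl | hJ
  · have := Real.log_natCast_nonneg N
    simp; positivity
  have hJ' : (0 : ℝ) < J := by exact_mod_cast hJ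
  calc _ ≤ ∑ j ∈ Finset.Icc 1 J, (1 / (j : ℝ)) * (J : ℝ) ^ (1 - a) := by
        refine Finset.sum_le_sum fun j hj => ?_
        simp only [Finset.mem_Icc] at hj
        have hj' : (0 : ℝ) < j := by exact_mod_cast hj.1
        have : (j : ℝ) ^ (-a) = (1 / (j : ℝ)) * (j : ℝ) ^ (1 - a) := by
          rw [sub_eq_add_neg, Real.rpow_add hj', Real.rpow_one]; field_simp
        rw [this]
        gcongr
        exact hj.2
    _ ≤ (1 + Real.log J) * (J : ℝ) ^ (1 - a) := by
        rw [← Finset.sum_mul]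
        gcongr
        exact sum_Icc_inv_le J
    _ ≤ _ := by gcongr

theorem card_divisors_mul_le (m n : ℕ) :
    (m * n).divisors.card ≤ m.divisors.card * n.divisors.card := by
  rw [Nat.divisors_mul]
  exact Finset.card_mul_le

/-- The divisor function is opened as a sum over e | m, costing one harmonic sum. The plain power
sum enters only through `L`, so that the versions with and without a logarithm can both be fed in.
-/
theorem sum_card_divisors_rpow_le {a L : ℝ} {N M : ℕ} (hMN : M ≤ N) (ha : a ≤ 1)
    (hL : ∀ J ≤ N, ∑ j ∈ Finset.Icc 1 J, (j : ℝ) ^ (-a) ≤ L * (J : ℝ) ^ (1 - a)) (hL0 : 0 ≤ L) :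
    ∑ m ∈ Finset.Icc 1 M, (m.divisors.card : ℝ) * (m : ℝ) ^ (-a) ≤
      L * (1 + Real.log N) * (M : ℝ) ^ (1 - a) := by
  rcases Nat.eq_zero_or_pos M with rfl | hM
  · have := Real.log_natCast_nonneg N
    simp; positivity
  have h1 : ∑ m ∈ Finset.Icc 1 M, (m.divisors.card : ℝ) * (m : ℝ) ^ (-a) =
      ∑ e ∈ Finset.Icc 1 M, ∑ j ∈ Finset.Icc 1 (M / e), ((e * j : ℕ) : ℝ) ^ (-a) := by
    rw [← sum_Icc_sum_divisors (fun _ n => (n : ℝ) ^ (-a)) M]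
    refine Finset.sum_congr rfl fun m _ => ?_
    rw [Finset.sum_const, nsmul_eq_mul]
  rw [h1]
  calc _ ≤ ∑ e ∈ Finset.Icc 1 M, (1 / (e : ℝ)) * (L * (M : ℝ) ^ (1 - a)) := by
        refine Finset.sum_le_sum fun e he => ?_
        simp only [Finset.mem_Icc] at he
        have he' : (0 : ℝ) < e := by exact_mod_cast he.1
        calc _ = (e : ℝ) ^ (-a) * ∑ j ∈ Finset.Icc 1 (M / e), (j : ℝ) ^ (-a) := by
              rw [Finset.mul_sum]
              refine Finset.sum_congr rfl fun j _ => ?_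
              push_cast
              rw [Real.mul_rpow (by positivity) (by positivity)]
          _ ≤ (e : ℝ) ^ (-a) * (L * ((M : ℝ) / e) ^ (1 - a)) := by
              gcongr
              refine (hL _ ((Nat.div_le_self _ _).trans hMN)).trans ?_
              gcongr
              exact Nat.cast_div_le
          _ = _ := by
              rw [Real.div_rpow (by positivity) (by positivity), sub_eq_add_neg,
                Real.rpow_add he', Real.rpow_one]
              field_simp
    _ ≤ (1 + Real.log N) * (L * (M : ℝ) ^ (1 - a)) := by
        rw [← Finset.sum_mul]
        gcongr
        exact (sum_Icc_inv_le M).trans (by gcongr)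
    _ = _ := by ring

/-- One factor τ(n) is opened as a sum over n = dj, and the other is split by τ(dj) ≤ τ(d)τ(j); both
resulting sums fall under the previous lemma. -/
theorem sum_card_divisors_sq_rpow_le {a L : ℝ} {N : ℕ} (ha : a ≤ 1)
    (hL : ∀ J ≤ N, ∑ j ∈ Finset.Icc 1 J, (j : ℝ) ^ (-a) ≤ L * (J : ℝ) ^ (1 - a)) (hL0 : 0 ≤ L) :
    ∑ n ∈ Finset.Icc 1 N, (n.divisors.card : ℝ) ^ 2 * (n : ℝ) ^ (-a) ≤
      L * (1 + Real.log N) ^ 3 * (N : ℝ) ^ (1 - a) := by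
  have hlog := Real.log_natCast_nonneg N
  have hdiv : ∑ d ∈ Finset.Icc 1 N, (d.divisors.card : ℝ) * (1 / (d : ℝ)) ≤ (1 + Real.log N) ^ 2 := by
    have := sum_card_divisors_rpow_le (a := 1) (L := 1 + Real.log N) (le_refl N) le_rfl
      (fun J hJ => sum_Icc_rpow_neg_le_of_le_one le_rfl hJ) (by positivity)
    simp only [Real.rpow_neg_one, sub_self, Real.rpow_zero, mul_one] at this
    simpa [sq, one_div] using this
  have h1 : ∑ n ∈ Finset.Icc 1 N, (n.divisors.card : ℝ) ^ 2 * (n : ℝ) ^ (-a) =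
      ∑ d ∈ Finset.Icc 1 N, ∑ j ∈ Finset.Icc 1 (N / d),
        ((d * j).divisors.card : ℝ) * ((d * j : ℕ) : ℝ) ^ (-a) := by
    rw [← sum_Icc_sum_divisors (fun _ n => (n.divisors.card : ℝ) * (n : ℝ) ^ (-a)) N]
    refine Finset.sum_congr rfl fun m _ => ?_
    rw [Finset.sum_const, nsmul_eq_mul]; ring
  rw [h1]
  calc _ ≤ ∑ d ∈ Finset.Icc 1 N, (d.divisors.card : ℝ) * (1 / (d : ℝ)) *
          (L * (1 + Real.log N) * (N : ℝ) ^ (1 - a)) := by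
        refine Finset.sum_le_sum fun d hd => ?_
        simp only [Finset.mem_Icc] at hd
        have hd' : (0 : ℝ) < d := by exact_mod_cast hd.1
        calc _ ≤ ∑ j ∈ Finset.Icc 1 (N / d), ((d.divisors.card : ℝ) * (d : ℝ) ^ (-a)) *
              ((j.divisors.card : ℝ) * (j : ℝ) ^ (-a)) := by
              refine Finset.sum_le_sum fun j _ => ?_
              have : ((d * j).divisors.card : ℝ) ≤ (d.divisors.card : ℝ) * j.divisors.card := by
                exact_mod_cast card_divisors_mul_le d j
              push_cast
              rw [Real.mul_rpow (by positivity) (by positivity)]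
              calc _ ≤ (d.divisors.card : ℝ) * j.divisors.card * ((d : ℝ) ^ (-a) * (j : ℝ) ^ (-a)) := by
                    gcongr
                _ = _ := by ring
          _ ≤ ((d.divisors.card : ℝ) * (d : ℝ) ^ (-a)) *
              (L * (1 + Real.log N) * ((N : ℝ) / d) ^ (1 - a)) := by
              rw [← Finset.mul_sum]
              gcongr
              refine (sum_card_divisors_rpow_le (Nat.div_le_self _ _) ha hL hL0).trans ?_
              gcongr
              exact Nat.cast_div_le
          _ = _ := by
              rw [Real.div_rpow (by positivity) (by positivity), sub_eq_add_neg,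
                Real.rpow_add hd', Real.rpow_one]
              field_simp
    _ ≤ (1 + Real.log N) ^ 2 * (L * (1 + Real.log N) * (N : ℝ) ^ (1 - a)) := by
        rw [← Finset.sum_mul]
        gcongr
    _ = _ := by ring

/-! ### Off-diagonal sums and oscillating integrals -/

theorem sum_inv_abs_sub_le {n N : ℕ} (hn : n ∈ Finset.Icc 1 N) :
    ∑ m ∈ (Finset.Icc 1 N).filter (fun m => n ≠ m), 1 / |(n : ℝ) - m| ≤ 2 * (1 + Real.log N) := by
  simp only [Finset.mem_Icc] at hn
  have hlt : ∑ m ∈ (Finset.Icc 1 N).filter (fun m => m < n), 1 / |(n : ℝ) - m| ≤ 1 + Real.log N := by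
    calc _ = ∑ m ∈ (Finset.Icc 1 N).filter (fun m => m < n), (fun j : ℕ => 1 / (j : ℝ)) (n - m) := by
          refine Finset.sum_congr rfl fun m hm => ?_
          have := (Finset.mem_filter.1 hm).2
          simp only
          rw [Nat.cast_sub this.le, abs_of_pos (sub_pos.2 (by exact_mod_cast this))]
      _ = ∑ j ∈ ((Finset.Icc 1 N).filter (fun m => m < n)).image (fun m => n - m), 1 / (j : ℝ) := by
          rw [Finset.sum_image]
          intro a ha b hb hab
          simp at ha hb hab; omega
      _ ≤ ∑ j ∈ Finset.Icc 1 N, 1 / (j : ℝ) := by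
          refine Finset.sum_le_sum_of_subset_of_nonneg ?_ fun _ _ _ => by positivity
          intro j hj
          simp at hj ⊢; omega
      _ ≤ _ := sum_Icc_inv_le N
  have hgt : ∑ m ∈ (Finset.Icc 1 N).filter (fun m => n < m), 1 / |(n : ℝ) - m| ≤ 1 + Real.log N := by
    calc _ = ∑ m ∈ (Finset.Icc 1 N).filter (fun m => n < m), (fun j : ℕ => 1 / (j : ℝ)) (m - n) := by
          refine Finset.sum_congr rfl fun m hm => ?_
          have := (Finset.mem_filter.1 hm).2
          simp only
          rw [Nat.cast_sub this.le, abs_sub_comm, abs_of_pos (sub_pos.2 (by exact_mod_cast this))]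
      _ = ∑ j ∈ ((Finset.Icc 1 N).filter (fun m => n < m)).image (fun m => m - n), 1 / (j : ℝ) := by
          rw [Finset.sum_image]
          intro a ha b hb hab
          simp at ha hb hab; omega
      _ ≤ ∑ j ∈ Finset.Icc 1 N, 1 / (j : ℝ) := by
          refine Finset.sum_le_sum_of_subset_of_nonneg ?_ fun _ _ _ => by positivity
          intro j hj
          simp at hj ⊢; omega
      _ ≤ _ := sum_Icc_inv_le N
  have hsplit : (Finset.Icc 1 N).filter (fun m => n ≠ m) =
      (Finset.Icc 1 N).filter (fun m => m < n) ∪ (Finset.Icc 1 N).filter (fun m => n < m) := by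
    ext m; simp; omega
  rw [hsplit, Finset.sum_union]
  · linarith
  · rw [Finset.disjoint_filter]; intro m _ h1 h2; omega

/-- From log(m/n) ≥ (m - n)/m and n ≤ √(mn) for n < m. The symmetric form prepares the inequality
between the means in the next lemma. -/
theorem inv_abs_log_sub_log_le {m n : ℕ} (hm : 0 < m) (hn : 0 < n) (h : m ≠ n) :
    1 / |Real.log m - Real.log n| ≤ 1 + Real.sqrt m * Real.sqrt n / |(m : ℝ) - n| := by
  wlog hlt : n < m generalizing m n
  · have := this hn hm h.symm (by omega)
    rwa [abs_sub_comm, abs_sub_comm (m : ℝ), mul_comm (Real.sqrt m)]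
  have hm' : (0 : ℝ) < m := by exact_mod_cast hm
  have hn' : (0 : ℝ) < n := by exact_mod_cast hn
  have hlt' : (n : ℝ) < m := by exact_mod_cast hlt
  have h1 : (m - n : ℝ) / m ≤ Real.log m - Real.log n := by
    have := Real.one_sub_inv_le_log_of_pos (x := (m : ℝ) / n) (by positivity)
    rw [Real.log_div hm'.ne' hn'.ne', inv_div] at this
    rw [sub_div, div_self hm'.ne']; exact this
  have h2 : 0 < (m - n : ℝ) / m := div_pos (by linarith) hm'
  rw [abs_of_pos (by linarith : 0 < Real.log m - Real.log n), abs_of_pos (by linarith : 0 < (m : ℝ) - n)]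
  calc _ ≤ 1 / ((m - n : ℝ) / m) := one_div_le_one_div_of_le h2 h1
    _ = 1 + n / (m - n : ℝ) := by
        have : (m : ℝ) - n ≠ 0 := by linarith
        field_simp; ring
    _ ≤ _ := by
        have h3 : (n : ℝ) ≤ Real.sqrt m * Real.sqrt n := by
          calc (n : ℝ) = Real.sqrt n * Real.sqrt n := (Real.mul_self_sqrt hn'.le).symm
            _ ≤ _ := by gcongr
        have : 0 < (m : ℝ) - n := by linarith
        gcongr

/-- A Hilbert type inequality with a logarithmic loss. The term 1 of the previous bound is handled
by Cauchy–Schwarz against ∑ 1/n. The term with 1/|n - m| is handled by 2xy ≤ x² + y², after which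
each row is at most two harmonic sums. -/
theorem sum_offDiag_div_log_le (b : ℕ → ℝ) (hb : ∀ n, 0 ≤ b n) (N : ℕ) :
    ∑ n ∈ Finset.Icc 1 N, ∑ m ∈ Finset.Icc 1 N,
      (if n ≠ m then b n * b m / |Real.log n - Real.log m| else 0) ≤
      3 * (1 + Real.log N) * ∑ n ∈ Finset.Icc 1 N, b n ^ 2 * n := by
  set Q := ∑ n ∈ Finset.Icc 1 N, b n ^ 2 * (n : ℝ) with hQ
  have hQ0 : 0 ≤ Q := Finset.sum_nonneg fun n _ => by positivity
  have hfirst : (∑ n ∈ Finset.Icc 1 N, b n) ^ 2 ≤ (1 + Real.log N) * Q := by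
    have hcs := Finset.sum_mul_sq_le_sq_mul_sq (Finset.Icc 1 N) (fun n => b n * Real.sqrt n)
      (fun n => 1 / Real.sqrt n)
    have e1 : ∑ n ∈ Finset.Icc 1 N, b n * Real.sqrt n * (1 / Real.sqrt n) = ∑ n ∈ Finset.Icc 1 N, b n := by
      refine Finset.sum_congr rfl fun n hn => ?_
      have : (0 : ℝ) < n := by exact_mod_cast (Finset.mem_Icc.1 hn).1
      have : Real.sqrt n ≠ 0 := (Real.sqrt_pos.2 this).ne'
      field_simp
    have e2 : ∑ n ∈ Finset.Icc 1 N, (b n * Real.sqrt n) ^ 2 = Q := by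
      refine Finset.sum_congr rfl fun n _ => ?_
      rw [mul_pow, Real.sq_sqrt (Nat.cast_nonneg n)]
    have e3 : ∑ n ∈ Finset.Icc 1 N, (1 / Real.sqrt n) ^ 2 = ∑ n ∈ Finset.Icc 1 N, 1 / (n : ℝ) := by
      refine Finset.sum_congr rfl fun n _ => ?_
      rw [div_pow, Real.sq_sqrt (Nat.cast_nonneg n), one_pow]
    rw [e1, e2, e3] at hcs
    calc _ ≤ _ := hcs
      _ ≤ Q * (1 + Real.log N) := by gcongr; exact sum_Icc_inv_le N
      _ = _ := mul_comm _ _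
  set a : ℕ → ℝ := fun n => b n * Real.sqrt n with ha
  have ha2 : ∀ n, a n ^ 2 = b n ^ 2 * n := fun n => by
    rw [ha]; simp only; rw [mul_pow, Real.sq_sqrt (Nat.cast_nonneg n)]
  have hsecond : ∑ n ∈ Finset.Icc 1 N, ∑ m ∈ Finset.Icc 1 N,
      (if n ≠ m then a n ^ 2 / |(n : ℝ) - m| else 0) ≤ 2 * (1 + Real.log N) * Q := by
    rw [hQ, Finset.mul_sum]
    refine Finset.sum_le_sum fun n hn => ?_
    rw [← Finset.sum_filter]
    calc _ = a n ^ 2 * ∑ m ∈ (Finset.Icc 1 N).filter (fun m => n ≠ m), 1 / |(n : ℝ) - m| := by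
          rw [Finset.mul_sum]
          refine Finset.sum_congr rfl fun m _ => by rw [mul_one_div]
      _ ≤ a n ^ 2 * (2 * (1 + Real.log N)) := by
          gcongr
          exact sum_inv_abs_sub_le hn
      _ = _ := by rw [ha2]; ring
  calc _ ≤ ∑ n ∈ Finset.Icc 1 N, ∑ m ∈ Finset.Icc 1 N, (b n * b m +
        ((if n ≠ m then a n ^ 2 / |(n : ℝ) - m| else 0) +
          (if m ≠ n then a m ^ 2 / |(m : ℝ) - n| else 0)) / 2) := by
        refine Finset.sum_le_sum fun n hn => Finset.sum_le_sum fun m hm => ?_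
        have hbb : 0 ≤ b n * b m := mul_nonneg (hb n) (hb m)
        by_cases h : n = m
        · simp [h]; exact mul_self_nonneg _
        · rw [if_pos h, if_pos h, if_pos (Ne.symm h), abs_sub_comm (m : ℝ)]
          have h1 := inv_abs_log_sub_log_le (Finset.mem_Icc.1 hn).1 (Finset.mem_Icc.1 hm).1 h
          have hpos : 0 < |(n : ℝ) - m| := abs_pos.2 (sub_ne_zero.2 (by exact_mod_cast h))
          calc b n * b m / |Real.log n - Real.log m| =
                b n * b m * (1 / |Real.log n - Real.log m|) := by rw [mul_one_div]
            _ ≤ b n * b m * (1 + Real.sqrt n * Real.sqrt m / |(n : ℝ) - m|) := by gcongr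
            _ = b n * b m + a n * a m / |(n : ℝ) - m| := by simp only [ha]; ring
            _ ≤ b n * b m + (a n ^ 2 + a m ^ 2) / 2 / |(n : ℝ) - m| := by
                gcongr
                nlinarith [sq_nonneg (a n - a m)]
            _ = _ := by ring
    _ = (∑ n ∈ Finset.Icc 1 N, b n) ^ 2 + ∑ n ∈ Finset.Icc 1 N, ∑ m ∈ Finset.Icc 1 N,
          (if n ≠ m then a n ^ 2 / |(n : ℝ) - m| else 0) := by
        simp only [Finset.sum_add_distrib, ← Finset.sum_div]
        rw [sq, Finset.sum_mul_sum]
        congr 1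
        rw [Finset.sum_comm (f := fun n m => if m ≠ n then a m ^ 2 / |(m : ℝ) - n| else 0)]
        ring
    _ ≤ _ := by linarith

theorem sum_pairs_le {X K : ℕ} (P : Finset (ℕ × ℕ)) (hP : P ⊆ Finset.Icc 1 X ×ˢ Finset.Icc 1 K)
    (g : ℕ → ℝ) (hg : ∀ n, 0 ≤ g n) :
    ∑ p ∈ P, g (p.1 * p.2) ≤ ∑ n ∈ Finset.Icc 1 (X * K), (n.divisors.card : ℝ) * g n := by
  have hmaps : ∀ p ∈ P, p.1 * p.2 ∈ Finset.Icc 1 (X * K) := by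
    intro p hp
    have h := hP hp
    simp only [Finset.mem_product, Finset.mem_Icc] at h ⊢
    exact ⟨Nat.mul_pos h.1.1 h.2.1, Nat.mul_le_mul h.1.2 h.2.2⟩
  rw [← Finset.sum_fiberwise_of_maps_to (g := fun p : ℕ × ℕ => p.1 * p.2) hmaps]
  refine Finset.sum_le_sum fun n hn => ?_
  calc _ = ∑ p ∈ P.filter (fun p => p.1 * p.2 = n), g n :=
        Finset.sum_congr rfl fun p hp => by rw [(Finset.mem_filter.1 hp).2]
    _ = ((P.filter (fun p => p.1 * p.2 = n)).card : ℝ) * g n := by rw [Finset.sum_const, nsmul_eq_mul]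
    _ ≤ _ := by
        refine mul_le_mul_of_nonneg_right ?_ (hg n)
        have hn1 : 0 < n := (Finset.mem_Icc.1 hn).1
        refine Nat.cast_le.2 (Finset.card_le_card_of_injOn (fun p => p.1) (fun p hp => ?_) ?_)
        · have h := (Finset.mem_filter.1 hp).2
          exact Nat.mem_divisors.2 ⟨Dvd.intro _ h, hn1.ne'⟩
        · intro p hp q hq hpq
          have h1 := (Finset.mem_filter.1 hp).2
          have h2 := (Finset.mem_filter.1 hq).2
          simp only at hpq
          have h3 : 0 < p.1 := Nat.pos_of_mul_pos_right (by rw [h1]; exact hn1)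
          refine Prod.ext hpq (Nat.eq_of_mul_eq_mul_left h3 ?_)
          rw [h1, hpq, h2]

/-- The length of the main sum grows with t, but the condition k ≤ `mainLength t` is just t ≥ 2πk².
It only moves the lower limit of integration, so the usual bound for an oscillating integral
survives. -/
theorem abs_integral_indicator_cos_le {A B b Δ : ℝ} (hAB : A ≤ B) (hΔ : Δ ≠ 0) :
    |∫ t in A..B, (Set.Ici b).indicator (fun t => Real.cos (t * Δ)) t| ≤ 2 / |Δ| := by
  have hcos : ∀ c d : ℝ, |∫ t in c..d, Real.cos (t * Δ)| ≤ 2 / |Δ| := by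
    intro c d
    rw [intervalIntegral.integral_comp_mul_right (fun x => Real.cos x) hΔ, integral_cos, smul_eq_mul,
      abs_mul, abs_inv, inv_mul_eq_div]
    gcongr
    have h1 := Real.abs_sin_le_one (d * Δ)
    have h2 := Real.abs_sin_le_one (c * Δ)
    exact (abs_sub _ _).trans (by linarith)
  have h0 : 0 ≤ 2 / |Δ| := by positivity
  rcases le_total b A with hb | hb
  · rw [intervalIntegral.integral_congr (g := fun t => Real.cos (t * Δ))]
    · exact hcos A B
    · intro t ht
      rw [Set.uIcc_of_le hAB] at ht
      exact Set.indicator_of_mem (Set.mem_Ici.2 (hb.trans ht.1)) _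
  rcases le_total B b with hB | hB
  · rw [intervalIntegral.integral_of_le hAB, setIntegral_indicator measurableSet_Ici]
    have : volume.restrict (Set.Ioc A B ∩ Set.Ici b) = 0 := by
      rw [Measure.restrict_eq_zero]
      refine measure_mono_null (t := {b}) (fun x hx => ?_) (by simp)
      exact le_antisymm (hx.1.2.trans hB) hx.2
    rw [this, integral_zero_measure, abs_zero]; exact h0
  · rw [intervalIntegral.integral_of_le hAB, setIntegral_indicator measurableSet_Ici]
    have : (Set.Ioc A B ∩ Set.Ici b : Set ℝ) =ᵐ[volume] Set.Ioc b B := by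
      refine (Filter.EventuallyEq.trans ?_ Ioc_ae_eq_Icc.symm)
      by_cases hAb : A = b
      · subst hAb
        have : Set.Ioc A B ∩ Set.Ici A = Set.Ioc A B :=
          Set.inter_eq_left.2 fun x hx => hx.1.le
        rw [this]; exact Ioc_ae_eq_Icc
      · have : Set.Ioc A B ∩ Set.Ici b = Set.Icc b B := by
          ext x
          simp only [Set.mem_inter_iff, Set.mem_Ioc, Set.mem_Ici, Set.mem_Icc]
          constructor
          · rintro ⟨⟨_, h2⟩, h3⟩; exact ⟨h3, h2⟩
          · rintro ⟨h1, h2⟩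
            exact ⟨⟨lt_of_lt_of_le (lt_of_le_of_ne hb hAb) h1, h2⟩, h1⟩
        rw [this]; exact Filter.EventuallyEq.rfl
    rw [setIntegral_congr_set this, ← intervalIntegral.integral_of_le hB]
    exact hcos b B

/-! ### The mollified main sum -/

/-- The mollifier `∑_{d ≤ X} μ(d) d^{-s}`. -/
noncomputable def mollifier (X : ℕ) (s : ℂ) : ℂ := ∑ d ∈ Finset.Icc 1 X, (μ d : ℂ) * (d : ℂ) ^ (-s)

/-- The truncated zeta series `∑_{k ≤ K} k^{-s}`. -/
noncomputable def zetaPartial (K : ℕ) (s : ℂ) : ℂ := ∑ k ∈ Finset.Icc 1 K, (k : ℂ) ^ (-s)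

/-- The number of terms of the main sum of `R(σ + it)`. -/
noncomputable def mainLength (t : ℝ) : ℕ := ⌊Real.sqrt (t / (2 * Real.pi))⌋₊

theorem le_mainLength_iff {k : ℕ} {t : ℝ} (ht : 0 ≤ t) :
    k ≤ mainLength t ↔ 2 * Real.pi * (k : ℝ) ^ 2 ≤ t := by
  unfold mainLength
  rw [Nat.le_floor_iff (Real.sqrt_nonneg _), Real.le_sqrt (Nat.cast_nonneg k),
    le_div_iff₀ (by positivity), mul_comm]
  positivity

theorem mainLength_mono {t t' : ℝ} (h : t ≤ t') : mainLength t ≤ mainLength t' := by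
  unfold mainLength; gcongr

theorem natCast_cpow_neg {n : ℕ} (hn : 0 < n) (σ t : ℝ) : (n : ℂ) ^ (-(σ + t * I : ℂ)) =
    (((n : ℝ) ^ (-σ) : ℝ) : ℂ) * exp (((-(t * Real.log n) : ℝ) : ℂ) * I) := by
  have hn' : (n : ℂ) ≠ 0 := by exact_mod_cast hn.ne'
  have hn2 : (0 : ℝ) < n := by exact_mod_cast hn
  rw [cpow_def_of_ne_zero hn', Real.rpow_def_of_pos hn2, ofReal_exp, ← exp_add, ← natCast_log]
  congr 1
  push_cast
  ring

theorem norm_sum_mul_exp_sq {ι : Type*} (P : Finset ι) (c θ : ι → ℝ) :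
    ‖∑ p ∈ P, (c p : ℂ) * exp ((θ p : ℂ) * I)‖ ^ 2 =
      ∑ p ∈ P, ∑ q ∈ P, c p * c q * Real.cos (θ p - θ q) := by
  have hre : (∑ p ∈ P, (c p : ℂ) * exp ((θ p : ℂ) * I)).re = ∑ p ∈ P, c p * Real.cos (θ p) := by
    rw [re_sum]
    refine Finset.sum_congr rfl fun p _ => ?_
    rw [re_ofReal_mul, exp_ofReal_mul_I_re]
  have him : (∑ p ∈ P, (c p : ℂ) * exp ((θ p : ℂ) * I)).im = ∑ p ∈ P, c p * Real.sin (θ p) := by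
    rw [im_sum]
    refine Finset.sum_congr rfl fun p _ => ?_
    rw [im_ofReal_mul, exp_ofReal_mul_I_im]
  rw [← normSq_eq_norm_sq, normSq_apply, hre, him, Finset.sum_mul_sum, Finset.sum_mul_sum,
    ← Finset.sum_add_distrib]
  refine Finset.sum_congr rfl fun p _ => ?_
  rw [← Finset.sum_add_distrib]
  refine Finset.sum_congr rfl fun q _ => ?_
  rw [Real.cos_sub]; ring

/-- The index pairs `(d, k) ≠ (1, 1)` of the product of the mollifier and the truncated zeta series. -/
def mollifiedPairs (X K : ℕ) : Finset (ℕ × ℕ) := (Finset.Icc 1 X ×ˢ Finset.Icc 1 K).erase (1, 1)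

theorem mollifiedPairs_subset (X K : ℕ) : mollifiedPairs X K ⊆ Finset.Icc 1 X ×ˢ Finset.Icc 1 K :=
  Finset.erase_subset _ _

theorem mul_pos_of_mem_mollifiedPairs {X K : ℕ} {p : ℕ × ℕ} (hp : p ∈ mollifiedPairs X K) :
    0 < p.1 * p.2 := by
  have := mollifiedPairs_subset X K hp
  simp only [Finset.mem_product, Finset.mem_Icc] at this
  exact Nat.mul_pos this.1.1 this.2.1

/-- The weight `μ(d) (dk)^{-σ}` of a pair. -/
noncomputable def pairWeight (σ : ℝ) (p : ℕ × ℕ) : ℝ := (μ p.1 : ℝ) * ((p.1 * p.2 : ℕ) : ℝ) ^ (-σ)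

theorem abs_pairWeight_le (σ : ℝ) (p : ℕ × ℕ) : |pairWeight σ p| ≤ ((p.1 * p.2 : ℕ) : ℝ) ^ (-σ) := by
  unfold pairWeight
  rw [abs_mul, abs_of_nonneg (Real.rpow_nonneg (Nat.cast_nonneg _) _)]
  refine mul_le_of_le_one_left (Real.rpow_nonneg (Nat.cast_nonneg _) _) ?_
  exact_mod_cast ArithmeticFunction.abs_moebius_le_one (n := p.1)

/-- The pair (1, 1) is the constant term 1. The index set uses the fixed length `K`, so it does not
vary with t; the true length `L` enters only through vanishing coefficients. -/
theorem zetaPartial_mul_mollifier_sub_one {X K L : ℕ} (hX : 1 ≤ X) (hL : 1 ≤ L) (hLK : L ≤ K)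
    (σ t : ℝ) : zetaPartial L (σ + t * I) * mollifier X (σ + t * I) - 1 =
      ∑ p ∈ mollifiedPairs X K, ((if p.2 ≤ L then pairWeight σ p else 0 : ℝ) : ℂ) *
        exp (((-(t * Real.log ((p.1 * p.2 : ℕ) : ℝ)) : ℝ) : ℂ) * I) := by
  set F : ℕ × ℕ → ℂ := fun p => ((if p.2 ≤ L then pairWeight σ p else 0 : ℝ) : ℂ) *
        exp (((-(t * Real.log ((p.1 * p.2 : ℕ) : ℝ)) : ℝ) : ℂ) * I) with hF
  have hmem : ((1, 1) : ℕ × ℕ) ∈ Finset.Icc 1 X ×ˢ Finset.Icc 1 K := by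
    simp; omega
  have h1 : F (1, 1) = 1 := by simp [hF, pairWeight, hL]
  have h2 := Finset.add_sum_erase _ F hmem
  unfold mollifiedPairs
  rw [← h1, sub_eq_iff_eq_add', h2]
  unfold zetaPartial mollifier
  rw [mul_comm, Finset.sum_mul_sum, Finset.sum_product]
  refine Finset.sum_congr rfl fun d hd => ?_
  have hsub : Finset.Icc 1 L ⊆ Finset.Icc 1 K := Finset.Icc_subset_Icc_right hLK
  rw [← Finset.sum_subset hsub]
  · refine Finset.sum_congr rfl fun k hk => ?_
    have hd1 := (Finset.mem_Icc.1 hd).1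
    have hk1 := (Finset.mem_Icc.1 hk)
    simp only [hF]
    rw [if_pos hk1.2, pairWeight, ofReal_mul, mul_assoc ((μ (d, k).1 : ℝ) : ℂ),
      ← natCast_cpow_neg (Nat.mul_pos hd1 hk1.1)]
    simp only [Nat.cast_mul]
    rw [natCast_mul_natCast_cpow]
    push_cast
    ring
  · intro k _ hk
    have : ¬ k ≤ L := fun h => hk (Finset.mem_Icc.2 ⟨(Finset.mem_Icc.1 (by assumption)).1, h⟩)
    simp [hF, this]

theorem sum_pairWeight_fiber {X K L : ℕ} (hLK : L ≤ K) (σ : ℝ) {n : ℕ} (hn : 1 < n) :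
    ∑ p ∈ (mollifiedPairs X K).filter (fun p => p.1 * p.2 = n),
      (if p.2 ≤ L then pairWeight σ p else 0) = (n : ℝ) ^ (-σ) * mollifiedCoeff X L n := by
  set P := mollifiedPairs X K with hP
  unfold mollifiedCoeff
  rw [Finset.mul_sum]
  have hsub : (Finset.Icc 1 X ×ˢ Finset.Icc 1 L).filter (fun p => p.1 * p.2 = n) ⊆
      P.filter (fun p => p.1 * p.2 = n) := by
    intro p hp
    simp only [Finset.mem_filter, Finset.mem_product, Finset.mem_Icc] at hp
    simp only [hP, mollifiedPairs, Finset.mem_filter, Finset.mem_erase, Finset.mem_product,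
      Finset.mem_Icc]
    refine ⟨⟨?_, hp.1.1, hp.1.2.1, hp.1.2.2.trans hLK⟩, hp.2⟩
    rintro rfl
    simp at hp; omega
  rw [← Finset.sum_subset hsub]
  · refine Finset.sum_congr rfl fun p hp => ?_
    simp only [Finset.mem_filter, Finset.mem_product, Finset.mem_Icc] at hp
    rw [if_pos hp.1.2.2, pairWeight, hp.2, mul_comm]
  · intro p hp hnot
    rw [if_neg]
    intro hle
    apply hnot
    have h3 := Finset.mem_filter.1 hp
    have h4 := mollifiedPairs_subset X K h3.1
    simp only [Finset.mem_product, Finset.mem_Icc] at h4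
    simp only [Finset.mem_filter, Finset.mem_product, Finset.mem_Icc]
    exact ⟨⟨h4.1, h4.2.1, hle⟩, h3.2⟩

theorem filter_mollifiedPairs_eq_one (X K : ℕ) :
    (mollifiedPairs X K).filter (fun p => p.1 * p.2 = 1) = ∅ := by
  refine Finset.filter_eq_empty_iff.2 fun p hp h => ?_
  exact absurd (Prod.ext (Nat.eq_one_of_mul_eq_one_right h)
    (Nat.eq_one_of_mul_eq_one_left h) : p = (1, 1)) (Finset.mem_erase.1 hp).1

/-- Grouping by n = dk, only n > X survive, and there n^{-2σ} ≤ X^{1-2σ}/n because σ ≥ 1/2. What is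
left is the diagonal form at σ = 1/2. -/
theorem sum_diag_pairWeight_le {X K L : ℕ} (hX : 1 ≤ X) (hXL : X ≤ L) (hLK : L ≤ K) {σ : ℝ}
    (hσ : 1 / 2 ≤ σ) :
    ∑ p ∈ mollifiedPairs X K, ∑ q ∈ mollifiedPairs X K, (if p.1 * p.2 = q.1 * q.2 then
      (if p.2 ≤ L then pairWeight σ p else 0) * (if q.2 ≤ L then pairWeight σ q else 0) else 0) ≤
      (X : ℝ) ^ (1 - 2 * σ) * mollifiedDiagonal X L := by
  set P := mollifiedPairs X K with hP
  set c : ℕ × ℕ → ℝ := fun p => if p.2 ≤ L then pairWeight σ p else 0 with hc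
  have hmaps : ∀ p ∈ P, p.1 * p.2 ∈ Finset.Icc 1 (X * K) := by
    intro p hp
    have h := mollifiedPairs_subset X K hp
    simp only [Finset.mem_product, Finset.mem_Icc] at h ⊢
    exact ⟨Nat.mul_pos h.1.1 h.2.1, Nat.mul_le_mul h.1.2 h.2.2⟩
  have h1 : ∑ p ∈ P, ∑ q ∈ P, (if p.1 * p.2 = q.1 * q.2 then c p * c q else 0) =
      ∑ n ∈ Finset.Icc 1 (X * K), (∑ p ∈ P.filter (fun p => p.1 * p.2 = n), c p) ^ 2 := by
    rw [← Finset.sum_fiberwise_of_maps_to (g := fun p : ℕ × ℕ => p.1 * p.2) hmaps]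
    refine Finset.sum_congr rfl fun n _ => ?_
    rw [sq, Finset.sum_mul_sum]
    refine Finset.sum_congr rfl fun p hp => ?_
    rw [Finset.sum_filter]
    refine Finset.sum_congr rfl fun q _ => ?_
    simp only [(Finset.mem_filter.1 hp).2, eq_comm (a := n)]
  have h2 : ∀ n, 1 < n → ∑ p ∈ P.filter (fun p => p.1 * p.2 = n), c p =
      (n : ℝ) ^ (-σ) * mollifiedCoeff X L n := fun n hn => sum_pairWeight_fiber hLK σ hn
  have h3 : ∑ p ∈ P.filter (fun p => p.1 * p.2 = 1), c p = 0 := by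
    rw [hP, filter_mollifiedPairs_eq_one, Finset.sum_empty]
  have hX' : (0 : ℝ) < X := by exact_mod_cast hX
  have hcoeff0 : ∀ n ∉ Finset.Icc 1 (X * L), 1 ≤ n → mollifiedCoeff X L n = 0 := by
    intro n hn hn1
    unfold mollifiedCoeff
    refine Finset.sum_eq_zero fun p hp => ?_
    exfalso
    simp only [Finset.mem_filter, Finset.mem_product, Finset.mem_Icc] at hp
    apply hn
    rw [Finset.mem_Icc]
    exact ⟨hn1, hp.2 ▸ Nat.mul_le_mul hp.1.1.2 hp.1.2.2⟩
  rw [h1, mollifiedDiagonal_eq_sum_sq, Finset.mul_sum]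
  have hsub : Finset.Icc 1 (X * L) ⊆ Finset.Icc 1 (X * K) :=
    Finset.Icc_subset_Icc_right (Nat.mul_le_mul_left X hLK)
  rw [Finset.sum_subset hsub (f := fun n => (X : ℝ) ^ (1 - 2 * σ) * (mollifiedCoeff X L n ^ 2 / n))
    (fun n hn hn' => by rw [hcoeff0 n hn' (Finset.mem_Icc.1 hn).1]; simp)]
  refine Finset.sum_le_sum fun n hn => ?_
  have hn1 := (Finset.mem_Icc.1 hn).1
  rcases eq_or_lt_of_le hn1 with h | h
  · rw [← h, h3, zero_pow two_ne_zero]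
    positivity
  · rw [h2 n h]
    by_cases hnX : n ≤ X
    · rw [mollifiedCoeff_eq_zero hXL h hnX]; simp
    · push Not at hnX
      have hn' : (0 : ℝ) < n := by exact_mod_cast hn1
      rw [mul_pow]
      have e1 : ((n : ℝ) ^ (-σ)) ^ 2 ≤ (X : ℝ) ^ (1 - 2 * σ) / n := by
        rw [← Real.rpow_natCast, ← Real.rpow_mul hn'.le, le_div_iff₀ hn']
        calc _ = (n : ℝ) ^ (1 - 2 * σ) := by
              nth_rewrite 2 [← Real.rpow_one (n : ℝ)]
              rw [← Real.rpow_add hn']; congr 1; push_cast; ring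
          _ ≤ _ := Real.rpow_le_rpow_of_nonpos hX' (by exact_mod_cast hnX.le) (by linarith)
      calc _ ≤ (X : ℝ) ^ (1 - 2 * σ) / n * mollifiedCoeff X L n ^ 2 := by gcongr
        _ = _ := by ring

/-- The off-diagonal part of `|1 - D M|²`. -/
noncomputable def offDiagonal (X K : ℕ) (σ t : ℝ) : ℝ :=
  ∑ p ∈ mollifiedPairs X K, ∑ q ∈ mollifiedPairs X K, if p.1 * p.2 ≠ q.1 * q.2 then
    pairWeight σ p * pairWeight σ q *
      (Set.Ici (max (2 * Real.pi * (p.2 : ℝ) ^ 2) (2 * Real.pi * (q.2 : ℝ) ^ 2))).indicator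
        (fun t => Real.cos (t * (Real.log ((p.1 * p.2 : ℕ) : ℝ) - Real.log ((q.1 * q.2 : ℕ) : ℝ)))) t
  else 0

/-- The diagonal is bounded for each t, although its length `mainLength t` moves; the off-diagonal
part is kept exactly, to be integrated. -/
theorem norm_one_sub_sq_le {A B t σ : ℝ} (hA : 2 * Real.pi ≤ A) (hAt : A ≤ t) (htB : t ≤ B)
    (hσ : 1 / 2 ≤ σ) :
    ‖1 - zetaPartial (mainLength t) (σ + t * I) * mollifier (mainLength A) (σ + t * I)‖ ^ 2 ≤
      (mainLength A : ℝ) ^ (1 - 2 * σ) * (2 * (1 + Real.log (mainLength B)) ^ 2) +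
        offDiagonal (mainLength A) (mainLength B) σ t := by
  have hpi := Real.pi_pos
  have ht0 : 0 ≤ t := by linarith
  have hX : 1 ≤ mainLength A := by rw [le_mainLength_iff (by linarith)]; simpa using hA
  have hXL := mainLength_mono hAt
  have hLK := mainLength_mono htB
  set X := mainLength A
  set K := mainLength B
  set L := mainLength t with hL
  rw [norm_sub_rev, zetaPartial_mul_mollifier_sub_one hX (hX.trans hXL) hLK, norm_sum_mul_exp_sq]
  set c : ℕ × ℕ → ℝ := fun p => if p.2 ≤ L then pairWeight σ p else 0 with hc
  have hdiag := sum_diag_pairWeight_le hX hXL hLK hσ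
  have hsplit : ∑ p ∈ mollifiedPairs X K, ∑ q ∈ mollifiedPairs X K, c p * c q *
      Real.cos (-(t * Real.log ((p.1 * p.2 : ℕ) : ℝ)) - -(t * Real.log ((q.1 * q.2 : ℕ) : ℝ))) =
      ∑ p ∈ mollifiedPairs X K, ∑ q ∈ mollifiedPairs X K,
        (if p.1 * p.2 = q.1 * q.2 then c p * c q else 0) + offDiagonal X K σ t := by
    unfold offDiagonal
    rw [← Finset.sum_add_distrib]
    refine Finset.sum_congr rfl fun p _ => ?_
    rw [← Finset.sum_add_distrib]
    refine Finset.sum_congr rfl fun q _ => ?_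
    by_cases h : p.1 * p.2 = q.1 * q.2
    · simp [h]
    · rw [if_neg h, if_pos h, zero_add]
      simp only [hc, hL, le_mainLength_iff ht0]
      rw [show -(t * Real.log ((p.1 * p.2 : ℕ) : ℝ)) - -(t * Real.log ((q.1 * q.2 : ℕ) : ℝ)) =
        -(t * (Real.log ((p.1 * p.2 : ℕ) : ℝ) - Real.log ((q.1 * q.2 : ℕ) : ℝ))) by ring, Real.cos_neg]
      by_cases h1 : 2 * Real.pi * (p.2 : ℝ) ^ 2 ≤ t
      · by_cases h2 : 2 * Real.pi * (q.2 : ℝ) ^ 2 ≤ t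
        · rw [if_pos h1, if_pos h2, Set.indicator_of_mem (Set.mem_Ici.2 (max_le h1 h2))]
        · rw [if_neg h2, Set.indicator_of_notMem
            (fun h3 => h2 ((le_max_right _ _).trans (Set.mem_Ici.1 h3)))]
          simp
      · rw [if_neg h1, Set.indicator_of_notMem
          (fun h3 => h1 ((le_max_left _ _).trans (Set.mem_Ici.1 h3)))]
        simp
  rw [hsplit]
  gcongr
  refine hdiag.trans ?_
  gcongr
  refine (mollifiedDiagonal_le X L).trans ?_
  have hX' : (0 : ℝ) < X := by exact_mod_cast hX
  have hL' : (0 : ℝ) < L := by exact_mod_cast hX.trans hXL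
  have e1 : Real.log X ≤ Real.log K := Real.log_le_log hX' (by exact_mod_cast hXL.trans hLK)
  have e2 : Real.log L ≤ Real.log K := Real.log_le_log hL' (by exact_mod_cast hLK)
  have e3 := Real.log_natCast_nonneg X
  have e4 := Real.log_natCast_nonneg L
  rw [sq, ← mul_assoc]
  gcongr

theorem intervalIntegrable_offDiagonal_term (b Δ A B : ℝ) : IntervalIntegrable
    ((Set.Ici b).indicator fun t => Real.cos (t * Δ)) volume A B := by
  rw [intervalIntegrable_iff]
  refine IntegrableOn.indicator ?_ measurableSet_Ici
  rw [← intervalIntegrable_iff]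
  exact Continuous.intervalIntegrable (by fun_prop) _ _

theorem intervalIntegrable_offDiagonal (X K : ℕ) (σ A B : ℝ) :
    IntervalIntegrable (offDiagonal X K σ) volume A B := by
  have : offDiagonal X K σ = ∑ p ∈ mollifiedPairs X K, ∑ q ∈ mollifiedPairs X K,
      fun t => if p.1 * p.2 ≠ q.1 * q.2 then pairWeight σ p * pairWeight σ q *
      (Set.Ici (max (2 * Real.pi * (p.2 : ℝ) ^ 2) (2 * Real.pi * (q.2 : ℝ) ^ 2))).indicator
        (fun t => Real.cos (t * (Real.log ((p.1 * p.2 : ℕ) : ℝ) - Real.log ((q.1 * q.2 : ℕ) : ℝ)))) t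
      else 0 := by
    funext t
    simp only [offDiagonal, Finset.sum_apply]
  rw [this]
  refine IntervalIntegrable.sum _ fun p _ => IntervalIntegrable.sum _ fun q _ => ?_
  split_ifs
  · exact (intervalIntegrable_offDiagonal_term _ _ _ _).const_mul _
  · exact intervalIntegrable_const

/-- Each pair of terms integrates to at most 2/|log n - log m| times its weights, and each product n
occurs for at most τ(n) pairs. The Hilbert type inequality then applies with b(n) = τ(n) n^{-σ}. -/
theorem integral_offDiagonal_le (X K : ℕ) (σ : ℝ) {A B : ℝ} (hAB : A ≤ B) :
    ∫ t in A..B, offDiagonal X K σ t ≤ 6 * (1 + Real.log ((X * K : ℕ) : ℝ)) *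
      ∑ n ∈ Finset.Icc 1 (X * K), (n.divisors.card : ℝ) ^ 2 * (n : ℝ) ^ (-(2 * σ - 1)) := by
  set P := mollifiedPairs X K with hP
  set h : ℕ → ℕ → ℝ := fun n m => if n ≠ m then
    (n : ℝ) ^ (-σ) * (m : ℝ) ^ (-σ) * (2 / |Real.log n - Real.log m|) else 0 with hh
  have hh0 : ∀ n m, 0 ≤ h n m := by
    intro n m; simp only [hh]; split_ifs <;> positivity
  have hint : ∀ p q : ℕ × ℕ, IntervalIntegrable (fun t => if p.1 * p.2 ≠ q.1 * q.2 then
      pairWeight σ p * pairWeight σ q *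
      (Set.Ici (max (2 * Real.pi * (p.2 : ℝ) ^ 2) (2 * Real.pi * (q.2 : ℝ) ^ 2))).indicator
        (fun t => Real.cos (t * (Real.log ((p.1 * p.2 : ℕ) : ℝ) - Real.log ((q.1 * q.2 : ℕ) : ℝ)))) t
      else 0) volume A B := by
    intro p q
    split_ifs
    · exact (intervalIntegrable_offDiagonal_term _ _ _ _).const_mul _
    · exact intervalIntegrable_const
  have h1 : ∫ t in A..B, offDiagonal X K σ t ≤ ∑ p ∈ P, ∑ q ∈ P, h (p.1 * p.2) (q.1 * q.2) := by
    unfold offDiagonal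
    rw [intervalIntegral.integral_finsetSum (fun p _ => by
      have := IntervalIntegrable.sum P fun q _ => hint p q
      rwa [Finset.sum_fn] at this)]
    refine Finset.sum_le_sum fun p hp => ?_
    rw [intervalIntegral.integral_finsetSum (fun q _ => hint p q)]
    refine Finset.sum_le_sum fun q hq => ?_
    simp only [hh]
    by_cases hne : p.1 * p.2 = q.1 * q.2
    · simp [hne]
    · simp only [ne_eq, hne, not_false_eq_true, if_true]
      rw [intervalIntegral.integral_const_mul]
      refine (le_abs_self _).trans ?_
      rw [abs_mul, abs_mul]
      have hΔ : Real.log ((p.1 * p.2 : ℕ) : ℝ) - Real.log ((q.1 * q.2 : ℕ) : ℝ) ≠ 0 := by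
        rw [sub_ne_zero]
        intro heq
        apply hne
        have a1 : (0 : ℝ) < ((p.1 * p.2 : ℕ) : ℝ) := by
          exact_mod_cast mul_pos_of_mem_mollifiedPairs hp
        have a2 : (0 : ℝ) < ((q.1 * q.2 : ℕ) : ℝ) := by
          exact_mod_cast mul_pos_of_mem_mollifiedPairs hq
        exact_mod_cast Real.log_injOn_pos (Set.mem_Ioi.2 a1) (Set.mem_Ioi.2 a2) heq
      have e1 := abs_pairWeight_le σ p
      have e2 := abs_pairWeight_le σ q
      have e3 := abs_integral_indicator_cos_le (b := max (2 * Real.pi * (p.2 : ℝ) ^ 2)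
        (2 * Real.pi * (q.2 : ℝ) ^ 2)) hAB hΔ
      gcongr
  refine h1.trans ?_
  set τ : ℕ → ℝ := fun n => (n.divisors.card : ℝ) with hτ
  calc _ ≤ ∑ p ∈ P, ∑ m ∈ Finset.Icc 1 (X * K), τ m * h (p.1 * p.2) m :=
        Finset.sum_le_sum fun p _ => sum_pairs_le P (mollifiedPairs_subset X K) _ (hh0 _)
    _ ≤ ∑ n ∈ Finset.Icc 1 (X * K), τ n * ∑ m ∈ Finset.Icc 1 (X * K), τ m * h n m :=
        sum_pairs_le P (mollifiedPairs_subset X K)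
          (fun n => ∑ m ∈ Finset.Icc 1 (X * K), τ m * h n m)
          (fun n => Finset.sum_nonneg fun m _ => mul_nonneg (Nat.cast_nonneg _) (hh0 n m))
    _ = 2 * ∑ n ∈ Finset.Icc 1 (X * K), ∑ m ∈ Finset.Icc 1 (X * K), (if n ≠ m then
          (τ n * (n : ℝ) ^ (-σ)) * (τ m * (m : ℝ) ^ (-σ)) / |Real.log n - Real.log m| else 0) := by
        rw [Finset.mul_sum]
        refine Finset.sum_congr rfl fun n _ => ?_
        rw [Finset.mul_sum, Finset.mul_sum]
        refine Finset.sum_congr rfl fun m _ => ?_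
        simp only [hh]
        split_ifs <;> ring
    _ ≤ 2 * (3 * (1 + Real.log ((X * K : ℕ) : ℝ)) *
          ∑ n ∈ Finset.Icc 1 (X * K), (τ n * (n : ℝ) ^ (-σ)) ^ 2 * n) := by
        gcongr
        exact sum_offDiag_div_log_le (fun n => τ n * (n : ℝ) ^ (-σ)) (fun n => by positivity) _
    _ = _ := by
        rw [← mul_assoc, ← mul_assoc]
        norm_num
        left
        refine Finset.sum_congr rfl fun n hn => ?_
        have hn' : (0 : ℝ) < n := by exact_mod_cast (Finset.mem_Icc.1 hn).1
        rw [mul_pow, mul_assoc, ← Real.rpow_natCast ((n : ℝ) ^ (-σ)), ← Real.rpow_mul hn'.le]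
        congr 1
        nth_rewrite 2 [← Real.rpow_one (n : ℝ)]
        rw [← Real.rpow_add hn']; congr 1; push_cast; ring

/-! ### The mean square of 1 - R M -/

/-- The lengths are about 0.399 √T and 0.564 √T; the lower bound on T makes room for the shifts by 3
and the rounding. In particular the product of the two lengths is at most T. -/
theorem mainLength_bounds {T : ℝ} (hT : 10000 ≤ T) :
    √T / 4 ≤ mainLength (T - 3) ∧ (mainLength (T - 3) : ℝ) ≤ √T / 2 ∧
      (mainLength (2 * T + 3) : ℝ) ≤ √T ∧ 1 ≤ mainLength (T - 3) := by
  have hs : 100 ≤ √T := by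
    rw [show (100 : ℝ) = √10000 by rw [show (10000 : ℝ) = 100 ^ 2 by norm_num]; simp]
    exact Real.sqrt_le_sqrt hT
  have hsq : √T ^ 2 = T := Real.sq_sqrt (by linarith)
  have hp1 := Real.pi_gt_three
  have hp2 := Real.pi_lt_d2
  have h1 : √T / 4 ≤ mainLength (T - 3) := by
    have h2 : √T / 4 + 1 ≤ √((T - 3) / (2 * Real.pi)) := by
      apply Real.le_sqrt_of_sq_le
      rw [le_div_iff₀ (by positivity)]
      have : (√T / 4 + 1) ^ 2 * (2 * Real.pi) ≤ (√T / 4 + 1) ^ 2 * 6.3 := by gcongr; linarith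
      nlinarith
    have h3 := Nat.sub_one_lt_floor (√((T - 3) / (2 * Real.pi)))
    unfold mainLength
    linarith
  have h4 := (le_mainLength_iff (t := T - 3) (by linarith)).1 le_rfl
  have h5 := (le_mainLength_iff (t := 2 * T + 3) (by linarith)).1 le_rfl
  refine ⟨h1, ?_, ?_, ?_⟩
  · refine abs_le_of_sq_le_sq' ?_ (by positivity) |>.2
    have : 6 * (mainLength (T - 3) : ℝ) ^ 2 ≤ 2 * Real.pi * (mainLength (T - 3) : ℝ) ^ 2 := by
      gcongr; linarith
    rw [div_pow, hsq]; linarith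
  · refine abs_le_of_sq_le_sq' ?_ (by positivity) |>.2
    have : 6 * (mainLength (2 * T + 3) : ℝ) ^ 2 ≤ 2 * Real.pi * (mainLength (2 * T + 3) : ℝ) ^ 2 := by
      gcongr; linarith
    rw [hsq]; linarith
  · have : (1 : ℝ) ≤ mainLength (T - 3) := by linarith
    exact_mod_cast this

theorem norm_mollifier_le (X : ℕ) {s : ℂ} (hs : 1 / 2 ≤ s.re) : ‖mollifier X s‖ ≤ 2 * √X := by
  refine le_trans ?_ (sum_Icc_rpow_neg_half_le X)
  refine (norm_sum_le _ _).trans (Finset.sum_le_sum fun d hd => ?_)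
  have hd1 : 1 ≤ d := (Finset.mem_Icc.1 hd).1
  rw [norm_mul, norm_natCast_cpow_of_pos hd1]
  have h1 : ‖(μ d : ℂ)‖ ≤ 1 := by
    rw [norm_intCast]
    exact_mod_cast ArithmeticFunction.abs_moebius_le_one (n := d)
  calc _ ≤ 1 * (d : ℝ) ^ (-s).re := by gcongr
    _ ≤ _ := by
      rw [one_mul]
      exact Real.rpow_le_rpow_of_exponent_le (by exact_mod_cast hd1) (by rw [neg_re]; linarith)

theorem differentiable_mollifier (X : ℕ) : Differentiable ℂ (mollifier X) := by
  unfold mollifier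
  refine Differentiable.fun_sum fun d hd => ?_
  have hd0 : (d : ℂ) ≠ 0 := by
    have := (Finset.mem_Icc.1 hd).1
    exact_mod_cast (by omega : d ≠ 0)
  exact (differentiable_const _).mul (differentiable_neg.const_cpow (Or.inl hd0))

/-- The mean square of `1 - R M` over `[T - 3, 2 T + 3]`, in terms of a divisor sum. -/
theorem exists_integral_norm_one_sub_sq_le : ∃ C, 0 < C ∧ ∀ T : ℝ, 10000 ≤ T → ∀ σ : ℝ, 1 / 2 ≤ σ →
    σ ≤ 4 → ∫ t in (T - 3)..(2 * T + 3),
      ‖1 - riemannAux (σ + t * I) * mollifier (mainLength (T - 3)) (σ + t * I)‖ ^ 2 ≤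
      C * (T ^ (3 / 2 - σ) * Real.log T ^ 2 + Real.log T *
        ∑ n ∈ Finset.Icc 1 (mainLength (T - 3) * mainLength (2 * T + 3)),
          (n.divisors.card : ℝ) ^ 2 * (n : ℝ) ^ (-(2 * σ - 1))) := by
  obtain ⟨C₀, hC₀, hR⟩ := exists_norm_riemannAux_sub_sum_le
  refine ⟨128 * C₀ ^ 2 + 1000000, by positivity, fun T hT σ hσ hσ4 => ?_⟩
  obtain ⟨hX1, hX2, hK, hX⟩ := mainLength_bounds hT
  set A := T - 3 with hA
  set B := 2 * T + 3 with hB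
  set X := mainLength A with hXdef
  set K := mainLength B with hKdef
  set V := ∑ n ∈ Finset.Icc 1 (X * K), (n.divisors.card : ℝ) ^ 2 * (n : ℝ) ^ (-(2 * σ - 1)) with hV
  have hV0 : 0 ≤ V := Finset.sum_nonneg fun n _ => by positivity
  have hp2 := Real.pi_lt_d2
  have hT0 : 0 < T := by linarith
  have hs1 : 1 ≤ √T := Real.one_le_sqrt.2 (by linarith)
  have hsT : √T ^ 2 = T := Real.sq_sqrt hT0.le
  have hℒ : 1 ≤ Real.log T := by
    rw [Real.le_log_iff_exp_le hT0]; linarith [Real.exp_one_lt_d9]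
  have hXK : X ≤ K := mainLength_mono (by linarith)
  have hlogK : Real.log K ≤ Real.log T := by
    refine Real.log_le_log (by exact_mod_cast (by omega : 0 < K)) (hK.trans ?_)
    nlinarith
  have hXKT : ((X * K : ℕ) : ℝ) ≤ T := by
    push_cast
    calc (X : ℝ) * K ≤ (√T / 2) * √T := by gcongr
      _ ≤ T := by nlinarith
  have hlogXK : Real.log ((X * K : ℕ) : ℝ) ≤ Real.log T :=
    Real.log_le_log (by exact_mod_cast Nat.mul_pos (by omega) (by omega)) hXKT
  set D : ℝ := T ^ (1 / 2 - σ) with hD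
  have hD0 : 0 < D := Real.rpow_pos_of_pos hT0 _
  have hTD : T ^ (3 / 2 - σ) = T * D := by
    rw [hD, show (3 / 2 - σ : ℝ) = 1 + (1 / 2 - σ) by ring, Real.rpow_add hT0, Real.rpow_one]
  have hXpow : (X : ℝ) ^ (1 - 2 * σ) ≤ 16384 * D := by
    calc (X : ℝ) ^ (1 - 2 * σ) ≤ (√T / 4) ^ (1 - 2 * σ) :=
          Real.rpow_le_rpow_of_nonpos (by positivity) hX1 (by linarith)
      _ = D * (1 / 4) ^ (1 - 2 * σ) := by
          rw [div_eq_mul_one_div, Real.mul_rpow (by positivity) (by positivity), Real.sqrt_eq_rpow,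
            ← Real.rpow_mul hT0.le]
          congr 2; ring
      -- σ ≤ 4 gives 1 - 2σ ≥ -7, and 4^7 = 16384.
      _ ≤ D * (1 / 4) ^ (-7 : ℝ) := by
          gcongr ?_ * ?_
          exact Real.rpow_le_rpow_of_exponent_ge (by norm_num) (by norm_num) (by linarith)
      _ = 16384 * D := by
          rw [show (-7 : ℝ) = ((-7 : ℤ) : ℝ) by norm_num, Real.rpow_intCast]; norm_num; ring
  have hAB : A ≤ B := by linarith
  have hpt : ∀ t ∈ Set.Icc A B, ‖1 - riemannAux (σ + t * I) * mollifier X (σ + t * I)‖ ^ 2 ≤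
      (131072 * D * (1 + Real.log T) ^ 2 / 2 + 64 * C₀ ^ 2 * D) + 2 * offDiagonal X K σ t := by
    intro t ht
    set Z := zetaPartial (mainLength t) (σ + t * I)
    set R := riemannAux (σ + t * I)
    set M := mollifier X (σ + t * I)
    have e1 : ‖1 - Z * M‖ ^ 2 ≤ X ^ (1 - 2 * σ) * (2 * (1 + Real.log K) ^ 2) + offDiagonal X K σ t :=
      norm_one_sub_sq_le (by linarith) ht.1 ht.2 hσ
    have e2 : ‖R - Z‖ ≤ C₀ * t ^ (-(σ / 2)) := hR σ t (by linarith) hσ4 (by linarith [ht.1])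
    have e3 : ‖M‖ ≤ 2 * √X := norm_mollifier_le X (by simpa using hσ)
    -- The remainder of R, squared, is of order T^{-σ}, and |M|² ≤ 4X is of order √T. The product
    -- T^{1/2-σ} is no larger than the diagonal.
    have e4 : (‖R - Z‖ * ‖M‖) ^ 2 ≤ 32 * C₀ ^ 2 * D := by
      have ht0 : 0 < t := by linarith [ht.1]
      calc (‖R - Z‖ * ‖M‖) ^ 2 ≤ ((C₀ * t ^ (-(σ / 2))) * (2 * √X)) ^ 2 := by gcongr
        _ = 4 * C₀ ^ 2 * t ^ (-σ) * X := by
            rw [mul_pow, mul_pow, mul_pow, Real.sq_sqrt (Nat.cast_nonneg _),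
              ← Real.rpow_natCast (t ^ (-(σ / 2))), ← Real.rpow_mul ht0.le]
            rw [show -(σ / 2) * ((2 : ℕ) : ℝ) = -σ by push_cast; ring]; ring
        _ ≤ 4 * C₀ ^ 2 * (T / 2) ^ (-σ) * (√T / 2) := by
            gcongr ?_ * ?_ * ?_
            exact Real.rpow_le_rpow_of_nonpos (by positivity) (by linarith [ht.1]) (by linarith)
        _ = 2 * C₀ ^ 2 * D * (1 / 2) ^ (-σ) := by
            rw [div_eq_mul_one_div T, Real.mul_rpow hT0.le (by norm_num), hD,
              show (1 / 2 - σ : ℝ) = -σ + 1 / 2 by ring, Real.rpow_add hT0, Real.sqrt_eq_rpow]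
            ring
        _ ≤ 2 * C₀ ^ 2 * D * (1 / 2) ^ (-4 : ℝ) := by
            gcongr ?_ * ?_
            exact Real.rpow_le_rpow_of_exponent_ge (by norm_num) (by norm_num) (by linarith)
        _ = 32 * C₀ ^ 2 * D := by
            rw [show (-4 : ℝ) = ((-4 : ℤ) : ℝ) by norm_num, Real.rpow_intCast]; norm_num; ring
    have e5 : ‖1 - R * M‖ ≤ ‖1 - Z * M‖ + ‖R - Z‖ * ‖M‖ := by
      rw [← norm_mul, show 1 - R * M = (1 - Z * M) - (R - Z) * M by ring]
      exact norm_sub_le _ _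
    have e6 : ‖1 - R * M‖ ^ 2 ≤ 2 * ‖1 - Z * M‖ ^ 2 + 2 * (‖R - Z‖ * ‖M‖) ^ 2 := by
      have := norm_nonneg (1 - R * M)
      nlinarith [sq_nonneg (‖1 - Z * M‖ - ‖R - Z‖ * ‖M‖)]
    have e7 : (X : ℝ) ^ (1 - 2 * σ) * (2 * (1 + Real.log K) ^ 2) ≤
        16384 * D * (2 * (1 + Real.log T) ^ 2) := by
      have : 0 ≤ Real.log K := Real.log_natCast_nonneg K
      gcongr
    linarith
  have hcont : Continuous fun t : ℝ => ‖1 - riemannAux (σ + t * I) * mollifier X (σ + t * I)‖ ^ 2 := by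
    have h1 := differentiable_riemannAux.continuous
    have h2 := (differentiable_mollifier X).continuous
    fun_prop
  have hint := intervalIntegral.integral_mono_on hAB (hcont.intervalIntegrable _ _)
    (intervalIntegrable_const.add ((intervalIntegrable_offDiagonal X K σ A B).const_mul 2)) hpt
  rw [intervalIntegral.integral_add intervalIntegrable_const
    ((intervalIntegrable_offDiagonal X K σ A B).const_mul 2), intervalIntegral.integral_const,
    intervalIntegral.integral_const_mul] at hint
  have hoff := integral_offDiagonal_le X K σ hAB
  rw [← hV] at hoff
  have hoff' : 6 * (1 + Real.log ((X * K : ℕ) : ℝ)) * V ≤ 12 * Real.log T * V :=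
    mul_le_mul_of_nonneg_right (by linarith) hV0
  have hBA : B - A ≤ 2 * T := by linarith
  rw [hTD]
  generalize (∫ t in A..B, offDiagonal X K σ t) = J at *
  refine hint.trans ?_
  clear_value V D
  clear hint hpt hcont hXpow hR hTD hD
  have hsq : (1 + Real.log T) ^ 2 ≤ 4 * Real.log T ^ 2 := by nlinarith
  have hone : 64 * C₀ ^ 2 * D ≤ 64 * C₀ ^ 2 * D * Real.log T ^ 2 :=
    le_mul_of_one_le_right (by positivity) (by nlinarith)
  have hmain : (B - A) • (131072 * D * (1 + Real.log T) ^ 2 / 2 + 64 * C₀ ^ 2 * D) ≤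
      (2 * T) * (131072 * D * (4 * Real.log T ^ 2) / 2 + 64 * C₀ ^ 2 * D * Real.log T ^ 2) := by
    rw [smul_eq_mul]
    refine mul_le_mul hBA (add_le_add ?_ hone) (by positivity) (by positivity)
    gcongr
  have h1 : 0 ≤ T * D * Real.log T ^ 2 := by positivity
  have h2 : 0 ≤ Real.log T * V := by positivity
  have h3 : 0 ≤ C₀ ^ 2 * (Real.log T * V) := by positivity
  linarith

/-- Laplace's method at θ = π, the leftmost point of the circle: 1 + cos θ ≥ 2(θ - π)²/π² reduces to
a Gaussian integral √(π³/(2b)), and π³/2 < 16. The factor 1/√b saves half a logarithm in the zero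
count. -/
theorem integral_exp_neg_one_add_cos_le {b r : ℝ} (hb : 0 < b) (hr : 1 ≤ r) :
    ∫ θ in (0)..(2 * Real.pi), Real.exp (-(b * (r + r * Real.cos θ))) ≤ 4 / √b := by
  have hπ := Real.pi_pos
  set c := 2 * b / Real.pi ^ 2 with hc
  have hc0 : 0 < c := by positivity
  have hint : Integrable fun x : ℝ => Real.exp (-c * x ^ 2) := integrable_exp_neg_mul_sq hc0
  calc ∫ θ in (0)..(2 * Real.pi), Real.exp (-(b * (r + r * Real.cos θ)))
      ≤ ∫ θ in (0)..(2 * Real.pi), (fun x => Real.exp (-c * x ^ 2)) (θ - Real.pi) := by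
        refine intervalIntegral.integral_mono_on (by positivity)
          (Continuous.intervalIntegrable (by fun_prop) _ _)
          (Continuous.intervalIntegrable (by fun_prop) _ _) fun θ hθ => ?_
        have h1 : |θ - Real.pi| ≤ Real.pi := abs_le.2 ⟨by linarith [hθ.1], by linarith [hθ.2]⟩
        have h2 := Real.cos_le_one_sub_mul_cos_sq h1
        rw [Real.cos_sub_pi] at h2
        have h3 : 2 / Real.pi ^ 2 * (θ - Real.pi) ^ 2 ≤ r + r * Real.cos θ := by
          nlinarith [Real.neg_one_le_cos θ]
        refine Real.exp_le_exp.2 ?_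
        have h4 := mul_le_mul_of_nonneg_left h3 hb.le
        have h5 : b * (2 / Real.pi ^ 2 * (θ - Real.pi) ^ 2) = c * (θ - Real.pi) ^ 2 := by
          rw [hc]; ring
        linarith
    _ = ∫ x in (-Real.pi)..Real.pi, Real.exp (-c * x ^ 2) := by
        rw [intervalIntegral.integral_comp_sub_right (fun x => Real.exp (-c * x ^ 2))]
        congr 1 <;> ring
    _ ≤ ∫ x : ℝ, Real.exp (-c * x ^ 2) := by
        rw [intervalIntegral.integral_of_le (by linarith)]
        exact setIntegral_le_integral hint (Filter.Eventually.of_forall fun x => (Real.exp_pos _).le)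
    _ = √(Real.pi / c) := integral_gaussian c
    _ ≤ 4 / √b := by
        rw [show (4 : ℝ) = √16 by rw [show (16 : ℝ) = 4 ^ 2 by norm_num]; simp, ← Real.sqrt_div (by norm_num)]
        apply Real.sqrt_le_sqrt
        rw [hc, div_div_eq_mul_div, div_le_div_iff₀ (by positivity) hb]
        have h6 : Real.pi ^ 3 ≤ 3.15 ^ 3 := by gcongr; exact Real.pi_lt_d2.le
        nlinarith

theorem sum_card_divisors_sq_le_log {T : ℝ} {N : ℕ} (hT : 1 ≤ Real.log T) (hN1 : 1 ≤ N)
    (hN : (N : ℝ) ≤ T) {a : ℝ} :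
    (a ≤ 1 / 2 → ∑ n ∈ Finset.Icc 1 N, (n.divisors.card : ℝ) ^ 2 * (n : ℝ) ^ (-a) ≤
      16 * Real.log T ^ 3 * T ^ (1 - a)) ∧
    (a ≤ 1 → ∑ n ∈ Finset.Icc 1 N, (n.divisors.card : ℝ) ^ 2 * (n : ℝ) ^ (-a) ≤
      16 * Real.log T ^ 4 * T ^ (1 - a)) ∧
    (1 ≤ a → ∑ n ∈ Finset.Icc 1 N, (n.divisors.card : ℝ) ^ 2 * (n : ℝ) ^ (-a) ≤
      16 * Real.log T ^ 4) := by
  have hN0 : (0 : ℝ) < N := by exact_mod_cast hN1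
  have hlog : Real.log N ≤ Real.log T := Real.log_le_log hN0 hN
  have hlog0 : 0 ≤ Real.log N := Real.log_natCast_nonneg N
  have h1 : 1 + Real.log N ≤ 2 * Real.log T := by linarith
  have hT0 : 0 < T := by linarith
  have key : ∀ a : ℝ, a ≤ 1 → ∑ n ∈ Finset.Icc 1 N, (n.divisors.card : ℝ) ^ 2 * (n : ℝ) ^ (-a) ≤
      16 * Real.log T ^ 4 * T ^ (1 - a) := by
    intro a ha
    refine (sum_card_divisors_sq_rpow_le ha
      (fun J hJ => sum_Icc_rpow_neg_le_of_le_one ha hJ) (by linarith)).trans ?_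
    calc _ ≤ (2 * Real.log T) * (2 * Real.log T) ^ 3 * T ^ (1 - a) := by
          gcongr
      _ = _ := by ring
  refine ⟨fun ha => ?_, key a, fun ha => ?_⟩
  · refine (sum_card_divisors_sq_rpow_le (by linarith)
      (fun J _ => sum_Icc_rpow_neg_le_of_le_half ha J) (by norm_num)).trans ?_
    calc _ ≤ 2 * (2 * Real.log T) ^ 3 * T ^ (1 - a) := by
          gcongr; linarith
      _ = _ := by ring
  · calc _ ≤ ∑ n ∈ Finset.Icc 1 N, (n.divisors.card : ℝ) ^ 2 * (n : ℝ) ^ (-1 : ℝ) := by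
          refine Finset.sum_le_sum fun n hn => ?_
          gcongr ?_ * ?_
          exact Real.rpow_le_rpow_of_exponent_le
            (by exact_mod_cast (Finset.mem_Icc.1 hn).1) (by linarith)
      _ ≤ _ := by simpa using key 1 le_rfl

/-- For σ > 3/4 there is a power of T to spare, which swallows surplus logarithms. -/
theorem log_pow_three_le_rpow {T : ℝ} (hT : 1 ≤ T) : Real.log T ^ 3 ≤ 13824 * T ^ (1 / 8 : ℝ) := by
  have h1 := Real.log_le_rpow_div (x := T) (by linarith) (by norm_num : (0 : ℝ) < 1 / 24)
  have h0 := Real.log_nonneg hT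
  calc Real.log T ^ 3 ≤ (T ^ (1 / 24 : ℝ) / (1 / 24)) ^ 3 := by gcongr
    _ = 13824 * (T ^ (1 / 24 : ℝ)) ^ 3 := by ring
    _ = 13824 * T ^ (1 / 8 : ℝ) := by
        rw [← Real.rpow_natCast, ← Real.rpow_mul (by linarith)]; norm_num

/-- The mean square of `1 - R M` decays geometrically to the right of the line `re s = α`. -/
theorem exists_integral_norm_one_sub_sq_le_exp : ∃ C, 0 < C ∧ ∀ T : ℝ, 10000 ≤ T → ∀ α : ℝ,
    1 / 2 ≤ α - 1 / Real.log T → α ≤ 1 → Real.log T ^ 2 ≤ T ^ (α - 1 / 2) → ∀ σ : ℝ,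
    α - 1 / Real.log T ≤ σ → σ ≤ 4 → ∫ t in (T - 3)..(2 * T + 3),
      ‖1 - riemannAux (σ + t * I) * mollifier (mainLength (T - 3)) (σ + t * I)‖ ^ 2 ≤
      C * T ^ (3 / 2 - α) * Real.log T ^ 2 *
        Real.exp (-(Real.log T / 12 * (σ - (α - 1 / Real.log T)))) := by
  obtain ⟨C₀, hC₀, hR⟩ := exists_integral_norm_one_sub_sq_le
  refine ⟨C₀ * 1000000, by positivity, fun T hT α hα hα1 hαT σ hσ hσ4 => ?_⟩
  obtain ⟨-, hX2, hK, hX⟩ := mainLength_bounds hT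
  refine (hR T hT σ (by linarith) hσ4).trans ?_
  have hXK : mainLength (T - 3) ≤ mainLength (2 * T + 3) := mainLength_mono (by linarith)
  have hT0 : 0 < T := by linarith
  have hℒ : 1 ≤ Real.log T := by
    rw [Real.le_log_iff_exp_le hT0]; linarith [Real.exp_one_lt_d9]
  have hN1 : 1 ≤ mainLength (T - 3) * mainLength (2 * T + 3) := Nat.mul_pos hX (by omega)
  have hN : ((mainLength (T - 3) * mainLength (2 * T + 3) : ℕ) : ℝ) ≤ T := by
    push_cast
    calc (mainLength (T - 3) : ℝ) * mainLength (2 * T + 3) ≤ (√T / 2) * √T := by gcongr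
      _ ≤ T := by nlinarith [Real.sq_sqrt hT0.le]
  obtain ⟨v1, v2, v3⟩ := sum_card_divisors_sq_le_log hℒ hN1 hN (a := 2 * σ - 1)
  have hℒ3 := log_pow_three_le_rpow (by linarith : 1 ≤ T)
  generalize ∑ n ∈ Finset.Icc 1 (mainLength (T - 3) * mainLength (2 * T + 3)),
    (n.divisors.card : ℝ) ^ 2 * (n : ℝ) ^ (-(2 * σ - 1)) = V at *
  have he1 : Real.exp 1 ≤ 3 := by linarith [Real.exp_one_lt_d9]
  have he2 : Real.exp 2 ≤ 9 := by
    rw [show (2 : ℝ) = 1 + 1 by norm_num, Real.exp_add]; nlinarith [Real.exp_pos 1]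
  have hrp : ∀ x : ℝ, T ^ x = Real.exp (Real.log T * x) := fun x => Real.rpow_def_of_pos hT0 x
  set ℓ := Real.log T with hℓ
  set η := α - 1 / ℓ with hη
  have hαη : ℓ * α = ℓ * η + 1 := by rw [hη]; field_simp; ring
  have hd : 0 ≤ ℓ * (σ - η) := mul_nonneg (by linarith) (by linarith)
  have hE : T ^ (3 / 2 - α) * Real.exp (-(ℓ / 12 * (σ - η))) =
      Real.exp (ℓ * (3 / 2 - η) - 1 - ℓ / 12 * (σ - η)) := by
    rw [hrp, ← Real.exp_add]; congr 1; linear_combination (-1) * hαη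
  set E := Real.exp (ℓ * (3 / 2 - η) - 1 - ℓ / 12 * (σ - η)) with hEdef
  have hE0 : 0 < E := Real.exp_pos _
  have i1 : T ^ (3 / 2 - σ) ≤ 3 * E := by
    calc T ^ (3 / 2 - σ) ≤ Real.exp 1 * E := by
          rw [hrp, hEdef, ← Real.exp_add]
          refine Real.exp_le_exp.2 ?_
          linarith
      _ ≤ 3 * E := by gcongr
  have i2 : V ≤ 900000 * (ℓ * E) := by
    -- For σ ≤ 3/4 the off-diagonal bound T^{2-2σ} (log T)^3 needs the hypothesis (log T)^2 ≤
    -- T^{α-1/2}. For larger σ a factor T^{1/8} is free; the rate 1/12 is slow enough that the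
    -- claimed decay leaves this room up to σ = 4, where the divisor sum no longer decreases.
    rcases le_or_gt σ (3 / 4) with h | h
    · calc V ≤ 16 * ℓ ^ 3 * T ^ (1 - (2 * σ - 1)) := v1 (by linarith)
        _ = 16 * ℓ * (ℓ ^ 2 * T ^ (1 - (2 * σ - 1))) := by ring
        _ ≤ 16 * ℓ * (T ^ (α - 1 / 2) * T ^ (1 - (2 * σ - 1))) := by gcongr
        _ ≤ 16 * ℓ * (Real.exp 2 * E) := by
            refine mul_le_mul_of_nonneg_left ?_ (by positivity)
            rw [hrp, hrp, ← Real.exp_add, hEdef, ← Real.exp_add]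
            refine Real.exp_le_exp.2 ?_
            linarith
        _ ≤ 16 * ℓ * (9 * E) := by gcongr
        _ ≤ _ := by nlinarith [mul_pos (by linarith : 0 < ℓ) hE0]
    · have j1 : V ≤ 16 * ℓ ^ 4 * Real.exp (ℓ * (11 / 8 - η) - ℓ / 12 * (σ - η)) := by
        rcases le_or_gt σ 1 with h1 | h1
        · refine (v2 (by linarith)).trans ?_
          gcongr
          rw [hrp]
          refine Real.exp_le_exp.2 ?_
          have : ℓ * (3 / 4) ≤ ℓ * σ := by gcongr
          linarith
        · refine (v3 (by linarith)).trans ?_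
          refine le_mul_of_one_le_right (by positivity) (Real.one_le_exp ?_)
          have : 0 ≤ ℓ * (11 / 8 - η - (σ - η) / 12) :=
            mul_nonneg (by linarith) (by
              have : η ≤ 1 := by
                have : 0 ≤ 1 / ℓ := by positivity
                linarith
              linarith)
          linarith
      calc V ≤ 16 * ℓ ^ 4 * Real.exp (ℓ * (11 / 8 - η) - ℓ / 12 * (σ - η)) := j1
        _ = 16 * ℓ * (ℓ ^ 3 * Real.exp (ℓ * (11 / 8 - η) - ℓ / 12 * (σ - η))) := by ring
        _ ≤ 16 * ℓ * ((13824 * T ^ (1 / 8 : ℝ)) * Real.exp (ℓ * (11 / 8 - η) - ℓ / 12 * (σ - η))) := by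
            gcongr
        _ = 16 * ℓ * (13824 * (Real.exp 1 * E)) := by
            rw [hrp, mul_assoc (13824 : ℝ), ← Real.exp_add, hEdef, ← Real.exp_add]
            congr 3; ring
        _ ≤ 16 * ℓ * (13824 * (3 * E)) := by gcongr
        _ ≤ _ := by nlinarith [mul_pos (by linarith : 0 < ℓ) hE0]
  calc C₀ * (T ^ (3 / 2 - σ) * ℓ ^ 2 + ℓ * V) ≤ C₀ * (3 * E * ℓ ^ 2 + ℓ * (900000 * (ℓ * E))) := by
        gcongr
    _ ≤ C₀ * 1000000 * E * ℓ ^ 2 := by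
        have : 0 ≤ C₀ * E * ℓ ^ 2 := by positivity
        nlinarith
    _ = _ := by rw [← hE]; ring

/-! ### The centres on the line re s = 2 -/

/-- On the line `re s = 2` the mollified truncated zeta series is close to one. -/
theorem exists_norm_zetaPartial_mul_mollifier_sub_one_le : ∃ C, 0 < C ∧ ∀ X L : ℕ, 1 ≤ X → X ≤ L →
    ∀ t : ℝ, ‖zetaPartial L (2 + t * I) * mollifier X (2 + t * I) - 1‖ ≤ C * (X : ℝ) ^ (-(1 / 2) : ℝ) := by
  have hsum : Summable fun n : ℕ => (n : ℝ) ^ (-(3 / 2) : ℝ) := Real.summable_nat_rpow.2 (by norm_num)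
  set Z := ∑' n : ℕ, (n : ℝ) ^ (-(3 / 2) : ℝ) with hZ
  have hZ0 : 0 ≤ Z := tsum_nonneg fun n => by positivity
  refine ⟨Z ^ 2 + 1, by positivity, fun X L hX hXL t => ?_⟩
  have hX0 : (0 : ℝ) < X := by exact_mod_cast hX
  have h := zetaPartial_mul_mollifier_sub_one hX (hX.trans hXL) (le_refl L) 2 t
  rw [ofReal_ofNat] at h
  rw [h]
  set P := mollifiedPairs X L with hP
  set W : ℕ × ℕ → ℝ := fun p => if p.2 ≤ L then pairWeight 2 p else 0 with hW
  have hmaps : ∀ p ∈ P, p.1 * p.2 ∈ Finset.Icc 1 (X * L) := fun p hp => by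
    have h1 := mollifiedPairs_subset X L hp
    simp only [Finset.mem_product, Finset.mem_Icc] at h1
    exact Finset.mem_Icc.2 ⟨Nat.mul_pos h1.1.1 h1.2.1, Nat.mul_le_mul h1.1.2 h1.2.2⟩
  have hfib : ∀ n ∈ Finset.Icc 1 (X * L), |∑ p ∈ P.filter (fun p => p.1 * p.2 = n), W p| ≤
      (X : ℝ) ^ (-(1 / 2) : ℝ) * ∑ p ∈ P.filter (fun p => p.1 * p.2 = n),
        ((p.1 * p.2 : ℕ) : ℝ) ^ (-(3 / 2) : ℝ) := by
    intro n hn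
    have hnn : 0 ≤ (X : ℝ) ^ (-(1 / 2) : ℝ) * ∑ p ∈ P.filter (fun p => p.1 * p.2 = n),
        ((p.1 * p.2 : ℕ) : ℝ) ^ (-(3 / 2) : ℝ) := by positivity
    rcases (Finset.mem_Icc.1 hn).1.eq_or_lt with h1 | h1
    · rw [← h1, hP, filter_mollifiedPairs_eq_one]; simp
    rcases le_or_gt n X with h2 | h2
    · rw [hW, hP, sum_pairWeight_fiber le_rfl 2 h1, mollifiedCoeff_eq_zero hXL h1 h2]
      simpa using hnn
    rw [Finset.mul_sum]
    refine (Finset.abs_sum_le_sum_abs _ _).trans (Finset.sum_le_sum fun p hp => ?_)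
    obtain ⟨-, hpn⟩ := Finset.mem_filter.1 hp
    have hn0 : (0 : ℝ) < n := by exact_mod_cast (by omega : 0 < n)
    have h3 : |W p| ≤ ((p.1 * p.2 : ℕ) : ℝ) ^ (-2 : ℝ) := by
      simp only [hW]
      split_ifs
      · exact abs_pairWeight_le 2 p
      · rw [abs_zero]; positivity
    refine h3.trans ?_
    -- Only n > X remain, so n^{-1/2} is given up for X^{-1/2}, and n^{-3/2} still converges over
    -- pairs.
    rw [hpn, show (-2 : ℝ) = -(1 / 2) + -(3 / 2) by norm_num, Real.rpow_add hn0]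
    gcongr ?_ * _
    exact Real.rpow_le_rpow_of_nonpos hX0 (by exact_mod_cast h2.le) (by norm_num)
  have hpart : ∀ N : ℕ, ∑ n ∈ Finset.Icc 1 N, (n : ℝ) ^ (-(3 / 2) : ℝ) ≤ Z := fun N =>
    hsum.sum_le_tsum _ fun n _ => by positivity
  rw [← Finset.sum_fiberwise_of_maps_to hmaps]
  calc _ ≤ ∑ n ∈ Finset.Icc 1 (X * L), |∑ p ∈ P.filter (fun p => p.1 * p.2 = n), W p| := by
        refine (norm_sum_le _ _).trans (Finset.sum_le_sum fun n _ => ?_)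
        have : ∑ p ∈ P.filter (fun p => p.1 * p.2 = n), (W p : ℂ) *
            exp (((-(t * Real.log ((p.1 * p.2 : ℕ) : ℝ)) : ℝ) : ℂ) * I) =
            ((∑ p ∈ P.filter (fun p => p.1 * p.2 = n), W p : ℝ) : ℂ) *
              exp (((-(t * Real.log (n : ℝ)) : ℝ) : ℂ) * I) := by
          rw [ofReal_sum, Finset.sum_mul]
          refine Finset.sum_congr rfl fun p hp => ?_
          rw [(Finset.mem_filter.1 hp).2]
        rw [this, norm_mul, norm_exp_ofReal_mul_I, mul_one, norm_real, Real.norm_eq_abs]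
    _ ≤ ∑ n ∈ Finset.Icc 1 (X * L), (X : ℝ) ^ (-(1 / 2) : ℝ) *
          ∑ p ∈ P.filter (fun p => p.1 * p.2 = n), ((p.1 * p.2 : ℕ) : ℝ) ^ (-(3 / 2) : ℝ) :=
        Finset.sum_le_sum hfib
    _ = (X : ℝ) ^ (-(1 / 2) : ℝ) * ∑ p ∈ P, ((p.1 * p.2 : ℕ) : ℝ) ^ (-(3 / 2) : ℝ) := by
        rw [← Finset.mul_sum, Finset.sum_fiberwise_of_maps_to hmaps]
    _ ≤ (X : ℝ) ^ (-(1 / 2) : ℝ) * ∑ p ∈ Finset.Icc 1 X ×ˢ Finset.Icc 1 L,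
          ((p.1 * p.2 : ℕ) : ℝ) ^ (-(3 / 2) : ℝ) := by
        gcongr
        exact mollifiedPairs_subset X L
    _ = (X : ℝ) ^ (-(1 / 2) : ℝ) * ((∑ d ∈ Finset.Icc 1 X, (d : ℝ) ^ (-(3 / 2) : ℝ)) *
          ∑ k ∈ Finset.Icc 1 L, (k : ℝ) ^ (-(3 / 2) : ℝ)) := by
        rw [Finset.sum_mul_sum, Finset.sum_product]
        congr 1
        refine Finset.sum_congr rfl fun d _ => Finset.sum_congr rfl fun k _ => ?_
        push_cast
        rw [Real.mul_rpow (Nat.cast_nonneg _) (Nat.cast_nonneg _)]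
    _ ≤ (X : ℝ) ^ (-(1 / 2) : ℝ) * (Z * Z) := by
        gcongr
        · exact hpart X
        · exact hpart L
    _ ≤ _ := by
        have : 0 ≤ (X : ℝ) ^ (-(1 / 2) : ℝ) := by positivity
        nlinarith

/-- The tail beyond X, squared, is of order 1/X, and the remainder of R times M is smaller. Over all
centres this costs O(√T) in Jensen's inequality, which is at most T^{3/2-α} for α ≤ 1. -/
theorem exists_norm_one_sub_sq_le_on_line_two : ∃ C, 0 < C ∧ ∀ T : ℝ, 10000 ≤ T →
    ∀ t ∈ Set.Icc (T - 1) (2 * T + 1),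
      ‖1 - riemannAux (2 + t * I) * mollifier (mainLength (T - 3)) (2 + t * I)‖ ^ 2 ≤ C / √T := by
  obtain ⟨C₀, hC₀, hR⟩ := exists_norm_riemannAux_sub_sum_le
  obtain ⟨C₁, hC₁, hZ⟩ := exists_norm_zetaPartial_mul_mollifier_sub_one_le
  refine ⟨8 * C₁ ^ 2 + 4 * C₀ ^ 2, by positivity, fun T hT t ht => ?_⟩
  obtain ⟨hX1, hX2, -, hX⟩ := mainLength_bounds hT
  set X := mainLength (T - 3) with hXdef
  have hT0 : 0 < T := by linarith
  have hs0 : 0 < √T := Real.sqrt_pos.2 hT0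
  have hX0 : (0 : ℝ) < X := by exact_mod_cast hX
  have ht0 : 0 < t := by linarith [ht.1]
  have hXL : X ≤ mainLength t := mainLength_mono (by linarith [ht.1])
  have e1 := hZ X (mainLength t) hX hXL t
  have e2 := hR 2 t (by norm_num) (by norm_num) (by linarith [ht.1, Real.pi_lt_d2])
  rw [ofReal_ofNat] at e2
  have e3 : ‖mollifier X (2 + t * I)‖ ≤ 2 * √X := norm_mollifier_le X (by simp; norm_num)
  set Z := zetaPartial (mainLength t) (2 + t * I)
  set R := riemannAux (2 + t * I)
  set M := mollifier X (2 + t * I)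
  have e2' : ‖R - Z‖ ≤ C₀ * t ^ (-1 : ℝ) := by
    rw [show (-1 : ℝ) = -(2 / 2) by norm_num]; exact e2
  have e5 : ‖1 - R * M‖ ≤ ‖Z * M - 1‖ + ‖R - Z‖ * ‖M‖ := by
    rw [← norm_mul, show 1 - R * M = -(Z * M - 1) - (R - Z) * M by ring, ← norm_neg (Z * M - 1)]
    exact norm_sub_le _ _
  have e6 : ‖1 - R * M‖ ^ 2 ≤ 2 * ‖Z * M - 1‖ ^ 2 + 2 * (‖R - Z‖ * ‖M‖) ^ 2 := by
    have := norm_nonneg (1 - R * M)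
    nlinarith [sq_nonneg (‖Z * M - 1‖ - ‖R - Z‖ * ‖M‖)]
  have e7 : ‖Z * M - 1‖ ^ 2 ≤ 4 * C₁ ^ 2 / √T := by
    calc ‖Z * M - 1‖ ^ 2 ≤ (C₁ * (X : ℝ) ^ (-(1 / 2) : ℝ)) ^ 2 := by gcongr
      _ = C₁ ^ 2 / X := by
          rw [mul_pow, ← Real.rpow_natCast ((X : ℝ) ^ (-(1 / 2) : ℝ)), ← Real.rpow_mul hX0.le,
            show (-(1 / 2) * ((2 : ℕ) : ℝ) : ℝ) = -1 by norm_num, Real.rpow_neg_one]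
          rfl
      _ ≤ C₁ ^ 2 / (√T / 4) := by gcongr
      _ = _ := by field_simp
  have e8 : (‖R - Z‖ * ‖M‖) ^ 2 ≤ 2 * C₀ ^ 2 / √T := by
    calc (‖R - Z‖ * ‖M‖) ^ 2 ≤ ((C₀ * t ^ (-1 : ℝ)) * (2 * √X)) ^ 2 := by gcongr
      _ = 4 * C₀ ^ 2 * X / t ^ 2 := by
          rw [mul_pow, mul_pow, mul_pow, Real.sq_sqrt hX0.le, Real.rpow_neg_one]
          field_simp
          norm_num
      _ ≤ 4 * C₀ ^ 2 * (√T / 2) / T := by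
          gcongr
          nlinarith [ht.1]
      _ = _ := by
          nth_rewrite 2 [← Real.sq_sqrt hT0.le]
          field_simp; ring
  calc _ ≤ 2 * (4 * C₁ ^ 2 / √T) + 2 * (2 * C₀ ^ 2 / √T) := by linarith
    _ = _ := by ring

/-! ### Zeros in a dyadic block -/

/-- `analyticOrderNatAt` sends infinite order to 0, so monotonicity needs a product that is not
identically zero; the point `c` and the identity theorem ensure this. -/
theorem analyticOrderNatAt_le_analyticOrderNatAt_mul {f g : ℂ → ℂ} (hf : Differentiable ℂ f)
    (hg : Differentiable ℂ g) {c : ℂ} (hc : f c * g c ≠ 0) (ρ : ℂ) :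
    analyticOrderNatAt f ρ ≤ analyticOrderNatAt (f * g) ρ := by
  refine ENat.toNat_le_toNat ?_ ?_
  · rw [analyticOrderAt_mul (hf.analyticAt ρ) (hg.analyticAt ρ)]
    exact le_self_add
  · have hfg : AnalyticOnNhd ℂ (f * g) Set.univ := fun z _ => (hf.analyticAt z).mul (hg.analyticAt z)
    refine hfg.analyticOrderAt_ne_top_of_isPreconnected isPreconnected_univ (Set.mem_univ c)
      (Set.mem_univ ρ) ?_
    rw [(analyticOrderAt_eq_zero (f := f * g)).2 (Or.inr hc)]
    simp

/-- Zeros of `R` with `T ≤ im ρ ≤ 2 T`, when `α` is not too close to `1 / 2`. -/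
theorem exists_sum_order_block_le_of_mollified : ∃ C T₀, 0 < C ∧ 10000 ≤ T₀ ∧ ∀ T : ℝ, T₀ ≤ T →
    ∀ α : ℝ, 1 / 2 ≤ α - 1 / Real.log T → α ≤ 1 → Real.log T ^ 2 ≤ T ^ (α - 1 / 2) →
    ∀ S : Finset ℂ, (∀ ρ ∈ S, α ≤ ρ.re ∧ ρ.re ≤ 1 ∧ T ≤ ρ.im ∧ ρ.im ≤ 2 * T) →
      ∑ ρ ∈ S, (analyticOrderNatAt riemannAux ρ : ℝ) ≤ C * T ^ (3 / 2 - α) * Real.log T ^ 3 := by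
  obtain ⟨C₁, hC₁, hline⟩ := exists_norm_one_sub_sq_le_on_line_two
  obtain ⟨C₂, hC₂, hmean⟩ := exists_integral_norm_one_sub_sq_le_exp
  refine ⟨8 * (16 * C₂ + 4 * C₁), max 10000 (4 * C₁ ^ 2), by positivity, le_max_left _ _,
    fun T hT α hα hα1 hαT S hS => ?_⟩
  have hT1 : 10000 ≤ T := (le_max_left _ _).trans hT
  have hT2 : 4 * C₁ ^ 2 ≤ T := (le_max_right _ _).trans hT
  have hT0 : 0 < T := by linarith
  have hs0 : 0 < √T := Real.sqrt_pos.2 hT0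
  have hℒ : 2 ≤ Real.log T := by
    rw [Real.le_log_iff_exp_le hT0, show (2 : ℝ) = 1 + 1 by norm_num, Real.exp_add]
    nlinarith [Real.exp_one_lt_d9, Real.exp_pos 1]
  specialize hline T hT1
  specialize hmean T hT1 α hα hα1 hαT
  set M := mollifier (mainLength (T - 3)) with hM
  set ℓ := Real.log T with hℓ
  have hMd : Differentiable ℂ M := differentiable_mollifier _
  have hRd := differentiable_riemannAux
  have hsmall : C₁ / √T ≤ 1 / 2 := by
    rw [div_le_div_iff₀ hs0 (by norm_num), one_mul]
    exact Real.le_sqrt_of_sq_le (by linarith)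
  set u : ℂ → ℝ := fun s => ‖1 - riemannAux s * M s‖ ^ 2 with hu
  -- With this factor R g = 1 - (1 - RM)², so log|R g| is bounded by |1 - RM|², whose mean is known.
  set g : ℂ → ℂ := fun s => M s * (2 - riemannAux s * M s) with hg
  have hgd : Differentiable ℂ g := hMd.mul ((differentiable_const _).sub (hRd.mul hMd))
  have hfg : ∀ s, (riemannAux * g) s = 1 - (1 - riemannAux s * M s) ^ 2 := fun s => by
    simp only [hg, Pi.mul_apply]; ring
  have hcent : ∀ t ∈ Set.Icc (T - 1) (2 * T + 1), (riemannAux * g) (2 + t * I) ≠ 0 ∧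
      -Real.log ‖(riemannAux * g) (2 + t * I)‖ ≤ 2 * (C₁ / √T) := by
    intro t ht
    have h1 := hline t ht
    set ε := ‖1 - riemannAux (2 + t * I) * M (2 + t * I)‖ ^ 2 with hε
    have h2 : 1 - ε ≤ ‖(riemannAux * g) (2 + t * I)‖ := by
      rw [hfg, hε, ← norm_pow]
      have := norm_sub_norm_le (1 : ℂ) ((1 - riemannAux (2 + t * I) * M (2 + t * I)) ^ 2)
      rwa [norm_one] at this
    have hε0 : 0 ≤ ε := by positivity
    have h3 : 0 < 1 - ε := by linarith
    refine ⟨norm_pos_iff.1 (by linarith), ?_⟩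
    have h4 := Real.log_le_log h3 h2
    have h5 := Real.one_sub_inv_le_log_of_pos h3
    have h6 : (1 - ε)⁻¹ ≤ 1 + 2 * ε := by
      rw [inv_le_iff_one_le_mul₀ h3]; nlinarith
    linarith
  have hne := (hcent T ⟨by linarith, by linarith⟩).1
  have hkey := sum_mult_le_of_mean_le (hRd.mul hgd) (u := u)
    (by have := hRd.continuous; have := hMd.continuous; fun_prop) (fun z => by positivity)
    (fun z => by
      have h1 : ‖(riemannAux * g) z‖ ≤ 1 + u z := by
        rw [hfg]
        refine (norm_sub_le _ _).trans ?_
        simp [hu]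
      rcases (norm_nonneg ((riemannAux * g) z)).eq_or_lt with h0 | h0
      · rw [← h0, Real.log_zero]; positivity
      · linarith [Real.log_le_sub_one_of_pos h0])
    -- Moving left of α by 1/log T changes T^{3/2-σ} by a bounded factor only.
    (δ := 1 / ℓ) (α := α) (r := 2 - α + 1 / ℓ) (T := T) (w := 2 * (C₁ / √T))
    (by positivity) (one_div_le_one_div_of_le (by norm_num) hℒ)
    (by have : 0 < 1 / ℓ := by positivity
        linarith) hα1 rfl hT0.le S (fun ρ => analyticOrderNatAt riemannAux ρ)
    (fun ρ _ => analyticOrderNatAt_le_analyticOrderNatAt_mul hRd hgd hne ρ) hS hcent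
    (G := fun σ => C₂ * T ^ (3 / 2 - α) * ℓ ^ 2 * Real.exp (-(ℓ / 12 * (σ - (α - 1 / ℓ)))))
    (by fun_prop) hmean
  set Q := T ^ (3 / 2 - α) with hQ
  have hQ0 : 0 < Q := Real.rpow_pos_of_pos hT0 _
  have hℓ0 : 0 < ℓ := by linarith
  have hθ : ∫ θ in (0)..(2 * Real.pi), C₂ * Q * ℓ ^ 2 *
      Real.exp (-(ℓ / 12 * (2 + (2 - α + 1 / ℓ) * Real.cos θ - (α - 1 / ℓ)))) ≤
      C₂ * Q * ℓ ^ 2 * (4 / √(ℓ / 12)) := by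
    rw [intervalIntegral.integral_const_mul]
    refine mul_le_mul_of_nonneg_left ?_ (by positivity)
    have := integral_exp_neg_one_add_cos_le (b := ℓ / 12) (r := 2 - α + 1 / ℓ) (by positivity)
      (by have : 0 < 1 / ℓ := by positivity
          linarith)
    refine le_trans (le_of_eq ?_) this
    refine intervalIntegral.integral_congr fun θ _ => ?_
    congr 2; ring
  have hsqrt12 : 4 / √(ℓ / 12) ≤ 16 / √ℓ := by
    have : √ℓ / 4 ≤ √(ℓ / 12) := by
      apply Real.le_sqrt_of_sq_le
      rw [div_pow, Real.sq_sqrt hℓ0.le]; linarith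
    calc 4 / √(ℓ / 12) ≤ 4 / (√ℓ / 4) := by gcongr
      _ = 16 / √ℓ := by field_simp; norm_num
  have hsℓ : 0 < √ℓ := Real.sqrt_pos.2 hℓ0
  have hsℓ2 : √ℓ ^ 2 = ℓ := Real.sq_sqrt hℓ0.le
  have hTQ : (T + 2) * (2 * (C₁ / √T)) ≤ 4 * C₁ * Q := by
    have h1 : √T ≤ Q := by
      rw [Real.sqrt_eq_rpow]
      exact Real.rpow_le_rpow_of_exponent_le (by linarith) (by linarith)
    have h2 : T = √T ^ 2 := (Real.sq_sqrt hT0.le).symm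
    calc (T + 2) * (2 * (C₁ / √T)) ≤ (2 * T) * (2 * (C₁ / √T)) := by gcongr; linarith
      _ = 4 * C₁ * √T := by
          nth_rewrite 1 [h2]; field_simp; norm_num
      _ ≤ _ := by gcongr
  set N := ∑ ρ ∈ S, (analyticOrderNatAt riemannAux ρ : ℝ) with hN
  have hπ : (2 * Real.pi)⁻¹ ≤ 1 := inv_le_one_of_one_le₀ (by linarith [Real.pi_gt_three])
  have h1 : N * (1 / ℓ * √(1 / ℓ) / 8) ≤ C₂ * Q * ℓ ^ 2 * (16 / √ℓ) + 4 * C₁ * Q := by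
    refine hkey.trans (add_le_add ?_ hTQ)
    calc _ ≤ 1 * (C₂ * Q * ℓ ^ 2 * (4 / √(ℓ / 12))) :=
          mul_le_mul hπ hθ (intervalIntegral.integral_nonneg (by positivity)
            fun θ _ => by positivity) (by norm_num)
      _ ≤ _ := by rw [one_mul]; gcongr
  have h2 : N * (1 / ℓ * √(1 / ℓ) / 8) = N / (8 * ℓ * √ℓ) := by
    rw [Real.sqrt_div (by norm_num), Real.sqrt_one]; field_simp
  rw [h2, div_le_iff₀ (by positivity)] at h1
  have h3 : √ℓ ≤ ℓ := by
    rw [Real.sqrt_le_left hℓ0.le]; nlinarith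
  calc N ≤ (C₂ * Q * ℓ ^ 2 * (16 / √ℓ) + 4 * C₁ * Q) * (8 * ℓ * √ℓ) := h1
    _ = 8 * (16 * C₂) * Q * ℓ ^ 3 + 8 * (4 * C₁) * Q * (ℓ * √ℓ) := by field_simp
    _ ≤ 8 * (16 * C₂) * Q * ℓ ^ 3 + 8 * (4 * C₁) * Q * ℓ ^ 3 := by
        gcongr
        nlinarith [mul_le_mul_of_nonneg_left h3 hℓ0.le, mul_pos hℓ0 hℓ0]
    _ = _ := by ring

/-- Zeros of `R` with `T ≤ im ρ ≤ 2 T` to the right of the critical line. -/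
theorem exists_sum_order_block_le : ∃ C T₀, 0 < C ∧ 10000 ≤ T₀ ∧ ∀ T : ℝ, T₀ ≤ T →
    ∀ S : Finset ℂ, (∀ ρ ∈ S, 1 / 2 ≤ ρ.re ∧ ρ.re ≤ 1 ∧ T ≤ ρ.im ∧ ρ.im ≤ 2 * T) →
      ∑ ρ ∈ S, (analyticOrderNatAt riemannAux ρ : ℝ) ≤ C * T * Real.log T := by
  obtain ⟨C₁, hC₁, hline⟩ := exists_norm_one_sub_sq_le_on_line_two
  obtain ⟨C₀, hC₀, hR⟩ := exists_norm_riemannAux_sub_sum_le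
  refine ⟨160, max 10000 (max (4 * C₁ ^ 2) C₀), by positivity, le_max_left _ _,
    fun T hT S hS => ?_⟩
  have hT1 : 10000 ≤ T := (le_max_left _ _).trans hT
  have hT2 : 4 * C₁ ^ 2 ≤ T := (le_max_left _ _).trans ((le_max_right _ _).trans hT)
  have hT3 : C₀ ≤ T := (le_max_right _ _).trans ((le_max_right _ _).trans hT)
  have hT0 : 0 < T := by linarith
  have hs0 : 0 < √T := Real.sqrt_pos.2 hT0
  have hℒ : 1 ≤ Real.log T := by
    rw [Real.le_log_iff_exp_le hT0]; linarith [Real.exp_one_lt_d9]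
  have hRd := differentiable_riemannAux
  have hsmall : C₁ / √T ≤ 1 / 2 := by
    rw [div_le_div_iff₀ hs0 (by norm_num), one_mul]
    exact Real.le_sqrt_of_sq_le (by linarith)
  obtain ⟨-, hX2, -, -⟩ := mainLength_bounds hT1
  have hsT : √T ^ 2 = T := Real.sq_sqrt hT0.le
  have hs1 : 100 ≤ √T := Real.le_sqrt_of_sq_le (by linarith)
  have hcent : ∀ t ∈ Set.Icc (T - 1) (2 * T + 1), riemannAux (2 + t * I) ≠ 0 ∧
      -Real.log ‖riemannAux (2 + t * I)‖ ≤ Real.log T := by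
    intro t ht
    have h1 := hline T hT1 t ht
    have h2 : ‖mollifier (mainLength (T - 3)) (2 + t * I)‖ ≤ 2 * √(mainLength (T - 3)) :=
      norm_mollifier_le _ (by simp; norm_num)
    set R := riemannAux (2 + t * I)
    set M := mollifier (mainLength (T - 3)) (2 + t * I)
    have h3 : 1 - ‖1 - R * M‖ ≤ ‖R * M‖ := by
      have := norm_sub_norm_le (1 : ℂ) (1 - R * M)
      simpa using this
    have h4 : ‖1 - R * M‖ ≤ 3 / 4 := by
      refine abs_le_of_sq_le_sq' ?_ (by norm_num) |>.2
      linarith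
    have h5 : √(mainLength (T - 3)) ≤ √T := by
      apply Real.sqrt_le_sqrt
      nlinarith
    rw [norm_mul] at h3
    have h6 : 1 / 4 ≤ ‖R‖ * (2 * √T) := by
      calc (1 / 4 : ℝ) ≤ ‖R‖ * ‖M‖ := by linarith
        _ ≤ _ := by gcongr; linarith
    have h7 : T⁻¹ ≤ ‖R‖ := by
      rw [inv_le_iff_one_le_mul₀ hT0]
      nlinarith [norm_nonneg R]
    have h8 : 0 < T⁻¹ := by positivity
    refine ⟨norm_pos_iff.1 (by linarith), ?_⟩
    have := Real.log_le_log h8 h7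
    rw [Real.log_inv] at this
    linarith
  have hbound : ∀ σ : ℝ, 1 / 2 - 1 / 2 ≤ σ → σ ≤ 4 → ∀ t ∈ Set.Icc (T - 3) (2 * T + 3),
      Real.log (1 + ‖riemannAux (σ + t * I)‖) ≤ 2 * Real.log T := by
    intro σ hσ hσ4 t ht
    have hσ' : 0 ≤ σ := by linarith
    have h1 := hR σ t hσ' hσ4 (by linarith [ht.1, Real.pi_lt_d2])
    have h2 : ‖∑ n ∈ Finset.Icc 1 (mainLength t), (n : ℂ) ^ (-(σ + t * I : ℂ))‖ ≤ mainLength t := by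
      refine (norm_sum_le _ _).trans ?_
      calc _ ≤ ∑ n ∈ Finset.Icc 1 (mainLength t), (1 : ℝ) := by
            refine Finset.sum_le_sum fun n hn => ?_
            have hn1 := (Finset.mem_Icc.1 hn).1
            rw [norm_natCast_cpow_of_pos hn1]
            exact Real.rpow_le_one_of_one_le_of_nonpos (by exact_mod_cast hn1) (by simpa using hσ')
        _ = _ := by simp
    have h3 : (mainLength t : ℝ) ≤ T := by
      have h4 := (le_mainLength_iff (t := t) (by linarith [ht.1])).1 le_rfl
      have h5 := Real.pi_gt_three
      have h6 : 6 * (mainLength t : ℝ) ^ 2 ≤ 2 * Real.pi * (mainLength t : ℝ) ^ 2 := by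
        gcongr; linarith
      refine abs_le_of_sq_le_sq' ?_ hT0.le |>.2
      nlinarith [ht.2]
    have h4 : C₀ * t ^ (-(σ / 2)) ≤ T := by
      refine (mul_le_of_le_one_right hC₀.le ?_).trans hT3
      exact Real.rpow_le_one_of_one_le_of_nonpos (by linarith [ht.1]) (by linarith)
    have h5 : ‖riemannAux (σ + t * I)‖ ≤ 2 * T := by
      have := norm_sub_norm_le (riemannAux (σ + t * I))
        (∑ n ∈ Finset.Icc 1 (mainLength t), (n : ℂ) ^ (-(σ + t * I : ℂ)))
      unfold mainLength at this h2 h3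
      linarith
    calc _ ≤ Real.log (T ^ 2) := Real.log_le_log (by positivity) (by nlinarith)
      _ = _ := by simp
  have hcontu : Continuous fun s => Real.log (1 + ‖riemannAux s‖) := by
    refine Continuous.log ?_ fun s => by positivity
    have := hRd.continuous
    fun_prop
  have hkey := sum_mult_le_of_mean_le hRd (u := fun s => Real.log (1 + ‖riemannAux s‖)) hcontu
    (fun z => Real.log_nonneg (by linarith [norm_nonneg (riemannAux z)]))
    (fun z => by
      rcases (norm_nonneg (riemannAux z)).eq_or_lt with h0 | h0
      · rw [← h0]; simp
      · exact Real.log_le_log h0 (by linarith))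
    -- No mollifier here: radius 2 reaches back to σ = 0, where the trivial bound |R| ≤ 2T gives a
    -- logarithm of order log T.
    (δ := 1 / 2) (α := 1 / 2) (r := 2 - 1 / 2 + 1 / 2) (T := T) (w := Real.log T)
    (by norm_num) le_rfl le_rfl (by norm_num) rfl hT0.le S (fun ρ => analyticOrderNatAt riemannAux ρ)
    (fun ρ _ => le_rfl) hS hcent (G := fun _ => (T + 6) * (2 * Real.log T)) continuous_const
    (fun σ hσ hσ4 => by
      have h1 : IntervalIntegrable (fun t : ℝ => Real.log (1 + ‖riemannAux (σ + t * I)‖)) volume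
          (T - 3) (2 * T + 3) :=
        (hcontu.comp (by fun_prop : Continuous fun t : ℝ => (σ + t * I : ℂ))).intervalIntegrable _ _
      have := intervalIntegral.integral_mono_on (by linarith) h1 intervalIntegrable_const
        (hbound σ hσ hσ4)
      rw [intervalIntegral.integral_const, smul_eq_mul,
        show 2 * T + 3 - (T - 3) = T + 6 by ring] at this
      exact this)
  rw [intervalIntegral.integral_const, smul_eq_mul, sub_zero, inv_mul_cancel_left₀ (by positivity)]
    at hkey
  set N := ∑ ρ ∈ S, (analyticOrderNatAt riemannAux ρ : ℝ) with hN
  have hN0 : 0 ≤ N := Finset.sum_nonneg fun _ _ => Nat.cast_nonneg _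
  have hhalf : (1 / 2 : ℝ) ≤ √(1 / 2) := Real.le_sqrt_of_sq_le (by norm_num)
  have h1 : N * (1 / 32) ≤ N * (1 / 2 * √(1 / 2) / 8) :=
    mul_le_mul_of_nonneg_left (by linarith) hN0
  have h2 : T * 1 ≤ T * Real.log T := by gcongr
  nlinarith

/-- Zero density bound in a dyadic block. -/
theorem exists_sum_order_block_le_rpow : ∃ C T₀, 0 < C ∧ 10000 ≤ T₀ ∧ ∀ T : ℝ, T₀ ≤ T →
    ∀ α : ℝ, 1 / 2 ≤ α → α ≤ 1 →
    ∀ S : Finset ℂ, (∀ ρ ∈ S, α ≤ ρ.re ∧ ρ.re ≤ 1 ∧ T ≤ ρ.im ∧ ρ.im ≤ 2 * T) →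
      ∑ ρ ∈ S, (analyticOrderNatAt riemannAux ρ : ℝ) ≤ C * T ^ (3 / 2 - α) * Real.log T ^ 3 := by
  obtain ⟨C₁, T₁, hC₁, hT₁, h₁⟩ := exists_sum_order_block_le_of_mollified
  obtain ⟨C₂, T₂, hC₂, hT₂, h₂⟩ := exists_sum_order_block_le
  refine ⟨C₁ + C₂, max T₁ T₂, by positivity, hT₁.trans (le_max_left _ _),
    fun T hT α hα hα1 S hS => ?_⟩
  have hT1 : T₁ ≤ T := (le_max_left _ _).trans hT
  have hT2 : T₂ ≤ T := (le_max_right _ _).trans hT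
  have hT0 : 0 < T := by linarith
  have hℒ : 2 ≤ Real.log T := by
    rw [Real.le_log_iff_exp_le hT0, show (2 : ℝ) = 1 + 1 by norm_num, Real.exp_add]
    nlinarith [Real.exp_one_lt_d9, Real.exp_pos 1]
  have hQ : 0 ≤ T ^ (3 / 2 - α) * Real.log T ^ 3 := by positivity
  -- In the first case α - 1/2 ≥ 2 log log T / log T ≥ 1/log T, since 2 log 2 > 1. In the second, T
  -- = T^{3/2-α} T^{α-1/2} < T^{3/2-α} (log T)², so the bound T log T suffices.
  rcases le_or_gt (Real.log T ^ 2) (T ^ (α - 1 / 2)) with h | h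
  · have h3 : 1 / 2 ≤ α - 1 / Real.log T := by
      have h4 := Real.log_le_log (by positivity) h
      rw [Real.log_rpow hT0, Real.log_pow] at h4
      have h5 : Real.log 2 ≤ Real.log (Real.log T) := Real.log_le_log (by norm_num) hℒ
      have h6 := Real.log_two_gt_d9
      have h7 : 1 / Real.log T ≤ α - 1 / 2 := by
        rw [div_le_iff₀ (by linarith)]
        push_cast at h4
        linarith
      linarith
    refine (h₁ T hT1 α h3 hα1 h S hS).trans ?_
    nlinarith
  · refine (h₂ T hT2 S fun ρ hρ => ⟨hα.trans (hS ρ hρ).1, (hS ρ hρ).2⟩).trans ?_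
    have h3 : T = T ^ (3 / 2 - α) * T ^ (α - 1 / 2) := by
      rw [← Real.rpow_add hT0]; norm_num
    calc C₂ * T * Real.log T = C₂ * (T ^ (3 / 2 - α) * T ^ (α - 1 / 2)) * Real.log T := by rw [← h3]
      _ ≤ C₂ * (T ^ (3 / 2 - α) * Real.log T ^ 2) * Real.log T := by gcongr
      _ ≤ _ := by nlinarith

/-! ### Finiteness and summation over dyadic blocks -/

theorem exists_riemannAux_ne_zero : ∃ s, riemannAux s ≠ 0 := by
  obtain ⟨C, hC, h⟩ := exists_norm_one_sub_sq_le_on_line_two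
  set T := max 10000 (4 * C ^ 2)
  have hT1 : 10000 ≤ T := le_max_left _ _
  refine ⟨2 + T * I, fun h0 => ?_⟩
  have h1 := h T hT1 T ⟨by linarith, by linarith⟩
  have hs0 : 0 < √T := Real.sqrt_pos.2 (by linarith)
  have h2 : 2 * C ≤ √T := Real.le_sqrt_of_sq_le (by
    have : 4 * C ^ 2 ≤ T := le_max_right _ _
    linarith)
  rw [h0, zero_mul, sub_zero, norm_one, one_pow, le_div_iff₀ hs0] at h1
  linarith

theorem finite_setOf_eq_zero_inter_of_isCompact {f : ℂ → ℂ} (hf : Differentiable ℂ f) {c : ℂ}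
    (hc : f c ≠ 0) {K : Set ℂ} (hK : IsCompact K) : ({z | f z = 0} ∩ K).Finite := by
  by_contra hinf
  obtain ⟨z, -, hz⟩ := Set.Infinite.exists_accPt_of_subset_isCompact hinf hK Set.inter_subset_right
  rw [accPt_iff_frequently_nhdsNE] at hz
  have hf' : AnalyticOnNhd ℂ f Set.univ := fun z _ => hf.analyticAt z
  exact hc (hf'.eqOn_zero_of_preconnected_of_frequently_eq_zero isPreconnected_univ (Set.mem_univ z)
    (hz.mono fun w hw => hw.1) (Set.mem_univ c))

/-- The zeros of a nonzero entire function do not accumulate in a compact rectangle. Finiteness also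
keeps the `finsum` in `riemannAuxCount` from taking its default value 0. -/
theorem finite_riemannAuxZeros (α T : ℝ) : (riemannAuxZeros α T).Finite := by
  obtain ⟨c, hc⟩ := exists_riemannAux_ne_zero
  refine (finite_setOf_eq_zero_inter_of_isCompact differentiable_riemannAux hc
    (K := Set.Icc α 1 ×ℂ Set.Icc 0 T) (isCompact_Icc.reProdIm isCompact_Icc)).subset ?_
  rintro ρ ⟨h0, h1, h2, h3, h4⟩
  exact ⟨h0, ⟨h1, h2⟩, ⟨h3.le, h4⟩⟩

theorem riemannAuxCount_eq_sum (α T : ℝ) : (riemannAuxCount α T : ℝ) =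
    ∑ ρ ∈ (finite_riemannAuxZeros α T).toFinset, (analyticOrderNatAt riemannAux ρ : ℝ) := by
  rw [riemannAuxCount, finsum_mem_eq_finite_toFinset_sum _ (finite_riemannAuxZeros α T), Nat.cast_sum]

theorem riemannAuxCount_mono {α β T U : ℝ} (hβ : β ≤ α) (hT : T ≤ U) :
    (riemannAuxCount α T : ℝ) ≤ riemannAuxCount β U := by
  rw [riemannAuxCount_eq_sum, riemannAuxCount_eq_sum]
  refine Finset.sum_le_sum_of_subset_of_nonneg ?_ fun _ _ _ => Nat.cast_nonneg _
  rw [Set.Finite.toFinset_subset_toFinset]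
  rintro ρ ⟨h0, h1, h2, h3, h4⟩
  exact ⟨h0, hβ.trans h1, h2, h3, h4.trans hT⟩

theorem exists_riemannAuxCount_two_mul_le : ∃ C T₀, 0 < C ∧ 10000 ≤ T₀ ∧ ∀ T : ℝ, T₀ ≤ T →
    ∀ α : ℝ, 1 / 2 ≤ α → α ≤ 1 → (riemannAuxCount α (2 * T) : ℝ) ≤
      riemannAuxCount α T + C * T ^ (3 / 2 - α) * Real.log T ^ 3 := by
  obtain ⟨C, T₀, hC, hT₀, h⟩ := exists_sum_order_block_le_rpow
  refine ⟨C, T₀, hC, hT₀, fun T hT α hα hα1 => ?_⟩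
  rw [riemannAuxCount_eq_sum, riemannAuxCount_eq_sum]
  classical
  rw [← Finset.sum_filter_add_sum_filter_not _ (fun ρ : ℂ => ρ.im ≤ T)]
  refine add_le_add ?_ (h T hT α hα hα1 _ fun ρ hρ => ?_)
  · refine Finset.sum_le_sum_of_subset_of_nonneg (fun ρ hρ => ?_) fun _ _ _ => Nat.cast_nonneg _
    rw [Finset.mem_filter, Set.Finite.mem_toFinset] at hρ
    obtain ⟨⟨h0, h1, h2, h3, -⟩, h4⟩ := hρ
    rw [Set.Finite.mem_toFinset]
    exact ⟨h0, h1, h2, h3, h4⟩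
  · rw [Finset.mem_filter, Set.Finite.mem_toFinset] at hρ
    obtain ⟨⟨-, h1, h2, -, h3⟩, h4⟩ := hρ
    exact ⟨h1, h2, (not_le.1 h4).le, h3⟩

/-- Induction on the number of halvings. As α ≤ 1, halving T multiplies T^{3/2-α} by at most
2^{-1/2} ≤ 3/4, so the blocks sum geometrically without a further logarithm. -/
theorem exists_riemannAuxCount_le : ∃ C : ℝ, ∀ α : ℝ, 1 / 2 ≤ α → α ≤ 1 → ∀ T : ℝ, 2 ≤ T →
    (riemannAuxCount α T : ℝ) ≤ C * T ^ (3 / 2 - α) * Real.log T ^ 3 := by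
  obtain ⟨C, T₀, hC, hT₀, h⟩ := exists_riemannAuxCount_two_mul_le
  -- `4 * C` closes the induction through (C' + C) · 3/4 ≤ C'. The factor 8 compensates (log T)³ ≥
  -- 1/8 on the bounded range T ≤ 2T₀.
  set C' := max (4 * C) (8 * riemannAuxCount (1 / 2) (2 * T₀)) with hC'
  refine ⟨C', fun α hα hα1 => ?_⟩
  have hC1 : 4 * C ≤ C' := le_max_left _ _
  have hC2 : 8 * (riemannAuxCount (1 / 2) (2 * T₀) : ℝ) ≤ C' := le_max_right _ _
  suffices H : ∀ k : ℕ, ∀ T : ℝ, 2 ≤ T → T ≤ 2 ^ k * (2 * T₀) →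
      (riemannAuxCount α T : ℝ) ≤ C' * T ^ (3 / 2 - α) * Real.log T ^ 3 by
    intro T hT
    obtain ⟨k, hk⟩ := pow_unbounded_of_one_lt T (by norm_num : (1 : ℝ) < 2)
    refine H k T hT (hk.le.trans (le_mul_of_one_le_right (by positivity) (by linarith)))
  have hsmall : ∀ T : ℝ, 2 ≤ T → T ≤ 2 * T₀ →
      (riemannAuxCount α T : ℝ) ≤ C' * T ^ (3 / 2 - α) * Real.log T ^ 3 := by
    intro T hT hTT
    have h1 : (1 / 2 : ℝ) ≤ Real.log T :=
      (by linarith [Real.log_two_gt_d9] : (1 / 2 : ℝ) ≤ Real.log 2).trans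
        (Real.log_le_log (by norm_num) hT)
    have h2 : 1 ≤ T ^ (3 / 2 - α) := Real.one_le_rpow (by linarith) (by linarith)
    have h3 : (1 / 2 : ℝ) ^ 3 ≤ Real.log T ^ 3 := by gcongr
    calc (riemannAuxCount α T : ℝ) ≤ riemannAuxCount (1 / 2) (2 * T₀) := riemannAuxCount_mono hα hTT
      _ ≤ C' * 1 * (1 / 2) ^ 3 := by linarith
      _ ≤ _ := by gcongr
  intro k
  induction k with
  | zero => intro T hT hTT; exact hsmall T hT (by linarith)
  | succ k ih =>
    intro T hT hTT
    rcases le_or_gt T (2 * T₀) with hle | hgt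
    · exact hsmall T hT hle
    have h1 := ih (T / 2) (by linarith) (by rw [pow_succ] at hTT; linarith)
    have h2 := h (T / 2) (by linarith) α hα hα1
    rw [mul_div_cancel₀ T (by norm_num : (2 : ℝ) ≠ 0)] at h2
    have hT0 : 0 < T := by linarith
    have h3 : (T / 2) ^ (3 / 2 - α) ≤ T ^ (3 / 2 - α) * (3 / 4) := by
      rw [div_eq_mul_one_div, Real.mul_rpow hT0.le (by norm_num)]
      gcongr
      calc (1 / 2 : ℝ) ^ (3 / 2 - α) ≤ (1 / 2) ^ (1 / 2 : ℝ) :=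
            Real.rpow_le_rpow_of_exponent_ge (by norm_num) (by norm_num) (by linarith)
        _ ≤ 3 / 4 := by
            rw [← Real.sqrt_eq_rpow, Real.sqrt_le_left (by norm_num)]; norm_num
    have h4 : Real.log (T / 2) ≤ Real.log T := Real.log_le_log (by linarith) (by linarith)
    have h5 : 0 ≤ Real.log (T / 2) := Real.log_nonneg (by linarith)
    have h6 : (T / 2) ^ (3 / 2 - α) * Real.log (T / 2) ^ 3 ≤
        T ^ (3 / 2 - α) * (3 / 4) * Real.log T ^ 3 := by gcongr
    have h7 : 0 ≤ T ^ (3 / 2 - α) * Real.log T ^ 3 := by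
      have := h5.trans h4
      positivity
    calc (riemannAuxCount α T : ℝ) ≤ (C' + C) * ((T / 2) ^ (3 / 2 - α) * Real.log (T / 2) ^ 3) := by
          linarith
      _ ≤ (C' + C) * (T ^ (3 / 2 - α) * (3 / 4) * Real.log T ^ 3) := by
          gcongr
      _ ≤ _ := by nlinarith

theorem theorem3p2 :
    Differentiable ℂ riemannAux ∧
    ∃ C : ℝ, ∀ α : ℝ, 1 / 2 < α → α ≤ 1 → ∀ T : ℝ, 2 ≤ T →
      (riemannAuxZeros α T).Finite ∧
      (riemannAuxCount α T : ℝ) ≤ C * T ^ (3 / 2 - α) * Real.log T ^ 3 := by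
  obtain ⟨C, hC⟩ := exists_riemannAuxCount_le
  exact ⟨differentiable_riemannAux, C, fun α hα hα1 T hT =>
    ⟨finite_riemannAuxZeros α T, hC α hα.le hα1 T hT⟩⟩
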